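/- Theorem 2. Let $V=[n]$ be partitioned into $k$ unknown nonempty clusters $V=V_1\sqcup\dots\sqcup V_k$, and let $0\le p<\frac12$. For every unordered pair of distinct points $u,v$ a faulty oracle holds one fixed $\pm1$ answer to the question whether $u$ and $v$ lie in the same cluster (so repeating a query repeats the answer); independently for all pairs, this answer is correct with probability $1-p$ and wrong with probability $p$. A maximum likelihood (ML) estimate, given the answers to all $\binom n2$ queries, is a partition $\mathcal P$ of $V$ that maximizes the probability of these answers when $\mathcal P$ is the true clustering. There are absolute constants $C_1,C_2>0$, a sequence $\varepsilon_n\to 0$, and deterministic adaptive query algorithms, one for each $n$ and $p$ (knowing $n$ and $p$, but neither $k$ nor the clusters), such that for all $n$, all $p\in[0,\frac12)$ and every true clustering of $[n]$, with probability at least $1-\varepsilon_n$ over the oracle's answers, all of the following hold, where $k$ is the number of true clusters: (i) the algorithm makes at most $C_1\,\frac{nk\log n}{(1-2p)^2}$ queries; (ii) the partition of $V$ that it returns is an ML estimate given the answers to all $\binom n2$ queries; (iii) every true cluster of size at least $\frac{C_2\log n}{(1-2p)^2}$ is one of the clusters of the returned partition. Moreover, for $p$ bounded away from $0$ (in particular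 as $p\to\frac12$), the query bound is within an $O(\log n)$ factor of the lower-bound expression $\frac{nk}{\Delta(p\|1-p)}$: for every $p_0>0$ there is a constant $C_3>0$ such that $\frac{nk\log n}{(1-2p)^2}\le C_3\log n\cdot\frac{nk}{\Delta(p\|1-p)}$ for all $n,k\ge0$ and all $p\in[p_0,\frac12)$. Here $\Delta(p\|q)=\frac12\big(D(p\|q)+D(q\|p)\big)$, where $D(p\|q)=p\log\frac pq+(1-p)\log\frac{1-p}{1-q}$. -/

import Mathlib

open Filter Topology MeasureTheory

namespace FaultyOracle

/-- A clustering of the points `0, …, n - 1`: a partition of them into disjoint nonempty clusters. -/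
abbrev Clustering (n : ℕ) : Type := Finpartition (Finset.univ : Finset (Fin n))

/-- The possible queries: the unordered pairs of two different points. -/
abbrev Pair (n : ℕ) : Type := {e : Sym2 (Fin n) // ¬ e.IsDiag}

/-- The oracle's answers to all the possible queries; `true` is the answer "same cluster" (`+1`) and
`false` the answer "different clusters" (`-1`). One fixed answer belongs to each pair, so repeating
a query repeats its answer. -/
abbrev Answers (n : ℕ) : Type := Pair n → Bool

/-- The two points of the pair `e` belong to the same cluster of `T`. -/
def SameCluster {n : ℕ} (T : Clustering n) (e : Pair n) : Prop :=
  ∃ S ∈ T.parts, ∀ v ∈ e.1, v ∈ S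

open Classical in
/-- The probability that the answer to the query `e` is `b` when `T` is the true clustering and the
error probability is `p`: `1 - p` for the correct answer and `p` for the incorrect one. -/
noncomputable def answerProb {n : ℕ} (p : ℝ) (T : Clustering n) (e : Pair n) (b : Bool) : ℝ :=
  if (b = true ↔ SameCluster T e) then 1 - p else p

/-- The law of the answers of the faulty oracle with symmetric error `p` when `T` is the true
clustering: the answers to different pairs are independent. -/
noncomputable def oracleLaw {n : ℕ} (p : ℝ) (T : Clustering n) : Measure (Answers n) :=
  Measure.pi fun e => ∑ b : Bool, ENNReal.ofReal (answerProb p T e b) • Measure.dirac b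

/-- The likelihood of the clustering `T`, given the answers to all the queries. -/
noncomputable def likelihood {n : ℕ} (p : ℝ) (a : Answers n) (T : Clustering n) : ℝ :=
  ∏ e : Pair n, answerProb p T e (a e)

/-- `T` is a maximum likelihood estimate of the clustering, given the answers to all the queries. -/
def IsMLEstimate {n : ℕ} (p : ℝ) (a : Answers n) (T : Clustering n) : Prop :=
  ∀ T' : Clustering n, likelihood p a T' ≤ likelihood p a T

/-- A deterministic adaptive query algorithm on `n` points: it either ends and returns a
clustering, or makes a query and continues in a way that depends on the answer. -/
inductive QueryAlgorithm (n : ℕ) : Type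
  | finish (result : Clustering n) : QueryAlgorithm n
  | query (e : Pair n) (next : Bool → QueryAlgorithm n) : QueryAlgorithm n

namespace QueryAlgorithm

/-- The clustering that the algorithm returns when the oracle's answers are `a`. -/
def output {n : ℕ} (a : Answers n) : QueryAlgorithm n → Clustering n
  | finish result => result
  | query e next => output a (next (a e))

/-- The number of queries that the algorithm makes when the oracle's answers are `a`. -/
def numQueries {n : ℕ} (a : Answers n) : QueryAlgorithm n → ℕ
  | finish _ => 0
  | query e next => numQueries a (next (a e)) + 1

end QueryAlgorithm

/-- The Kullback-Leibler divergence of two Bernoulli distributions. -/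
noncomputable def klBernoulli (p q : ℝ) : ℝ :=
  p * Real.log (p / q) + (1 - p) * Real.log ((1 - p) / (1 - q))

/-- The symmetrized divergence `Δ(p‖q) = (D(p‖q) + D(q‖p)) / 2` of two Bernoulli distributions. -/
noncomputable def jsBernoulli (p q : ℝ) : ℝ :=
  (klBernoulli p q + klBernoulli q p) / 2

end FaultyOracle

/-! Write δ = 1 - 2p, L = log n / δ², D = δL and K = 1000000 L. An ML estimate is a partition that
maximizes the agreement, the sum of the ±1 answers over the pairs inside its parts. The heart of the
proof is `Recovers`: for a fixed set Y, with probability at least 1 - 40/n⁴, every optimal labeling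
of Y is exact on the clusters with at least K points in Y, and all its other classes have fewer than
2K points (`prob_not_recovers`).

Given this, the algorithm keeps a set of active points. A new point is queried against all of them
and is dropped, with an active representative, exactly when an optimal labeling puts it with 2K
active points. By `Recovers` this decision is the one that the truth dictates, so the active sets
depend on the true clusters only and not on the answers; hence a union bound over at most n + 2 sets
suffices in spite of adaptivity (`prob_not_recovers_all`). Each of the k clusters has at most 2K + 1
active points, which bounds the queries per point by k(2K + 1). At the end, a cluster with fewer
than K active points is entirely active. On all other clusters both the extended labeling and any
global optimum are exact, and on the rest the labeling of the active points is already optimal, so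
the extension is a global optimum (`IsState.isOptimal`).

For recovery, correct the points of large clusters B that an optimal labeling misplaces. Each of
them lies in order K pairs on which the labeling and the truth disagree, and the answers to these
pairs favour the truth; a union bound pays log n for each point that moves (`ReliableNear`). The
obstacle is the remaining set A: its optimal labeling is a maximum over noise, and misplaced points
X of B may be attached to its classes. A union bound over labelings of A is too expensive. If fewer
than 2|X| points of A lie in small classes, these can be included in the union bound
(`false_of_few_loose`). Otherwise |X| points U of low degree are removed from A and take the places
of the points of X. Pairs between X and A join different clusters, so they are the least likely to
be answered "same". Thus the maximum over labelings with X attached exceeds the one with U attached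
by only O(D|X|), and the latter comes from a labeling of A (`attachment_le`). This loss is smaller
than the gain of the correction (`matched_of_many_loose`).

The comparison of the two maxima is a decoupling inequality (`expect_exp_sup_mul_le`), proved by
induction on the signs: a penalty of 8l² for each used sign of size l compensates the randomness of
the maximum. Its failure probability n^(-10|X|) pays for a union bound over X and U only
(`prob_not_exchangeable`). -/

namespace FaultyOracle

/-! ### Expectations of independent bits as finite sums -/

section ProductExpectation

variable {ι : Type*} [Fintype ι]

/-- Expectation of `F` when the bits are independent and bit `i` is `b` with probability `q i b`. -/
noncomputable def expect [DecidableEq ι] (q : ι → Bool → ℝ) (F : (ι → Bool) → ℝ) : ℝ :=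
  ∑ a : ι → Bool, (∏ i, q i (a i)) * F a

/-- The weights `q` are the laws of random bits. -/
structure IsBitLaw (q : ι → Bool → ℝ) : Prop where
  nonneg : ∀ i b, 0 ≤ q i b
  add_eq_one : ∀ i, q i true + q i false = 1

variable {q : ι → Bool → ℝ}

theorem IsBitLaw.prod_nonneg (hq : IsBitLaw q) (a : ι → Bool) : 0 ≤ ∏ i, q i (a i) :=
  Finset.prod_nonneg fun i _ => hq.nonneg i _

variable [DecidableEq ι]

theorem expect_prod (q g : ι → Bool → ℝ) :
    expect q (fun a => ∏ i, g i (a i)) = ∏ i, (q i true * g i true + q i false * g i false) := by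
  have h := Finset.prod_univ_sum (fun _ : ι => (Finset.univ : Finset Bool))
    (fun i b => q i b * g i b)
  simp only [Fintype.sum_bool, Fintype.piFinset_univ] at h
  rw [h, expect]
  exact Finset.sum_congr rfl fun a _ => by rw [Finset.prod_mul_distrib]

theorem expect_const (hq : IsBitLaw q) (c : ℝ) : expect q (fun _ => c) = c := by
  have h := expect_prod q (fun _ _ => 1)
  simp only [Finset.prod_const_one, mul_one, hq.add_eq_one] at h
  have : expect q (fun _ => c) = expect q (fun _ => (1 : ℝ)) * c := by
    simp only [expect, mul_one, Finset.sum_mul]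
  rw [this, h, one_mul]

theorem expect_mono (hq : IsBitLaw q) {F G : (ι → Bool) → ℝ} (h : ∀ a, F a ≤ G a) :
    expect q F ≤ expect q G :=
  Finset.sum_le_sum fun a _ => mul_le_mul_of_nonneg_left (h a) (hq.prod_nonneg a)

theorem expect_mul_left (c : ℝ) (F : (ι → Bool) → ℝ) :
    expect q (fun a => c * F a) = c * expect q F := by
  simp only [expect, Finset.mul_sum]
  exact Finset.sum_congr rfl fun a _ => by ring

theorem expect_mul_right (c : ℝ) (F : (ι → Bool) → ℝ) :
    expect q (fun a => F a * c) = expect q F * c := by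
  simp only [expect, Finset.sum_mul]
  exact Finset.sum_congr rfl fun a _ => by ring

theorem expect_add (F G : (ι → Bool) → ℝ) :
    expect q (fun a => F a + G a) = expect q F + expect q G := by
  simp only [expect, ← Finset.sum_add_distrib]
  exact Finset.sum_congr rfl fun a _ => by ring

theorem expect_sum {κ : Type*} (s : Finset κ) (F : κ → (ι → Bool) → ℝ) :
    expect q (fun a => ∑ k ∈ s, F k a) = ∑ k ∈ s, expect q (F k) := by
  simp only [expect, Finset.mul_sum]
  rw [Finset.sum_comm]

theorem expect_pos (hq : IsBitLaw q) {F : (ι → Bool) → ℝ} (h : ∀ a, 0 < F a) :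
    0 < expect q F := by
  obtain ⟨a₀, -, ha₀⟩ := Finset.exists_min_image (Finset.univ : Finset (ι → Bool)) F
    Finset.univ_nonempty
  calc 0 < F a₀ := h a₀
    _ = expect q (fun _ => F a₀) := (expect_const hq _).symm
    _ ≤ expect q F := expect_mono hq fun a => ha₀ a (Finset.mem_univ a)

/-- Resampling the bits in `I` does not change an expectation. -/
theorem expect_mix (hq : IsBitLaw q) (I : ι → Prop) [DecidablePred I] (F : (ι → Bool) → ℝ) :
    expect q (fun a => expect q fun b => F fun i => if I i then b i else a i) = expect q F := by
  -- Exchanging the coordinates in `I` between two independent samples is an involution that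
  -- preserves the product of their weights.
  obtain ⟨e, he⟩ : ∃ e : ((ι → Bool) × (ι → Bool)) ≃ ((ι → Bool) × (ι → Bool)), ∀ a b,
      e (a, b) = (fun i => if I i then b i else a i, fun i => if I i then a i else b i) := by
    refine ⟨Function.Involutive.toPerm
      (fun x => (fun i => if I i then x.2 i else x.1 i, fun i => if I i then x.1 i else x.2 i))
      ?_, fun a b => rfl⟩
    rintro ⟨a, b⟩
    ext i <;> by_cases h : I i <;> simp [h]
  have h1 : expect q F = ∑ x : (ι → Bool) × (ι → Bool),
      (∏ i, q i (x.1 i)) * (∏ i, q i (x.2 i)) * F x.1 := by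
    rw [Fintype.sum_prod_type]
    simp only [expect]
    refine Finset.sum_congr rfl fun a _ => ?_
    have := expect_const hq (F a)
    simp only [expect] at this
    rw [← this, Finset.mul_sum]
    exact Finset.sum_congr rfl fun b _ => by rw [this]; ring
  rw [h1, ← Equiv.sum_comp e, Fintype.sum_prod_type]
  simp only [expect, Finset.mul_sum]
  refine Finset.sum_congr rfl fun a _ => Finset.sum_congr rfl fun b _ => ?_
  rw [← mul_assoc, he]
  congr 1
  rw [← Finset.prod_mul_distrib, ← Finset.prod_mul_distrib]
  refine Finset.prod_congr rfl fun i _ => ?_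
  by_cases h : I i <;> simp [h, mul_comm]

theorem expect_apply (hq : IsBitLaw q) (i : ι) (g : Bool → ℝ) :
    expect q (fun a => g (a i)) = q i true * g true + q i false * g false := by
  have h := expect_prod q (fun j b => if j = i then g b else 1)
  have h2 : (fun a : ι → Bool => ∏ j, if j = i then g (a j) else 1) = fun a => g (a i) := by
    ext a; simp
  rw [h2] at h
  rw [h, Finset.prod_eq_single i]
  · simp
  · intro j _ hj
    simp [hj, hq.add_eq_one]
  · simp

theorem expect_update (hq : IsBitLaw q) (i : ι) (F : (ι → Bool) → ℝ) :
    expect q F = q i true * expect q (fun a => F (Function.update a i true)) +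
      q i false * expect q (fun a => F (Function.update a i false)) := by
  rw [← expect_mix hq (fun j => j = i) F]
  have h : ∀ a b : ι → Bool, (fun j => if j = i then b j else a j) = Function.update a i (b i) := by
    intro a b; ext j
    by_cases hj : j = i
    · subst hj; simp
    · simp [hj]
  simp only [h]
  have h2 : ∀ a : ι → Bool, expect q (fun b => F (Function.update a i (b i))) =
      q i true * F (Function.update a i true) + q i false * F (Function.update a i false) :=
    fun a => expect_apply hq i fun c => F (Function.update a i c)
  simp only [h2]
  rw [expect_add, expect_mul_left, expect_mul_left]

/-- The probability of `P` when the bits are independent with laws `q`. -/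
noncomputable def prob (q : ι → Bool → ℝ) (P : (ι → Bool) → Prop) : ℝ :=
  open Classical in expect q fun a => if P a then 1 else 0

theorem prob_le_expect (hq : IsBitLaw q) {P : (ι → Bool) → Prop} {F : (ι → Bool) → ℝ}
    (h0 : ∀ a, 0 ≤ F a) (h1 : ∀ a, P a → 1 ≤ F a) : prob q P ≤ expect q F := by
  refine expect_mono hq fun a => ?_
  split_ifs with h
  · exact h1 a h
  · exact h0 a

theorem prob_mono (hq : IsBitLaw q) {P Q : (ι → Bool) → Prop} (h : ∀ a, P a → Q a) :
    prob q P ≤ prob q Q := by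
  refine expect_mono hq fun a => ?_
  by_cases hP : P a
  · simp [hP, h a hP]
  · simp only [hP, if_false]; split_ifs <;> norm_num

theorem prob_exists_le (hq : IsBitLaw q) {κ : Type*} (s : Finset κ)
    (P : κ → (ι → Bool) → Prop) : prob q (fun a => ∃ k ∈ s, P k a) ≤ ∑ k ∈ s, prob q (P k) := by
  classical
  simp only [prob]
  rw [← expect_sum]
  refine expect_mono hq fun a => ?_
  have h0 : ∀ k ∈ s, (0 : ℝ) ≤ if P k a then 1 else 0 := fun k _ => by split_ifs <;> norm_num
  split_ifs with h
  · obtain ⟨k, hk, hP⟩ := h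
    calc (1 : ℝ) = if P k a then 1 else 0 := by simp [hP]
      _ ≤ _ := Finset.single_le_sum h0 hk
  · exact Finset.sum_nonneg h0

theorem prob_or_le (hq : IsBitLaw q) (P Q : (ι → Bool) → Prop) :
    prob q (fun a => P a ∨ Q a) ≤ prob q P + prob q Q := by
  simp only [prob]
  rw [← expect_add]
  refine expect_mono hq fun a => ?_
  by_cases h1 : P a <;> by_cases h2 : Q a <;> simp [h1, h2]

theorem prob_not (hq : IsBitLaw q) (P : (ι → Bool) → Prop) :
    prob q (fun a => ¬ P a) = 1 - prob q P := by
  have h : prob q (fun a => ¬ P a) + prob q P = 1 := by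
    simp only [prob]
    rw [← expect_add]
    refine Eq.trans ?_ (expect_const hq 1)
    congr 1
    ext a
    by_cases h1 : P a <;> simp [h1]
  linarith

/-- A union bound over the labelings that differ from `base`. -/
theorem prob_exists_labeling_le (hq : IsBitLaw q) {V Lab : Type*} [Fintype V] [DecidableEq V]
    [Fintype Lab] [DecidableEq Lab] (base : V → Lab) (P : (V → Lab) → (ι → Bool) → Prop) {r : ℝ}
    (hr : 0 ≤ r) (hP : ∀ c, c ≠ base →
      prob q (P c) ≤ r ^ (Finset.univ.filter fun v => c v ≠ base v).card)
    (hsmall : (Fintype.card V : ℝ) * Fintype.card Lab * r ≤ 1) :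
    prob q (fun a => ∃ c, c ≠ base ∧ P c a) ≤ 2 * (Fintype.card V * Fintype.card Lab * r) := by
  have h1 : prob q (fun a => ∃ c, c ≠ base ∧ P c a) ≤
      ∑ c ∈ Finset.univ.erase base, r ^ (Finset.univ.filter fun v => c v ≠ base v).card := by
    refine le_trans (prob_mono hq (Q := fun a => ∃ c ∈ Finset.univ.erase base, P c a) ?_) ?_
    · rintro a ⟨c, hc, h⟩
      exact ⟨c, by simp [hc], h⟩
    · refine (prob_exists_le hq _ _).trans (Finset.sum_le_sum fun c hc => hP c ?_)
      simpa using hc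
  -- Summed over all labelings, r to the power of the distance factorizes over the points. Each
  -- factor is at most 1 + |Lab| r, so the total is at most e^y with y = |V| |Lab| r.
  have h2 : ∑ c : V → Lab, r ^ (Finset.univ.filter fun v => c v ≠ base v).card =
      ∏ v : V, ∑ b : Lab, if b ≠ base v then r else 1 := by
    rw [Finset.prod_univ_sum, Fintype.piFinset_univ]
    refine Finset.sum_congr rfl fun c _ => ?_
    rw [Finset.prod_ite, Finset.prod_const, Finset.prod_const_one, mul_one]
  have h3 : ∀ v : V, ∑ b : Lab, (if b ≠ base v then r else 1) ≤ 1 + Fintype.card Lab * r := by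
    intro v
    rw [Finset.sum_ite, Finset.sum_const, Finset.sum_const, nsmul_eq_mul, nsmul_eq_mul]
    have h5 : (Finset.univ.filter fun b : Lab => ¬ b ≠ base v) = {base v} := by
      ext b; simp
    have h4 : ((Finset.univ.filter fun b : Lab => b ≠ base v).card : ℝ) ≤ Fintype.card Lab := by
      exact_mod_cast Finset.card_le_univ _
    rw [h5]
    have := mul_le_mul_of_nonneg_right h4 hr
    simp only [Finset.card_singleton, Nat.cast_one, mul_one]
    linarith
  set y : ℝ := Fintype.card V * Fintype.card Lab * r with hy
  have hy0 : 0 ≤ y := by positivity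
  have h6 : ∏ v : V, ∑ b : Lab, (if b ≠ base v then r else 1) ≤ Real.exp y := by
    calc _ ≤ ∏ v : V, (1 + Fintype.card Lab * r) := Finset.prod_le_prod
          (fun v _ => Finset.sum_nonneg fun b _ => by split_ifs <;> linarith) fun v _ => h3 v
      _ = (1 + Fintype.card Lab * r) ^ Fintype.card V := by simp
      _ ≤ (Real.exp (Fintype.card Lab * r)) ^ Fintype.card V := by
          refine pow_le_pow_left₀ (by positivity) ?_ _
          linarith [Real.add_one_le_exp ((Fintype.card Lab : ℝ) * r)]
      _ = Real.exp y := by rw [← Real.exp_nat_mul, hy]; ring_nf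
  -- The labeling `base` itself contributes 1, and e^y - 1 ≤ 2y for 0 ≤ y ≤ 1.
  have h7 := Real.abs_exp_sub_one_le (x := y) (by rw [abs_of_nonneg hy0]; exact hsmall)
  rw [abs_of_nonneg hy0] at h7
  have h8 := le_abs_self (Real.exp y - 1)
  have h9 := Finset.sum_erase_add (s := Finset.univ)
    (f := fun c : V → Lab => r ^ (Finset.univ.filter fun v => c v ≠ base v).card)
    (Finset.mem_univ base)
  simp only [ne_eq, not_true_eq_false, Finset.filter_false, Finset.card_empty, pow_zero] at h9
  simp only [ne_eq] at h1 h2 h6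
  linarith

end ProductExpectation

/-! ### A decoupling inequality for maxima of sums of signs -/

section Tensorization

variable {ι : Type*} [Fintype ι] [DecidableEq ι] {q : ι → Bool → ℝ}

/-- The sign of an answer. -/
def sg (b : Bool) : ℝ := if b then 1 else -1

theorem exp_quadratic_bound {x : ℝ} (hx : |x| ≤ 1) : Real.exp x ≤ 1 + x + x ^ 2 := by
  have h := Real.abs_exp_sub_one_sub_id_le hx
  have := le_abs_self (Real.exp x - 1 - x)
  linarith

/-- The two-point case of the decoupling inequality. -/
theorem two_point_decoupling {p p' d θ α β : ℝ} (hp0 : 0 ≤ p) (hp' : p ≤ p') (hp1 : p' ≤ 1)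
    (hd0 : 0 ≤ d) (hd : 2 * d ≤ θ) (hθ : θ ≤ 1) (hα : α ≤ Real.exp ((1 - θ) * d)) (hα0 : 0 ≤ α)
    (hβ : β ≤ 1) (hβ0 : 0 ≤ β) :
    ((1 - p) * β + p * α) * ((1 - p') + p' * Real.exp (-d)) ≤ 1 := by
  have hed : Real.exp (-d) ≤ 1 - d + d ^ 2 := by
    have := exp_quadratic_bound (x := -d) (by rw [abs_neg, abs_of_nonneg hd0]; linarith)
    nlinarith
  have hed2 : Real.exp (-d) ≤ 1 - d + d ^ 2 / 2 := by
    have h := Real.exp_bound' (x := d) hd0 (by linarith) (n := 2) (by norm_num)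
    have h1 := Real.quadratic_le_exp_of_nonneg hd0
    have h2 : Real.exp (-d) * Real.exp d = 1 := by rw [← Real.exp_add]; simp
    have h3 : (1 - d + d ^ 2 / 2) * (1 + d + d ^ 2 / 2) ≥ 1 := by nlinarith [sq_nonneg (d ^ 2)]
    have h4 : 0 < Real.exp (-d) := Real.exp_pos _
    have h5 : 0 < Real.exp d := Real.exp_pos _
    have h6 : 0 ≤ 1 - d + d ^ 2 / 2 := by nlinarith [sq_nonneg (d - 1)]
    have h7 : Real.exp (-d) * Real.exp d ≤ (1 - d + d ^ 2 / 2) * Real.exp d := by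
      rw [h2]
      calc 1 ≤ (1 - d + d ^ 2 / 2) * (1 + d + d ^ 2 / 2) := h3
        _ ≤ _ := mul_le_mul_of_nonneg_left h1 h6
    exact le_of_mul_le_mul_right h7 h5
  -- Since θ ≥ 2d, the damping turns e^d into at most e^(d - 2d²), which is below 1 + d - d²/2 and
  -- so below 2 - e^(-d).
  have hk : Real.exp ((1 - θ) * d) ≤ 2 - Real.exp (-d) := by
    have h1 : (1 - θ) * d ≤ d - 2 * d ^ 2 := by nlinarith
    have h2 := exp_quadratic_bound (x := d - 2 * d ^ 2) (by
      rw [abs_le]; constructor <;> nlinarith)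
    have h3 := Real.exp_le_exp.2 h1
    nlinarith [mul_nonneg hd0 hd0, mul_nonneg (mul_nonneg hd0 hd0) hd0]
  have hρ0 : 0 < Real.exp (-d) := Real.exp_pos _
  have hρ1 : Real.exp (-d) ≤ 1 := Real.exp_le_one_iff.2 (by linarith)
  set ρ := Real.exp (-d)
  -- With α ≤ 2 - ρ and p ≤ p', the two factors are bounded by 1 + x and 1 - x for the same x = p(1
  -- - ρ).
  have h1 : (1 - p) * β + p * α ≤ 1 + p * (1 - ρ) := by nlinarith
  have h2 : (1 - p') + p' * ρ ≤ 1 - p * (1 - ρ) := by nlinarith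
  have h3 : 0 ≤ (1 - p) * β + p * α :=
    add_nonneg (mul_nonneg (by linarith) hβ0) (mul_nonneg hp0 hα0)
  have h4 : 0 ≤ (1 - p') + p' * ρ := add_nonneg (by linarith) (mul_nonneg (by linarith) hρ0.le)
  calc _ ≤ (1 + p * (1 - ρ)) * (1 - p * (1 - ρ)) := mul_le_mul h1 h2 h4 (h3.trans h1)
    _ ≤ 1 := by nlinarith [sq_nonneg (p * (1 - ρ))]

/-- Decoupling for a maximum of sums of signs: penalizing every sign that is used makes the
exponential moment of the maximum at most the one of an independent dominating copy. -/
theorem expect_exp_sup_mul_le (hq : IsBitLaw q) {J κ : Type*} [DecidableEq J] {e₁ e₂ : J → ι}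
    (h₁ : Function.Injective e₁) (h₂ : Function.Injective e₂) {l : ℝ} (hl0 : 0 ≤ l)
    (hl : l ≤ 1 / 4) (s : Finset κ) (hs : s.Nonempty) (M : κ → Finset J) (S : Finset J)
    (hdom : ∀ j ∈ S, q (e₁ j) true ≤ q (e₂ j) true) (b : κ → ℝ) :
    expect q (fun x => Real.exp (s.sup' hs fun k =>
      b k + ∑ j ∈ S, if j ∈ M k then l * sg (x (e₁ j)) - 8 * l ^ 2 else 0)) *
    expect q (fun y => Real.exp (-(s.sup' hs fun k =>
      b k + ∑ j ∈ S, if j ∈ M k then l * sg (y (e₂ j)) else 0))) ≤ 1 := by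
  induction S using Finset.induction_on generalizing b with
  | empty =>
    simp only [Finset.sum_empty, add_zero]
    rw [expect_const hq, expect_const hq, ← Real.exp_add]
    simp
  | insert i S hi ih =>
    -- The induction hypothesis, applied to the offsets shifted by the sign `i`, bounds the moment
    -- of the copy by 1 / A t. What remains is a two-point inequality between values of A; the
    -- penalty 8l² turns the sign ±1 into ±1 - 8l.
    have ih' := ih fun j hj => hdom j (Finset.mem_insert_of_mem hj)
    -- the exponential moments with the sign `i` replaced by a number
    let bt : ℝ → κ → ℝ := fun t k => b k + if i ∈ M k then l * t else 0
    let g : ℝ → (ι → Bool) → ℝ := fun t x => s.sup' hs fun k =>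
      bt t k + ∑ j ∈ S, if j ∈ M k then l * sg (x (e₁ j)) - 8 * l ^ 2 else 0
    let A : ℝ → ℝ := fun t => expect q fun x => Real.exp (g t x)
    let f : ℝ → (ι → Bool) → ℝ := fun t y => s.sup' hs fun k =>
      bt t k + ∑ j ∈ S, if j ∈ M k then l * sg (y (e₂ j)) else 0
    have hApos : ∀ t, 0 < A t := fun t => expect_pos hq fun _ => Real.exp_pos _
    have hB : ∀ t, expect q (fun y => Real.exp (-(f t y))) ≤ 1 / A t := by
      intro t
      rw [le_div_iff₀ (hApos t), mul_comm]
      exact ih' (bt t)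
    have hbt : ∀ t t', t ≤ t' → ∀ k, bt t k ≤ bt t' k := by
      intro t t' htt k
      simp only [bt]
      split_ifs
      · have := mul_le_mul_of_nonneg_left htt hl0
        linarith
      · exact le_rfl
    have hgmono : ∀ t t', t ≤ t' → ∀ x, g t x ≤ g t' x := fun t t' htt x =>
      Finset.sup'_mono_fun fun k _ => add_le_add (hbt t t' htt k) le_rfl
    have hAmono : ∀ t t', t ≤ t' → A t ≤ A t' := fun t t' htt =>
      expect_mono hq fun x => Real.exp_le_exp.2 (hgmono t t' htt x)
    -- Flipping one sign changes every competitor by at most 2l, hence also the maximum. So d = log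
    -- (A 1 / A (-1)) is at most 2l, which is the condition 2d ≤ θ for θ = 4l.
    have hAlip : A 1 ≤ Real.exp (2 * l) * A (-1) := by
      rw [← expect_mul_left]
      refine expect_mono hq fun x => ?_
      rw [← Real.exp_add, Real.exp_le_exp]
      refine Finset.sup'_le _ _ fun k hk => ?_
      have h1 : bt (-1) k + (∑ j ∈ S, if j ∈ M k then l * sg (x (e₁ j)) - 8 * l ^ 2 else 0)
          ≤ g (-1) x := Finset.le_sup' (fun k => bt (-1) k +
            ∑ j ∈ S, if j ∈ M k then l * sg (x (e₁ j)) - 8 * l ^ 2 else 0) hk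
      have h2 : bt 1 k ≤ 2 * l + bt (-1) k := by
        simp only [bt]
        split_ifs <;> linarith
      linarith
    -- splitting off the sign `i`
    have hX : expect q (fun x => Real.exp (s.sup' hs fun k =>
        b k + ∑ j ∈ insert i S, if j ∈ M k then l * sg (x (e₁ j)) - 8 * l ^ 2 else 0)) =
        q (e₁ i) true * A (1 - 8 * l) + q (e₁ i) false * A (-1 - 8 * l) := by
      rw [expect_update hq (e₁ i)]
      have key : ∀ c : Bool, (fun x : ι → Bool => Real.exp (s.sup' hs fun k =>
          b k + ∑ j ∈ insert i S, if j ∈ M k then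
            l * sg (Function.update x (e₁ i) c (e₁ j)) - 8 * l ^ 2 else 0)) =
          fun x => Real.exp (g (sg c - 8 * l) x) := by
        intro c
        ext x
        congr 1
        refine Finset.sup'_congr hs rfl fun k _ => ?_
        rw [Finset.sum_insert hi, Function.update_self, ← add_assoc]
        congr 1
        · simp only [bt]
          split_ifs <;> ring
        · refine Finset.sum_congr rfl fun j hj => ?_
          rw [Function.update_of_ne (by intro h; exact hi (h₁ h ▸ hj))]
      rw [key true, key false]
      simp [sg, A]
    have hY : expect q (fun y => Real.exp (-(s.sup' hs fun k =>
        b k + ∑ j ∈ insert i S, if j ∈ M k then l * sg (y (e₂ j)) else 0))) =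
        q (e₂ i) true * expect q (fun y => Real.exp (-(f 1 y))) +
        q (e₂ i) false * expect q (fun y => Real.exp (-(f (-1) y))) := by
      rw [expect_update hq (e₂ i)]
      have key : ∀ c : Bool, (fun y : ι → Bool => Real.exp (-(s.sup' hs fun k =>
          b k + ∑ j ∈ insert i S, if j ∈ M k then
            l * sg (Function.update y (e₂ i) c (e₂ j)) else 0))) =
          fun y => Real.exp (-(f (sg c) y)) := by
        intro c
        ext y
        congr 2
        refine Finset.sup'_congr hs rfl fun k _ => ?_
        rw [Finset.sum_insert hi, Function.update_self, ← add_assoc]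
        congr 1
        refine Finset.sum_congr rfl fun j hj => ?_
        rw [Function.update_of_ne (by intro h; exact hi (h₂ h ▸ hj))]
      rw [key true, key false]
      simp [sg]
    rw [hX, hY]
    set d := Real.log (A 1 / A (-1)) with hd
    have hratio : 0 < A 1 / A (-1) := div_pos (hApos _) (hApos _)
    have hA1 : A 1 = Real.exp d * A (-1) := by
      rw [hd, Real.exp_log hratio, div_mul_cancel₀ _ (hApos _).ne']
    have hd0 : 0 ≤ d := Real.log_nonneg (by
      rw [le_div_iff₀ (hApos _), one_mul]; exact hAmono _ _ (by norm_num))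
    have hd2 : d ≤ 2 * l := by
      rw [hd, Real.log_le_iff_le_exp hratio, div_le_iff₀ (hApos _)]
      exact hAlip
    -- log-convexity of `A`
    have hconv : A (1 - 8 * l) ≤ Real.exp ((1 - 4 * l) * d) * A (-1) := by
      -- The point 1 - 8l is the convex combination of 1 and -1 with weights 1 - 4l and 4l. Tilting
      -- by d makes the two terms have equal expectation, so that pointwise convexity of exp gives
      -- the log-convex bound without Hölder's inequality.
      have hpt : ∀ x, Real.exp (g (1 - 8 * l) x) ≤ Real.exp ((1 - 4 * l) * d) *
          ((1 - 4 * l) * (Real.exp (-d) * Real.exp (g 1 x)) + 4 * l * Real.exp (g (-1) x)) := by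
        intro x
        have h1 : g (1 - 8 * l) x ≤ (1 - 4 * l) * g 1 x + 4 * l * g (-1) x := by
          refine Finset.sup'_le _ _ fun k hk => ?_
          set R := ∑ j ∈ S, if j ∈ M k then l * sg (x (e₁ j)) - 8 * l ^ 2 else 0
          have h1 : bt 1 k + R ≤ g 1 x := Finset.le_sup' (fun k => bt 1 k +
            ∑ j ∈ S, if j ∈ M k then l * sg (x (e₁ j)) - 8 * l ^ 2 else 0) hk
          have h2 : bt (-1) k + R ≤ g (-1) x := Finset.le_sup' (fun k => bt (-1) k +
            ∑ j ∈ S, if j ∈ M k then l * sg (x (e₁ j)) - 8 * l ^ 2 else 0) hk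
          have h3 : bt (1 - 8 * l) k = (1 - 4 * l) * bt 1 k + 4 * l * bt (-1) k := by
            simp only [bt]
            split_ifs <;> ring
          have h4 := mul_le_mul_of_nonneg_left h1 (by linarith : 0 ≤ 1 - 4 * l)
          have h5 := mul_le_mul_of_nonneg_left h2 (by linarith : 0 ≤ 4 * l)
          rw [h3]
          linarith
        have h2 := (convexOn_exp).2 (Set.mem_univ (g 1 x - d)) (Set.mem_univ (g (-1) x))
          (by linarith : 0 ≤ 1 - 4 * l) (by linarith : 0 ≤ 4 * l) (by ring)
        simp only [smul_eq_mul] at h2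
        have h3 : Real.exp (g 1 x - d) = Real.exp (-d) * Real.exp (g 1 x) := by
          rw [← Real.exp_add]; ring_nf
        rw [h3] at h2
        calc Real.exp (g (1 - 8 * l) x) ≤ Real.exp ((1 - 4 * l) * g 1 x + 4 * l * g (-1) x) :=
              Real.exp_le_exp.2 h1
          _ = Real.exp ((1 - 4 * l) * d) *
              Real.exp ((1 - 4 * l) * (g 1 x - d) + 4 * l * g (-1) x) := by
              rw [← Real.exp_add]; ring_nf
          _ ≤ _ := mul_le_mul_of_nonneg_left h2 (Real.exp_pos _).le
      calc A (1 - 8 * l) ≤ _ := expect_mono hq hpt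
        _ = Real.exp ((1 - 4 * l) * d) *
            ((1 - 4 * l) * (Real.exp (-d) * A 1) + 4 * l * A (-1)) := by
            rw [expect_mul_left, expect_add, expect_mul_left, expect_mul_left, expect_mul_left]
        _ = _ := by
            rw [hA1, ← mul_assoc (Real.exp (-d)), ← Real.exp_add]
            simp only [neg_add_cancel, Real.exp_zero]
            ring
    -- α and β are the penalized moments for the two values of the sign, in units of A (-1); β ≤ 1
    -- because A is monotone.
    have hmain := two_point_decoupling (hq.nonneg (e₁ i) true)
      (hdom i (Finset.mem_insert_self i S))
      (by linarith [hq.nonneg (e₂ i) false, hq.add_eq_one (e₂ i)]) hd0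
      (by linarith : 2 * d ≤ 4 * l) (by linarith)
      (α := A (1 - 8 * l) / A (-1)) (β := A (-1 - 8 * l) / A (-1))
      (by rw [div_le_iff₀ (hApos _)]; exact hconv) (div_pos (hApos _) (hApos _)).le
      (by rw [div_le_one (hApos _)]; exact hAmono _ _ (by linarith))
      (div_pos (hApos _) (hApos _)).le
    have hf1 : q (e₁ i) false = 1 - q (e₁ i) true := by linarith [hq.add_eq_one (e₁ i)]
    have hf2 : q (e₂ i) false = 1 - q (e₂ i) true := by linarith [hq.add_eq_one (e₂ i)]
    have hB1 := mul_le_mul_of_nonneg_left (hB 1) (hq.nonneg (e₂ i) true)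
    have hB2 := mul_le_mul_of_nonneg_left (hB (-1)) (hq.nonneg (e₂ i) false)
    have hpos : 0 ≤ q (e₁ i) true * A (1 - 8 * l) + q (e₁ i) false * A (-1 - 8 * l) :=
      add_nonneg (mul_nonneg (hq.nonneg _ _) (hApos _).le)
        (mul_nonneg (hq.nonneg _ _) (hApos _).le)
    refine (mul_le_mul_of_nonneg_left (add_le_add hB1 hB2) hpos).trans ?_
    refine le_trans (le_of_eq ?_) hmain
    have hA1' : Real.exp (-d) = A (-1) / A 1 := by
      rw [hA1, Real.exp_neg]
      field_simp [(hApos (-1)).ne']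
    rw [hA1', hf1, hf2]
    have := (hApos 1).ne'
    have := (hApos (-1)).ne'
    field_simp
    ring

/-- Exchanging the bits on which a maximum of sums of signs depends for independent dominating
bits: the maximum exceeds its copy only by a multiple of the number of signs in a sum. -/
theorem expect_exp_sup_sub_sup_le (hq : IsBitLaw q) {J κ : Type*} [DecidableEq J] [Fintype J]
    {e₁ e₂ : J → ι} (h₁ : Function.Injective e₁) (h₂ : Function.Injective e₂)
    (hdisj : ∀ i j, e₁ i ≠ e₂ j) {l R : ℝ} (hl0 : 0 ≤ l) (hl : l ≤ 1 / 4) (s : Finset κ)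
    (hs : s.Nonempty) (M : κ → Finset J) (hR : ∀ k ∈ s, ((M k).card : ℝ) ≤ R)
    (hdom : ∀ j, q (e₁ j) true ≤ q (e₂ j) true) (b : κ → (ι → Bool) → ℝ)
    (hb : ∀ k a a', (∀ i, (∀ j, i ≠ e₁ j) → (∀ j, i ≠ e₂ j) → a i = a' i) → b k a = b k a') :
    expect q (fun a => Real.exp ((s.sup' hs fun k => b k a + ∑ j ∈ M k, l * sg (a (e₁ j))) -
      s.sup' hs fun k => b k a + ∑ j ∈ M k, l * sg (a (e₂ j)))) ≤ Real.exp (8 * l ^ 2 * R) := by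
  classical
  -- Resampling the bits of e₂, and later those of e₁, separates the two maxima into factors for
  -- fixed remaining bits.
  rw [← expect_mix hq (fun i => ∃ j, i = e₂ j), ← expect_const hq (Real.exp (8 * l ^ 2 * R))]
  have step : ∀ a : ι → Bool, expect q (fun y => Real.exp
      ((s.sup' hs fun k => b k a + ∑ j ∈ M k, l * sg (a (e₁ j))) -
        s.sup' hs fun k => b k a + ∑ j ∈ M k, l * sg (y (e₂ j)))) =
      Real.exp (s.sup' hs fun k => b k a + ∑ j ∈ M k, l * sg (a (e₁ j))) *
      expect q (fun y => Real.exp (-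
        s.sup' hs fun k => b k a + ∑ j ∈ M k, l * sg (y (e₂ j)))) := by
    intro a
    rw [← expect_mul_left]
    congr 1
    ext y
    rw [← Real.exp_add, sub_eq_add_neg]
  have hmix2 : ∀ (a y : ι → Bool), Real.exp
      ((s.sup' hs fun k => b k (fun i => if ∃ j, i = e₂ j then y i else a i) +
          ∑ j ∈ M k, l * sg (if ∃ j', e₁ j = e₂ j' then y (e₁ j) else a (e₁ j))) -
        s.sup' hs fun k => b k (fun i => if ∃ j, i = e₂ j then y i else a i) +
          ∑ j ∈ M k, l * sg (if ∃ j', e₂ j = e₂ j' then y (e₂ j) else a (e₂ j))) =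
      Real.exp ((s.sup' hs fun k => b k a + ∑ j ∈ M k, l * sg (a (e₁ j))) -
        s.sup' hs fun k => b k a + ∑ j ∈ M k, l * sg (y (e₂ j))) := by
    intro a y
    have hb' : ∀ k, b k (fun i => if ∃ j, i = e₂ j then y i else a i) = b k a := by
      intro k
      refine hb k _ _ fun i _ hi2 => ?_
      rw [if_neg]
      rintro ⟨j, hj⟩
      exact hi2 j hj
    have h1 : ∀ j, ¬ ∃ j', e₁ j = e₂ j' := fun j ⟨j', h⟩ => hdisj j j' h
    have h2 : ∀ j, ∃ j', e₂ j = e₂ j' := fun j => ⟨j, rfl⟩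
    simp only [hb', h1, h2, if_true, if_false]
  simp only [hmix2, step]
  rw [← expect_mix hq (fun i => ∃ j, i = e₁ j)]
  refine expect_mono hq fun a => ?_
  have hmix1 : ∀ x : ι → Bool, Real.exp
      (s.sup' hs fun k => b k (fun i => if ∃ j, i = e₁ j then x i else a i) +
          ∑ j ∈ M k, l * sg (if ∃ j', e₁ j = e₁ j' then x (e₁ j) else a (e₁ j))) *
        expect q (fun y => Real.exp (-
        s.sup' hs fun k => b k (fun i => if ∃ j, i = e₁ j then x i else a i) +
          ∑ j ∈ M k, l * sg (y (e₂ j)))) =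
      Real.exp (s.sup' hs fun k => b k a + ∑ j ∈ M k, l * sg (x (e₁ j))) *
        expect q (fun y => Real.exp (-
          s.sup' hs fun k => b k a + ∑ j ∈ M k, l * sg (y (e₂ j)))) := by
    intro x
    have hb' : ∀ k, b k (fun i => if ∃ j, i = e₁ j then x i else a i) = b k a := by
      intro k
      refine hb k _ _ fun i hi1 _ => ?_
      rw [if_neg]
      rintro ⟨j, hj⟩
      exact hi1 j hj
    have h2 : ∀ j, ∃ j', e₁ j = e₁ j' := fun j => ⟨j, rfl⟩
    simp only [hb', h2, if_true]
  simp only [hmix1]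
  rw [expect_mul_right]
  have hten := expect_exp_sup_mul_le hq h₁ h₂ hl0 hl s hs M Finset.univ (fun j _ => hdom j)
    (fun k => b k a)
  simp only [Finset.sum_ite_mem, Finset.univ_inter] at hten
  -- A competitor uses at most R signs, so the penalties lower the maximum by at most 8l²R.
  have hle : ∀ x : ι → Bool, Real.exp (s.sup' hs fun k => b k a + ∑ j ∈ M k, l * sg (x (e₁ j))) ≤
      Real.exp (8 * l ^ 2 * R) * Real.exp (s.sup' hs fun k =>
        b k a + ∑ j ∈ M k, (l * sg (x (e₁ j)) - 8 * l ^ 2)) := by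
    intro x
    rw [← Real.exp_add, Real.exp_le_exp]
    refine Finset.sup'_le _ _ fun k hk => ?_
    have h1 := Finset.le_sup' (fun k => b k a + ∑ j ∈ M k, (l * sg (x (e₁ j)) - 8 * l ^ 2)) hk
    simp only [Finset.sum_sub_distrib, Finset.sum_const, nsmul_eq_mul] at h1
    have h2 := mul_le_mul_of_nonneg_left (hR k hk) (by positivity : 0 ≤ 8 * l ^ 2)
    simp only [Finset.sum_sub_distrib, Finset.sum_const, nsmul_eq_mul]
    linarith
  have hle' := expect_mono hq hle
  rw [expect_mul_left] at hle'
  have hpos : 0 < expect q (fun y => Real.exp (-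
      s.sup' hs fun k => b k a + ∑ j ∈ M k, l * sg (y (e₂ j)))) :=
    expect_pos hq fun _ => Real.exp_pos _
  calc _ ≤ _ := mul_le_mul_of_nonneg_right hle' hpos.le
    _ ≤ Real.exp (8 * l ^ 2 * R) * 1 := by
        rw [mul_assoc]
        exact mul_le_mul_of_nonneg_left hten (Real.exp_pos _).le
    _ = _ := mul_one _

end Tensorization

end FaultyOracle

namespace FaultyOracle

/-! ### Unordered pairs, the law of the answers and its exponential moments -/

section Pairs

variable {n : ℕ}

/-- A function of the pairs as a function of two points, which vanishes on the diagonal. -/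
noncomputable def ord (G : Pair n → ℝ) (u v : Fin n) : ℝ :=
  if h : u = v then 0 else G ⟨s(u, v), by simpa using h⟩

theorem ord_comm (G : Pair n → ℝ) (u v : Fin n) : ord G u v = ord G v u := by
  unfold ord
  by_cases h : u = v
  · subst h; rfl
  · have h' : ¬ v = u := fun e => h e.symm
    simp only [h, h', dif_neg, not_false_eq_true]
    congr 2
    exact Sym2.eq_swap

theorem ord_self (G : Pair n → ℝ) (u : Fin n) : ord G u u = 0 := by simp [ord]

theorem sum_ord (G : Pair n → ℝ) : ∑ u, ∑ v, ord G u v = 2 * ∑ e, G e := by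
  classical
  rw [← Fintype.sum_prod_type']
  have h1 : ∑ x : Fin n × Fin n, ord G x.1 x.2 =
      ∑ x ∈ Finset.univ.filter (fun x : Fin n × Fin n => x.1 ≠ x.2), ord G x.1 x.2 := by
    rw [Finset.sum_filter]
    refine Finset.sum_congr rfl fun x _ => ?_
    by_cases h : x.1 = x.2
    · simp [h, ord_self]
    · simp [h]
  rw [h1, ← Finset.sum_coe_sort (Finset.univ.filter fun x : Fin n × Fin n => x.1 ≠ x.2)]
  let π : {x // x ∈ Finset.univ.filter fun x : Fin n × Fin n => x.1 ≠ x.2} → Pair n :=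
    fun x => ⟨s(x.1.1, x.1.2), by have := (Finset.mem_filter.1 x.2).2; simpa using this⟩
  rw [← Finset.sum_fiberwise (s := Finset.univ) (g := π), Finset.mul_sum]
  refine Finset.sum_congr rfl fun e _ => ?_
  obtain ⟨e, he⟩ := e
  induction e using Sym2.inductionOn with
  | hf u v =>
    have huv : u ≠ v := by simpa using he
    have hfib : (Finset.univ.filter fun x => π x = ⟨s(u, v), he⟩) =
        {⟨(u, v), by simp [huv]⟩, ⟨(v, u), by simp [huv.symm]⟩} := by
      ext ⟨⟨x, y⟩, hxy⟩
      simp [π]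
    rw [hfib, Finset.sum_pair]
    · simp only [ord, huv, huv.symm, dif_neg, not_false_eq_true]
      have : (⟨s(v, u), by simpa using huv.symm⟩ : Pair n) = ⟨s(u, v), he⟩ := by
        ext1; exact Sym2.eq_swap
      rw [this]
      ring
    · simp [huv]

theorem sum_mul_ord {F : Fin n → Fin n → ℝ} (hF : ∀ u v, F u v = F v u) (G : Pair n → ℝ) :
    ∑ u, ∑ v, F u v * ord G u v = 2 * ∑ e : Pair n, Sym2.lift ⟨F, hF⟩ e.1 * G e := by
  rw [← sum_ord]
  refine Finset.sum_congr rfl fun u _ => Finset.sum_congr rfl fun v _ => ?_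
  by_cases h : u = v
  · simp [h, ord_self]
  · simp [ord, h]

/-- The two points of the pair have the same label. -/
def Joined {α : Type*} (c : Fin n → α) (e : Pair n) : Prop := ∀ u ∈ e.1, ∀ v ∈ e.1, c u = c v

theorem joined_mk {α : Type*} (c : Fin n → α) {u v : Fin n} (h : ¬ (s(u, v)).IsDiag) :
    Joined c ⟨s(u, v), h⟩ ↔ c u = c v := by
  simp only [Joined, Sym2.mem_iff]
  constructor
  · intro H; exact H u (Or.inl rfl) v (Or.inr rfl)
  · rintro H x (rfl | rfl) y (rfl | rfl) <;> simp [H]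

open Classical in
/-- The law of the answers when the points with equal labels `t` form the true clusters. -/
noncomputable def answerLaw (p : ℝ) (t : Fin n → Fin n) (e : Pair n) (b : Bool) : ℝ :=
  if (b = true ↔ Joined t e) then 1 - p else p

theorem isBitLaw_answerLaw {p : ℝ} (hp0 : 0 ≤ p) (hp : p < 1 / 2) (t : Fin n → Fin n) :
    IsBitLaw (answerLaw p t) where
  nonneg e b := by unfold answerLaw; split_ifs <;> linarith
  add_eq_one e := by
    unfold answerLaw
    by_cases h : Joined t e <;> simp [h]

/-- The answer to the pair `u, v` as a number: `1` for "same cluster", `-1` for "different". -/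
noncomputable def wt (a : Answers n) : Fin n → Fin n → ℝ := ord fun e => sg (a e)

theorem wt_comm (a : Answers n) (u v : Fin n) : wt a u v = wt a v u := ord_comm _ u v

theorem wt_self (a : Answers n) (u : Fin n) : wt a u u = 0 := ord_self _ u

-- The double sum meets each pair twice, so a pair carries the exponent x = 2F times ±1, with + for
-- a correct answer. Independence reduces the claim to (1 - p)eˣ + pe⁻ˣ ≤ exp(x(1 - 2p) + x²) for
-- |x| ≤ 1. All Chernoff bounds on answers come from here, with the sign of F selecting the tail.
open Classical in
theorem expect_exp_le {p : ℝ} (hp0 : 0 ≤ p) (hp : p < 1 / 2) (t : Fin n → Fin n)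
    {F : Fin n → Fin n → ℝ} (hF : ∀ u v, F u v = F v u) (hF1 : ∀ u v, |2 * F u v| ≤ 1) :
    expect (answerLaw p t) (fun a => Real.exp (∑ u, ∑ v,
      F u v * ((if t u = t v then 1 else -1) * wt a u v))) ≤
    Real.exp (∑ u, ∑ v, if u = v then 0 else (F u v * (1 - 2 * p) + 2 * F u v ^ 2)) := by
  have hq := isBitLaw_answerLaw hp0 hp t
  have hsym : ∀ u v, F u v * (if t u = t v then 1 else -1) =
      F v u * (if t v = t u then 1 else -1) := by
    intro u v; rw [hF u v]; simp only [eq_comm]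
  have h1 : ∀ a : Answers n, ∑ u, ∑ v, F u v * ((if t u = t v then 1 else -1) * wt a u v) =
      ∑ e : Pair n, 2 * Sym2.lift ⟨fun u v => F u v * (if t u = t v then 1 else -1), hsym⟩ e.1 *
        sg (a e) := by
    intro a
    have := sum_mul_ord hsym (fun e => sg (a e))
    simp only [mul_assoc] at this ⊢
    rw [← Finset.mul_sum]
    exact this
  have hsym2 : ∀ u v, F u v * (1 - 2 * p) + 2 * F u v ^ 2 =
      F v u * (1 - 2 * p) + 2 * F v u ^ 2 := by
    intro u v; rw [hF u v]
  have h2 : ∑ u, ∑ v, (if u = v then 0 else (F u v * (1 - 2 * p) + 2 * F u v ^ 2)) =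
      ∑ e : Pair n, 2 * Sym2.lift ⟨fun u v => F u v * (1 - 2 * p) + 2 * F u v ^ 2, hsym2⟩ e.1 := by
    have := sum_mul_ord hsym2 (fun _ => 1)
    simp only [mul_one] at this
    rw [← Finset.mul_sum, ← this]
    refine Finset.sum_congr rfl fun u _ => Finset.sum_congr rfl fun v _ => ?_
    by_cases h : u = v <;> simp [ord, h]
  simp only [h1, h2, Real.exp_sum]
  rw [expect_prod (answerLaw p t) (fun e b => Real.exp (2 * Sym2.lift
    ⟨fun u v => F u v * (if t u = t v then 1 else -1), hsym⟩ e.1 * sg b))]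
  refine Finset.prod_le_prod (fun e _ => ?_) fun e _ => ?_
  · exact add_nonneg (mul_nonneg (hq.nonneg _ _) (Real.exp_pos _).le)
      (mul_nonneg (hq.nonneg _ _) (Real.exp_pos _).le)
  · obtain ⟨e, he⟩ := e
    induction e using Sym2.inductionOn with
    | hf u v =>
      have key : ∀ x : ℝ, |x| ≤ 1 → (1 - p) * Real.exp x + p * Real.exp (-x) ≤
          Real.exp (x * (1 - 2 * p) + x ^ 2) := by
        intro x hx
        have e1 := exp_quadratic_bound hx
        have e2 := exp_quadratic_bound (x := -x) (by rwa [abs_neg])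
        have e3 := Real.add_one_le_exp (x * (1 - 2 * p) + x ^ 2)
        have e4 := mul_le_mul_of_nonneg_left e1 (by linarith : 0 ≤ 1 - p)
        have e5 := mul_le_mul_of_nonneg_left e2 hp0
        nlinarith
      have hk := key (2 * F u v) (hF1 u v)
      have hring : 2 * F u v * (1 - 2 * p) + (2 * F u v) ^ 2 =
          2 * (F u v * (1 - 2 * p) + 2 * F u v ^ 2) := by ring
      rw [hring] at hk
      simp only [answerLaw, joined_mk, Sym2.lift_mk, sg]
      by_cases h : t u = t v
      · simp only [h, if_true, iff_true, Bool.false_eq_true, if_false, mul_one, mul_neg]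
        exact hk
      · simp only [h, if_true, Bool.false_eq_true, if_false, mul_one, iff_false,
          not_true_eq_false, mul_neg, neg_neg]
        linarith

end Pairs

/-! ### The random events behind recovery and their probabilities -/

section Events

variable {n : ℕ}

/-- Twice the total weight of the pairs in `Y` that have equal labels. -/
noncomputable def agreement {α : Type*} (w : Fin n → Fin n → ℝ) (Y : Finset (Fin n))
    (c : Fin n → α) : ℝ :=
  open Classical in ∑ u ∈ Y, ∑ v ∈ Y, if c u = c v then w u v else 0

/-- The total weight of the pairs between `X` and `C` that have equal labels. -/
noncomputable def cross {α : Type*} (w : Fin n → Fin n → ℝ) (X C : Finset (Fin n))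
    (c : Fin n → α) : ℝ :=
  open Classical in ∑ u ∈ X, ∑ v ∈ C, if c u = c v then w u v else 0

/-- The sum of `f` over the ordered pairs in `Y` on which the labelings `c₁` and `c₂` disagree. -/
noncomputable def disagreeSum {α β : Type*} (Y : Finset (Fin n)) (c₁ : Fin n → α) (c₂ : Fin n → β)
    (f : Fin n → Fin n → ℝ) : ℝ :=
  open Classical in
  ∑ u ∈ Y, ∑ v ∈ Y, if (c₁ u = c₁ v ↔ c₂ u = c₂ v) then 0 else f u v

/-- The weight of a pair, with the sign that makes correct answers positive. -/
noncomputable def truthWt (t : Fin n → Fin n) (w : Fin n → Fin n → ℝ) (u v : Fin n) : ℝ :=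
  (if t u = t v then 1 else -1) * w u v

/-- Three disjoint palettes: 0 for names of true clusters, 1 for classes of the labeling under
study, 2 for points that are made singletons. Labelings that mix these can then be compared with a
fixed reference point by point. -/
abbrev Lab (n : ℕ) : Type := Fin 3 × Fin n

/-- Whenever two labelings disagree on many pairs compared with their distance `m` from `base`,
the answers to these pairs are correct about as often as expected. -/
def ReliableNear (t : Fin n → Fin n) (w : Fin n → Fin n → ℝ) (Y : Finset (Fin n)) (δ r : ℝ)
    (base : Fin n → Lab n) : Prop :=
  ∀ c₁ c₂ : Fin n → Lab n,
    0 < (Finset.univ.filter fun v => ¬ (c₁ v = base v ∧ c₂ v = base v)).card →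
    r * (Finset.univ.filter fun v => ¬ (c₁ v = base v ∧ c₂ v = base v)).card ≤
      disagreeSum Y c₁ c₂ (fun _ _ => 1) →
    δ / 2 * disagreeSum Y c₁ c₂ (fun _ _ => 1) ≤ disagreeSum Y c₁ c₂ (truthWt t w)

/-- Sets of at most `α` points have internal weight at most `s` per point. -/
def SmallSetsLight (w : Fin n → Fin n → ℝ) (α s : ℝ) : Prop :=
  ∀ U : Finset (Fin n), (U.card : ℝ) ≤ α → |∑ u ∈ U, ∑ v ∈ U, w u v| ≤ s * U.card

/-- The labelings whose classes contain less than `α` points of `X` and, if they meet `X`, less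
than `β` points of `C`. -/
def Confined (X C : Finset (Fin n)) (α β : ℝ) (c : Fin n → Fin n) : Prop :=
  ∀ x ∈ X, ((X.filter fun y => c y = c x).card : ℝ) < α ∧
    ((C.filter fun v => c v = c x).card : ℝ) < β

/-- Points of `B` can be exchanged for points of `A` without much loss. -/
def Exchangeable (w : Fin n → Fin n → ℝ) (A B : Finset (Fin n)) (α β s : ℝ) : Prop :=
  ∀ X U : Finset (Fin n), X.Nonempty → X ⊆ B → U ⊆ A → X.card = U.card →
    ∃ σ : Fin n → Fin n, Set.BijOn σ X U ∧ ∀ c, Confined X (A \ U) α β c →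
      ∃ c', Confined X (A \ U) α β c' ∧
        agreement w (A \ U) c + 2 * cross w X (A \ U) c ≤
          agreement w (A \ U) c' + 2 * (∑ x ∈ X, ∑ v ∈ A \ U,
            if c' x = c' v then w (σ x) v else 0) + s * X.card

theorem disagreeSum_eq {α β : Type*} [DecidableEq α] [DecidableEq β] (Y : Finset (Fin n))
    (c₁ : Fin n → α) (c₂ : Fin n → β) (f : Fin n → Fin n → ℝ) :
    disagreeSum Y c₁ c₂ f =
      ∑ u, ∑ v, (if u ∈ Y ∧ v ∈ Y ∧ ¬ (c₁ u = c₁ v ↔ c₂ u = c₂ v) then 1 else 0) * f u v := by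
  unfold disagreeSum
  rw [← Finset.sum_subset (Finset.subset_univ Y)]
  · refine Finset.sum_congr rfl fun u hu => ?_
    rw [← Finset.sum_subset (Finset.subset_univ Y)]
    · refine Finset.sum_congr rfl fun v hv => ?_
      by_cases h : (c₁ u = c₁ v ↔ c₂ u = c₂ v) <;> simp [h, hu, hv]
    · intro v _ hv; simp [hv]
  · intro u _ hu; simp [hu]

/-- A Chernoff bound with F = -δ/8 on the N disagreeing ordered pairs: the moment contributes
-3δ²N/32, and the threshold at half of the expectation costs δ²N/16. -/
theorem prob_le_exp_disagreeSum {p : ℝ} (hp0 : 0 ≤ p) (hp : p < 1 / 2) (t : Fin n → Fin n)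
    (Y : Finset (Fin n)) {α β : Type*} (c₁ : Fin n → α) (c₂ : Fin n → β) :
    prob (answerLaw p t) (fun a => ¬ ((1 - 2 * p) / 2 * disagreeSum Y c₁ c₂ (fun _ _ => 1) ≤
      disagreeSum Y c₁ c₂ (truthWt t (wt a)))) ≤
      Real.exp (-((1 - 2 * p) ^ 2 * disagreeSum Y c₁ c₂ (fun _ _ => 1) / 32)) := by
  classical
  set δ := 1 - 2 * p with hδ
  have hδ0 : 0 < δ := by rw [hδ]; linarith
  have hδ1 : δ ≤ 1 := by rw [hδ]; linarith
  set N := disagreeSum Y c₁ c₂ (fun _ _ => 1) with hN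
  let D : Fin n → Fin n → ℝ := fun u v =>
    if u ∈ Y ∧ v ∈ Y ∧ ¬ (c₁ u = c₁ v ↔ c₂ u = c₂ v) then 1 else 0
  have hDsym : ∀ u v, D u v = D v u := by
    intro u v
    simp only [D]
    congr 1
    rw [eq_comm (a := c₁ u), eq_comm (a := c₂ u)]
    exact propext ⟨fun h => ⟨h.2.1, h.1, h.2.2⟩, fun h => ⟨h.2.1, h.1, h.2.2⟩⟩
  have hD01 : ∀ u v, D u v = 0 ∨ D u v = 1 := by
    intro u v; simp only [D]; split_ifs <;> simp
  have hNsum : N = ∑ u, ∑ v, D u v := by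
    rw [hN, disagreeSum_eq]; simp only [mul_one, D]
  have hmgf := expect_exp_le hp0 hp t (F := fun u v => -(δ / 8) * D u v)
    (fun u v => by rw [hDsym u v]) (fun u v => by
      rcases hD01 u v with h | h <;> rw [h, abs_le] <;> constructor <;> nlinarith)
  have hq := isBitLaw_answerLaw hp0 hp t
  have hexp : ∑ u, ∑ v, (if u = v then 0 else
      (-(δ / 8) * D u v * δ + 2 * (-(δ / 8) * D u v) ^ 2)) = -(3 * δ ^ 2 / 32) * N := by
    rw [hNsum, Finset.mul_sum]
    refine Finset.sum_congr rfl fun u _ => ?_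
    rw [Finset.mul_sum]
    refine Finset.sum_congr rfl fun v _ => ?_
    by_cases h : u = v
    · simp [h, D]
    · rcases hD01 u v with h' | h' <;> simp only [h, if_false, h'] <;> ring
  rw [hexp] at hmgf
  refine (prob_le_expect hq (F := fun a => Real.exp (δ ^ 2 / 16 * N) *
    Real.exp (∑ u, ∑ v, -(δ / 8) * D u v * ((if t u = t v then 1 else -1) * wt a u v)))
    (fun a => by positivity) ?_).trans ?_
  · intro a ha
    rw [← Real.exp_add]
    refine Real.one_le_exp ?_
    have h1 : ∑ u, ∑ v, -(δ / 8) * D u v * ((if t u = t v then 1 else -1) * wt a u v) =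
        -(δ / 8) * disagreeSum Y c₁ c₂ (truthWt t (wt a)) := by
      rw [disagreeSum_eq, Finset.mul_sum]
      refine Finset.sum_congr rfl fun u _ => ?_
      rw [Finset.mul_sum]
      refine Finset.sum_congr rfl fun v _ => ?_
      simp only [truthWt, D]
      ring
    rw [h1]
    push Not at ha
    nlinarith
  · rw [expect_mul_left]
    refine (mul_le_mul_of_nonneg_left hmgf (Real.exp_pos _).le).trans ?_
    rw [← Real.exp_add, Real.exp_le_exp]
    apply le_of_eq
    ring

theorem exp_neg_nat_mul_log (hn : 2 ≤ n) (k : ℕ) :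
    Real.exp (-(k * Real.log n)) = 1 / (n : ℝ) ^ k := by
  have h : (0 : ℝ) < n := by exact_mod_cast (by omega : 0 < n)
  rw [Real.exp_neg, Real.exp_nat_mul, Real.exp_log h, one_div]

/-- A pair of labelings is one labeling with 9n² labels, and the union bound is over its distance m
from the reference. With at least 400Lm disagreeing pairs the Chernoff exponent is 12.5 m log n,
which beats the n⁻¹² charged per moved point. -/
theorem prob_not_reliableNear {p : ℝ} (hp0 : 0 ≤ p) (hp : p < 1 / 2) (hn : 2 ≤ n)
    (t : Fin n → Fin n) (Y : Finset (Fin n)) (base : Fin n → Lab n) :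
    prob (answerLaw p t) (fun a => ¬ ReliableNear t (wt a) Y (1 - 2 * p)
      (400 * (Real.log n / (1 - 2 * p) ^ 2)) base) ≤ 8 / (n : ℝ) ^ 4 := by
  classical
  have hδ0 : 0 < 1 - 2 * p := by linarith
  have hq := isBitLaw_answerLaw hp0 hp t
  have hn2 : (2 : ℝ) ≤ n := by exact_mod_cast hn
  have hn0 : (0 : ℝ) < n := by linarith
  have hlog : 0 < Real.log n := Real.log_pos (by linarith)
  have hexp := exp_neg_nat_mul_log hn 12
  push_cast at hexp
  have hpow : (512 : ℝ) ≤ n ^ 9 := by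
    calc (512 : ℝ) = 2 ^ 9 := by norm_num
      _ ≤ n ^ 9 := pow_le_pow_left₀ (by norm_num) hn2 9
  have hcard : (Fintype.card (Fin n) : ℝ) * Fintype.card (Lab n × Lab n) *
      Real.exp (-(12 * Real.log n)) = 9 / (n : ℝ) ^ 9 := by
    rw [hexp]
    simp only [Fintype.card_fin, Fintype.card_prod]
    push_cast
    field_simp
    ring
  have hmain := prob_exists_labeling_le hq (Lab := Lab n × Lab n) (fun v => (base v, base v))
    (fun c a => 400 * (Real.log n / (1 - 2 * p) ^ 2) *
      (Finset.univ.filter fun v => c v ≠ (base v, base v)).card ≤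
      disagreeSum Y (fun v => (c v).1) (fun v => (c v).2) (fun _ _ => 1) ∧
      ¬ ((1 - 2 * p) / 2 * disagreeSum Y (fun v => (c v).1) (fun v => (c v).2) (fun _ _ => 1) ≤
        disagreeSum Y (fun v => (c v).1) (fun v => (c v).2) (truthWt t (wt a))))
    (r := Real.exp (-(12 * Real.log n))) (Real.exp_pos _).le ?_ ?_
  · rw [hcard] at hmain
    have hle : 2 * (9 / (n : ℝ) ^ 9) ≤ 8 / (n : ℝ) ^ 4 := by
      have h5 : (32 : ℝ) ≤ n ^ 5 := by
        calc (32 : ℝ) = 2 ^ 5 := by norm_num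
          _ ≤ n ^ 5 := pow_le_pow_left₀ (by norm_num) hn2 5
      rw [← mul_div_assoc, div_le_div_iff₀ (by positivity) (by positivity)]
      have h4 : (0 : ℝ) < n ^ 4 := by positivity
      have : (n : ℝ) ^ 9 = n ^ 5 * n ^ 4 := by ring
      rw [this]
      nlinarith
    refine le_trans (prob_mono hq ?_) (hmain.trans hle)
    intro a ha
    simp only [ReliableNear, not_forall] at ha
    obtain ⟨c₁, c₂, h1, h2, h3⟩ := ha
    have hfilter : (Finset.univ.filter fun v => (c₁ v, c₂ v) ≠ (base v, base v)) =
        Finset.univ.filter fun v => ¬ (c₁ v = base v ∧ c₂ v = base v) := by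
      ext v; simp
    refine ⟨fun v => (c₁ v, c₂ v), ?_, ?_, ?_⟩
    · intro h
      rw [← hfilter, Finset.card_pos] at h1
      obtain ⟨v, hv⟩ := h1
      exact (Finset.mem_filter.1 hv).2 (congrFun h v)
    · simp only [hfilter]
      exact h2
    · exact h3
  · intro c _
    set m := (Finset.univ.filter fun v => c v ≠ (base v, base v)).card
    by_cases h : 400 * (Real.log n / (1 - 2 * p) ^ 2) * m ≤
        disagreeSum Y (fun v => (c v).1) (fun v => (c v).2) (fun _ _ => 1)
    · refine (prob_mono hq fun a ha => ha.2).trans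
        ((prob_le_exp_disagreeSum hp0 hp t Y _ _).trans ?_)
      rw [← Real.exp_nat_mul, Real.exp_le_exp]
      have h1 : (1 - 2 * p) ^ 2 * (400 * (Real.log n / (1 - 2 * p) ^ 2) * m) =
          400 * Real.log n * m := by field_simp
      have h2 := mul_le_mul_of_nonneg_left h (sq_nonneg (1 - 2 * p))
      rw [h1] at h2
      have h3 : 0 ≤ Real.log n * m := by positivity
      linarith
    · have : prob (answerLaw p t) (fun a => 400 * (Real.log n / (1 - 2 * p) ^ 2) * m ≤
        disagreeSum Y (fun v => (c v).1) (fun v => (c v).2) (fun _ _ => 1) ∧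
        ¬ ((1 - 2 * p) / 2 * disagreeSum Y (fun v => (c v).1) (fun v => (c v).2) (fun _ _ => 1) ≤
        disagreeSum Y (fun v => (c v).1) (fun v => (c v).2) (truthWt t (wt a)))) ≤ 0 := by
        refine (prob_mono hq (Q := fun _ => False) fun a ha => h ha.1).trans ?_
        simp only [prob, if_false]
        rw [expect_const hq]
      exact this.trans (by positivity)
  · rw [hcard, div_le_one (by positivity)]
    linarith

/-- For |U| ≤ 2400L the expected weight inside U is at most δ|U|² ≤ 2400D|U|, and the fluctuation
that survives a union bound over U is also of order D|U|. With F = ±δ/2 in the direction of the mean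
or against it, the moment costs at most 2400 log n per point, against 3600 from the threshold. -/
theorem prob_not_smallSetsLight {p : ℝ} (hp0 : 0 ≤ p) (hp : p < 1 / 2) (hn : 2 ≤ n)
    (t : Fin n → Fin n) :
    prob (answerLaw p t) (fun a => ¬ SmallSetsLight (wt a)
      (2400 * (Real.log n / (1 - 2 * p) ^ 2)) (7200 * (Real.log n / (1 - 2 * p)))) ≤
        8 / (n : ℝ) ^ 4 := by
  classical
  set δ := 1 - 2 * p with hδ
  have hδ0 : 0 < δ := by linarith
  have hδ1 : δ ≤ 1 := by linarith
  have hq := isBitLaw_answerLaw hp0 hp t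
  have hn2 : (2 : ℝ) ≤ n := by exact_mod_cast hn
  have hn0 : (0 : ℝ) < n := by linarith
  have hlog : 0 < Real.log n := Real.log_pos (by linarith)
  have hlog2 : 1 / 2 ≤ Real.log n := by
    have h1 := Real.log_le_log (by norm_num) hn2
    linarith [Real.log_two_gt_d9]
  have hexp := exp_neg_nat_mul_log hn 10
  push_cast at hexp
  have hcard : (Fintype.card (Fin n) : ℝ) * Fintype.card Bool *
      Real.exp (-(10 * Real.log n)) = 2 / (n : ℝ) ^ 9 := by
    rw [hexp]
    simp only [Fintype.card_fin, Fintype.card_bool]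
    push_cast
    field_simp
  have hpow : (512 : ℝ) ≤ n ^ 9 := by
    calc (512 : ℝ) = 2 ^ 9 := by norm_num
      _ ≤ n ^ 9 := pow_le_pow_left₀ (by norm_num) hn2 9
  -- one set and one sign
  have hone : ∀ (U : Finset (Fin n)) (ε : ℝ), (ε = 1 ∨ ε = -1) →
      (U.card : ℝ) ≤ 2400 * (Real.log n / δ ^ 2) → prob (answerLaw p t) (fun a =>
        7200 * (Real.log n / δ) * U.card < ε * ∑ u ∈ U, ∑ v ∈ U, wt a u v) ≤
        Real.exp (-(1200 * Real.log n * U.card)) := by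
    intro U ε hε hU
    let F : Fin n → Fin n → ℝ := fun u v =>
      if u ∈ U ∧ v ∈ U then ε * (δ / 2) * (if t u = t v then 1 else -1) else 0
    have hFabs : ∀ u v, |F u v| ≤ δ / 2 := by
      intro u v
      simp only [F]
      split_ifs <;> rcases hε with rfl | rfl <;>
        simp <;> linarith [(abs_of_pos (half_pos hδ0)).le]
    have hmgf := expect_exp_le hp0 hp t (F := F) (fun u v => by
        simp only [F, and_comm, eq_comm]) (fun u v => by
          rw [abs_mul, abs_two]; linarith [hFabs u v])
    have hbound : ∑ u, ∑ v, (if u = v then 0 else (F u v * (1 - 2 * p) + 2 * F u v ^ 2)) ≤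
        δ ^ 2 * (U.card : ℝ) ^ 2 := by
      have h1 : ∀ u v, (if u = v then 0 else (F u v * (1 - 2 * p) + 2 * F u v ^ 2)) ≤
          if u ∈ U ∧ v ∈ U then δ ^ 2 else 0 := by
        intro u v
        by_cases huv : u ∈ U ∧ v ∈ U
        · rw [if_pos huv]
          have h2 := abs_le.1 (hFabs u v)
          split_ifs
          · positivity
          · nlinarith [h2.1, h2.2]
        · rw [if_neg huv]
          have : F u v = 0 := by simp only [F, if_neg huv]
          rw [this]; simp
      refine (Finset.sum_le_sum fun u _ => Finset.sum_le_sum fun v _ => h1 u v).trans ?_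
      have h3 : ∀ u, (∑ v, if u ∈ U ∧ v ∈ U then δ ^ 2 else 0) =
          if u ∈ U then U.card * δ ^ 2 else 0 := by
        intro u
        by_cases hu : u ∈ U <;> simp [hu]
      simp only [h3, Finset.sum_ite_mem, Finset.univ_inter, Finset.sum_const, nsmul_eq_mul]
      apply le_of_eq
      ring
    have hsum : ∀ a : Answers n, ∑ u, ∑ v, F u v * ((if t u = t v then 1 else -1) * wt a u v) =
        ε * (δ / 2) * ∑ u ∈ U, ∑ v ∈ U, wt a u v := by
      intro a
      rw [Finset.mul_sum, ← Finset.sum_subset (Finset.subset_univ U)]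
      · refine Finset.sum_congr rfl fun u hu => ?_
        rw [Finset.mul_sum, ← Finset.sum_subset (Finset.subset_univ U)]
        · refine Finset.sum_congr rfl fun v hv => ?_
          simp only [F, hu, hv, and_self, if_true]
          split_ifs <;> ring
        · intro v _ hv; simp [F, hv]
      · intro u _ hu; simp [F, hu]
    simp only [hsum] at hmgf
    refine (prob_le_expect hq (F := fun a => Real.exp (-(3600 * Real.log n * U.card)) *
      Real.exp (ε * (δ / 2) * ∑ u ∈ U, ∑ v ∈ U, wt a u v)) (fun a => by positivity) ?_).trans ?_
    · intro a ha
      rw [← Real.exp_add]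
      refine Real.one_le_exp ?_
      have h1 := mul_le_mul_of_nonneg_left ha.le (by linarith : 0 ≤ δ / 2)
      have h2 : δ / 2 * (7200 * (Real.log n / δ) * U.card) = 3600 * Real.log n * U.card := by
        field_simp; ring
      rw [h2] at h1
      nlinarith
    · rw [expect_mul_left]
      refine (mul_le_mul_of_nonneg_left hmgf (Real.exp_pos _).le).trans ?_
      rw [← Real.exp_add, Real.exp_le_exp]
      have h1 : δ ^ 2 * (U.card : ℝ) ^ 2 ≤ 2400 * Real.log n * U.card := by
        have h2 := mul_le_mul_of_nonneg_left hU (by positivity : 0 ≤ δ ^ 2 * (U.card : ℝ))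
        have h3 : δ ^ 2 * (U.card : ℝ) * (2400 * (Real.log n / δ ^ 2)) =
            2400 * Real.log n * U.card := by field_simp
        nlinarith
      linarith
  have hmain := prob_exists_labeling_le hq (Lab := Bool) (fun _ : Fin n => false)
    (fun c a => ((Finset.univ.filter fun v => c v ≠ false).card : ℝ) ≤
        2400 * (Real.log n / δ ^ 2) ∧
      (7200 * (Real.log n / δ) * (Finset.univ.filter fun v => c v ≠ false).card <
        1 * ∑ u ∈ Finset.univ.filter (fun v => c v ≠ false),
          ∑ v ∈ Finset.univ.filter (fun v => c v ≠ false), wt a u v ∨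
      7200 * (Real.log n / δ) * (Finset.univ.filter fun v => c v ≠ false).card <
        -1 * ∑ u ∈ Finset.univ.filter (fun v => c v ≠ false),
          ∑ v ∈ Finset.univ.filter (fun v => c v ≠ false), wt a u v))
    (r := Real.exp (-(10 * Real.log n))) (Real.exp_pos _).le ?_ ?_
  · rw [hcard] at hmain
    have hle : 2 * (2 / (n : ℝ) ^ 9) ≤ 8 / (n : ℝ) ^ 4 := by
      have h5 : (32 : ℝ) ≤ n ^ 5 := by
        calc (32 : ℝ) = 2 ^ 5 := by norm_num
          _ ≤ n ^ 5 := pow_le_pow_left₀ (by norm_num) hn2 5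
      rw [← mul_div_assoc, div_le_div_iff₀ (by positivity) (by positivity)]
      have h4 : (0 : ℝ) < n ^ 4 := by positivity
      have : (n : ℝ) ^ 9 = n ^ 5 * n ^ 4 := by ring
      rw [this]
      nlinarith
    refine le_trans (prob_mono hq ?_) (hmain.trans hle)
    intro a ha
    unfold SmallSetsLight at ha
    push Not at ha
    obtain ⟨U, h1, h2⟩ := ha
    have hfilter : (Finset.univ.filter fun v => (decide (v ∈ U)) ≠ false) = U := by
      ext v; simp
    refine ⟨fun v => decide (v ∈ U), ?_, ?_⟩
    · intro h
      have hU : U = ∅ := by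
        ext v
        simpa using congrFun h v
      rw [hU] at h2
      simp at h2
    · simp only [hfilter]
      refine ⟨h1, ?_⟩
      rcases lt_abs.1 h2 with h | h
      · left; linarith
      · right; linarith
  · intro c hc
    set U := Finset.univ.filter fun v => c v ≠ false with hU
    have hU1 : (1 : ℝ) ≤ U.card := by
      have : 0 < U.card := by
        rw [Finset.card_pos]
        by_contra h
        rw [Finset.not_nonempty_iff_eq_empty] at h
        apply hc
        ext v
        by_contra hv
        have : v ∈ U := by rw [hU]; simpa using hv
        rw [h] at this
        simp at this
      exact_mod_cast this
    by_cases h : (U.card : ℝ) ≤ 2400 * (Real.log n / δ ^ 2)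
    · refine (prob_mono hq fun a ha => ha.2).trans ((prob_or_le hq _ _).trans ?_)
      have h1 := hone U 1 (Or.inl rfl) h
      have h2 := hone U (-1) (Or.inr rfl) h
      rw [← Real.exp_nat_mul]
      have h3 : Real.exp (-(1200 * Real.log n * U.card)) ≤
          Real.exp (-1) * Real.exp (U.card * -(10 * Real.log n)) := by
        rw [← Real.exp_add, Real.exp_le_exp]
        nlinarith
      have h4 : Real.exp (-1) ≤ 1 / 2 := by
        rw [Real.exp_neg, ← one_div]
        exact one_div_le_one_div_of_le (by norm_num) (by linarith [Real.add_one_le_exp (1 : ℝ)])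
      have h5 : 0 < Real.exp (U.card * -(10 * Real.log n)) := Real.exp_pos _
      nlinarith
    · refine (prob_mono hq (Q := fun _ => False) fun a ha => h ha.1).trans ?_
      simp only [prob, if_false]
      rw [expect_const hq]
      positivity
  · rw [hcard, div_le_one (by positivity)]
    linarith

theorem exists_bijOn_of_card_eq {X U : Finset (Fin n)} (h : X.card = U.card) :
    ∃ σ : Fin n → Fin n, Set.BijOn σ X U := by
  classical
  let e := Finset.equivOfCardEq h
  refine ⟨fun v => if hv : v ∈ X then e ⟨v, hv⟩ else v, ?_, ?_, ?_⟩
  · intro v hv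
    have hv' : v ∈ X := hv
    simp [hv']
  · intro u hu v hv huv
    have hu' : u ∈ X := hu
    have hv' : v ∈ X := hv
    simp only [hu', hv', dif_pos] at huv
    have := e.injective (Subtype.ext huv)
    simpa using this
  · intro u hu
    have hu' : u ∈ U := hu
    refine ⟨(e.symm ⟨u, hu'⟩).1, (e.symm ⟨u, hu'⟩).2, ?_⟩
    simp

/-- Pairs between X and C join different clusters and are answered "same" with probability p only;
pairs between σ(X) and C are answered so at least as often. Decoupling, with the confined labelings
as competitors, therefore compares the two maxima at once, with no union bound over the labelings of
C. Confinement bounds the number of signs used by |X|β. -/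
theorem prob_not_exchange {p : ℝ} (hp0 : 0 ≤ p) (hp : p < 1 / 2) (hn : 2 ≤ n)
    (t : Fin n → Fin n) (X U C : Finset (Fin n)) (σ : Fin n → Fin n) (hσ : Set.BijOn σ X U)
    (hXU : ∀ x ∈ X, ∀ v ∈ U, x ≠ v) (hXC : ∀ x ∈ X, ∀ v ∈ C, t x ≠ t v)
    (hUC : ∀ u ∈ U, ∀ v ∈ C, u ≠ v) (α : ℝ) :
    prob (answerLaw p t) (fun a => ¬ ∀ c,
      Confined X C α (2000000 * (Real.log n / (1 - 2 * p) ^ 2)) c →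
      ∃ c', Confined X C α (2000000 * (Real.log n / (1 - 2 * p) ^ 2)) c' ∧
        agreement (wt a) C c + 2 * cross (wt a) X C c ≤
          agreement (wt a) C c' + 2 * (∑ x ∈ X, ∑ v ∈ C,
            if c' x = c' v then wt a (σ x) v else 0) +
            52000 * (Real.log n / (1 - 2 * p)) * X.card) ≤
      Real.exp (-(10 * Real.log n * X.card)) := by
  classical
  set δ := 1 - 2 * p with hδ
  have hδ0 : 0 < δ := by linarith
  have hδ1 : δ ≤ 1 := by linarith
  have hq := isBitLaw_answerLaw hp0 hp t
  have hn2 : (2 : ℝ) ≤ n := by exact_mod_cast hn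
  have hlog : 0 < Real.log n := Real.log_pos (by linarith)
  set β := 2000000 * (Real.log n / δ ^ 2) with hβ
  let s : Finset (Fin n → Fin n) := Finset.univ.filter (Confined X C α β)
  by_cases hs : s.Nonempty
  swap
  · refine (prob_mono hq (Q := fun _ => False) fun a ha => ?_).trans ?_
    · apply ha
      intro c hc
      exact absurd ⟨c, by simpa [s] using hc⟩ hs
    · simp only [prob, if_false]
      rw [expect_const hq]
      positivity
  have hσU : ∀ x ∈ X, σ x ∈ U := fun x hx => hσ.mapsTo hx
  let e₁ : X × C → Pair n := fun j => ⟨s(j.1.1, j.2.1), by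
    have := hXC _ j.1.2 _ j.2.2
    simp only [Sym2.mk_isDiag_iff]
    intro h
    exact this (congrArg t h)⟩
  let e₂ : X × C → Pair n := fun j => ⟨s(σ j.1.1, j.2.1), by
    simp only [Sym2.mk_isDiag_iff]
    exact hUC _ (hσU _ j.1.2) _ j.2.2⟩
  have hXC' : ∀ x ∈ X, ∀ v ∈ C, x ≠ v := fun x hx v hv h => hXC x hx v hv (congrArg t h)
  have h₁ : Function.Injective e₁ := by
    rintro ⟨⟨x, hx⟩, ⟨v, hv⟩⟩ ⟨⟨x', hx'⟩, ⟨v', hv'⟩⟩ h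
    simp only [e₁, Subtype.mk.injEq, Sym2.eq_iff] at h
    rcases h with ⟨rfl, rfl⟩ | ⟨h, -⟩
    · rfl
    · exact absurd h (hXC' _ hx _ hv')
  have h₂ : Function.Injective e₂ := by
    rintro ⟨⟨x, hx⟩, ⟨v, hv⟩⟩ ⟨⟨x', hx'⟩, ⟨v', hv'⟩⟩ h
    simp only [e₂, Subtype.mk.injEq, Sym2.eq_iff] at h
    rcases h with ⟨h, rfl⟩ | ⟨h, -⟩
    · obtain rfl := hσ.injOn hx hx' h
      rfl
    · exact absurd h (hUC _ (hσU _ hx) _ hv')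
  have hdisj : ∀ i j, e₁ i ≠ e₂ j := by
    rintro ⟨⟨x, hx⟩, ⟨v, hv⟩⟩ ⟨⟨x', hx'⟩, ⟨v', hv'⟩⟩ h
    simp only [e₁, e₂, Subtype.mk.injEq, Sym2.eq_iff] at h
    rcases h with ⟨h, -⟩ | ⟨h, -⟩
    · exact hXU _ hx _ (hσU _ hx') h
    · exact hXC' _ hx _ hv' h
  let M : (Fin n → Fin n) → Finset (X × C) := fun c =>
    Finset.univ.filter fun j => c j.1.1 = c j.2.1
  have hM : ∀ c ∈ s, ((M c).card : ℝ) ≤ X.card * β := by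
    intro c hc
    have hc' : Confined X C α β c := by simpa [s] using hc
    have h1 : ((M c).card : ℝ) = ∑ x : X, ((C.filter fun v => c v = c x.1).card : ℝ) := by
      rw [Finset.card_filter, Nat.cast_sum, Fintype.sum_prod_type]
      refine Finset.sum_congr rfl fun x _ => ?_
      rw [Finset.card_filter, Nat.cast_sum, ← Finset.sum_coe_sort C]
      exact Finset.sum_congr rfl fun v _ => by simp only [eq_comm]
    rw [h1]
    refine (Finset.sum_le_sum fun x _ => (hc' x.1 x.2).2.le).trans ?_
    simp
  have hwt₁ : ∀ (a : Answers n) (j : X × C), sg (a (e₁ j)) = wt a j.1.1 j.2.1 := by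
    intro a j
    simp only [wt, ord, dif_neg (hXC' _ j.1.2 _ j.2.2), e₁]
  have hwt₂ : ∀ (a : Answers n) (j : X × C), sg (a (e₂ j)) = wt a (σ j.1.1) j.2.1 := by
    intro a j
    simp only [wt, ord, dif_neg (hUC _ (hσU _ j.1.2) _ j.2.2), e₂]
  -- With this l the decoupling costs 8l²|X|β = 16|X| log n, while the allowed loss of 52000 D|X| is
  -- worth 26|X| log n after scaling by l/2. The difference is the exponent 10.
  set l := δ / 1000 with hl
  have hdom : ∀ j, answerLaw p t (e₁ j) true ≤ answerLaw p t (e₂ j) true := by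
    intro j
    have hne : ¬ Joined t (e₁ j) := by
      simp only [e₁, joined_mk]
      exact hXC _ j.1.2 _ j.2.2
    simp only [answerLaw, hne, true_iff, if_false]
    split_ifs <;> linarith
  have hmain := expect_exp_sup_sub_sup_le hq h₁ h₂ hdisj (l := l) (by positivity)
    (by rw [hl]; linarith) s hs M hM hdom
    (fun c a => l / 2 * agreement (wt a) C c) (by
      intro c a a' h
      congr 1
      unfold agreement
      refine Finset.sum_congr rfl fun u hu => Finset.sum_congr rfl fun v hv => ?_
      congr 1
      simp only [wt, ord]
      split_ifs with huv
      · rfl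
      · congr 1
        apply h
        · rintro ⟨⟨x, hx⟩, ⟨v', hv'⟩⟩ he
          simp only [e₁, Subtype.mk.injEq, Sym2.eq_iff] at he
          rcases he with ⟨h, -⟩ | ⟨-, h⟩
          · exact hXC' _ hx _ hu h.symm
          · exact hXC' _ hx _ hv h.symm
        · rintro ⟨⟨x, hx⟩, ⟨v', hv'⟩⟩ he
          simp only [e₂, Subtype.mk.injEq, Sym2.eq_iff] at he
          rcases he with ⟨h, -⟩ | ⟨-, h⟩
          · exact hUC _ (hσU _ hx) _ hu h.symm
          · exact hUC _ (hσU _ hx) _ hv h.symm)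
  simp only [hwt₁, hwt₂] at hmain
  have hsum : ∀ (c : Fin n → Fin n) (f : Fin n → Fin n → ℝ), ∑ j ∈ M c, l * f j.1.1 j.2.1 =
      l * ∑ x ∈ X, ∑ v ∈ C, if c x = c v then f x v else 0 := by
    intro c f
    rw [← Finset.mul_sum, Finset.sum_filter, Fintype.sum_prod_type, ← Finset.sum_coe_sort X]
    congr 1
    refine Finset.sum_congr rfl fun x _ => ?_
    rw [← Finset.sum_coe_sort C]
  have hsum₁ : ∀ (a : Answers n) (c : Fin n → Fin n), ∑ j ∈ M c, l * wt a j.1.1 j.2.1 =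
      l * cross (wt a) X C c := fun a c => by
    rw [hsum c (wt a)]
    unfold cross
    congr!
  have hsum₂ : ∀ (a : Answers n) (c : Fin n → Fin n), ∑ j ∈ M c, l * wt a (σ j.1.1) j.2.1 =
      l * ∑ x ∈ X, ∑ v ∈ C, if c x = c v then wt a (σ x) v else 0 :=
    fun a c => hsum c fun x v => wt a (σ x) v
  simp only [hsum₁, hsum₂] at hmain
  refine (prob_le_expect hq (F := fun a => Real.exp (-(26 * Real.log n * X.card)) *
    Real.exp ((s.sup' hs fun c => l / 2 * agreement (wt a) C c + l * cross (wt a) X C c) -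
      s.sup' hs fun c => l / 2 * agreement (wt a) C c +
        l * ∑ x ∈ X, ∑ v ∈ C, if c x = c v then wt a (σ x) v else 0))
    (fun a => by positivity) ?_).trans ?_
  · intro a ha
    rw [← Real.exp_add]
    refine Real.one_le_exp ?_
    push Not at ha
    obtain ⟨c, hc, hc'⟩ := ha
    have h1 := Finset.le_sup' (fun c => l / 2 * agreement (wt a) C c + l * cross (wt a) X C c)
      (show c ∈ s by simpa [s] using hc)
    have hl0 : 0 < l / 2 := by positivity
    have hconst : l / 2 * (52000 * (Real.log n / δ) * X.card) = 26 * Real.log n * X.card := by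
      rw [hl]; field_simp; ring
    -- Failure for one c means that every confined c' falls short, so the two maxima differ by the
    -- full allowance. The coefficient l/2 reflects that `agreement` counts each pair twice and
    -- `cross` once.
    have h2 : (s.sup' hs fun c => l / 2 * agreement (wt a) C c +
        l * ∑ x ∈ X, ∑ v ∈ C, if c x = c v then wt a (σ x) v else 0) ≤
        l / 2 * agreement (wt a) C c + l * cross (wt a) X C c - 26 * Real.log n * X.card := by
      refine Finset.sup'_le _ _ fun c' hcs => ?_
      have h3 := mul_le_mul_of_nonneg_left (hc' c' (by simpa [s] using hcs)).le hl0.le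
      rw [mul_add (l / 2) _ (52000 * (Real.log n / δ) * X.card), hconst] at h3
      linarith
    linarith
  · rw [expect_mul_left]
    refine (mul_le_mul_of_nonneg_left hmain (Real.exp_pos _).le).trans ?_
    rw [← Real.exp_add, Real.exp_le_exp]
    have : 8 * l ^ 2 * (X.card * β) = 16 * Real.log n * X.card := by
      rw [hl, hβ]; field_simp; ring
    rw [this]
    linarith

/-- A pair (X, U) is a labeling by two bits per point at distance |X| + |U| = 2|X| from the empty
one, so n^(-10|X|) is n⁻⁵ for each moved point. -/
theorem prob_not_exchangeable {p : ℝ} (hp0 : 0 ≤ p) (hp : p < 1 / 2) (hn : 2 ≤ n)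
    (t : Fin n → Fin n) (A B : Finset (Fin n)) (hAB : ∀ x ∈ B, ∀ v ∈ A, t x ≠ t v) (α : ℝ) :
    prob (answerLaw p t) (fun a => ¬ Exchangeable (wt a) A B α
      (2000000 * (Real.log n / (1 - 2 * p) ^ 2)) (52000 * (Real.log n / (1 - 2 * p)))) ≤
      8 / (n : ℝ) ^ 4 := by
  classical
  have hq := isBitLaw_answerLaw hp0 hp t
  have hn2 : (2 : ℝ) ≤ n := by exact_mod_cast hn
  have hn0 : (0 : ℝ) < n := by linarith
  have hexp := exp_neg_nat_mul_log hn 5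
  push_cast at hexp
  have hcard : (Fintype.card (Fin n) : ℝ) * Fintype.card (Bool × Bool) *
      Real.exp (-(5 * Real.log n)) = 4 / (n : ℝ) ^ 4 := by
    rw [hexp]
    simp only [Fintype.card_fin, Fintype.card_prod, Fintype.card_bool]
    push_cast
    field_simp
  have hpow : (16 : ℝ) ≤ n ^ 4 := by
    calc (16 : ℝ) = 2 ^ 4 := by norm_num
      _ ≤ n ^ 4 := pow_le_pow_left₀ (by norm_num) hn2 4
  have : Nonempty (Fin n → Fin n) := ⟨id⟩
  -- The bijection is fixed for each (X, U) before the answers are drawn.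
  choose! σ hσ using fun (x : Finset (Fin n) × Finset (Fin n)) (h : x.1.card = x.2.card) =>
    exists_bijOn_of_card_eq h
  let fX : (Fin n → Bool × Bool) → Finset (Fin n) := fun c => Finset.univ.filter fun v => (c v).1
  let fU : (Fin n → Bool × Bool) → Finset (Fin n) := fun c => Finset.univ.filter fun v => (c v).2
  have hmain := prob_exists_labeling_le hq (Lab := Bool × Bool)
    (fun _ : Fin n => (false, false))
    (fun c a => (fX c ⊆ B ∧ fU c ⊆ A ∧ (fX c).card = (fU c).card) ∧ ¬ ∀ c₀,
      Confined (fX c) (A \ fU c) α (2000000 * (Real.log n / (1 - 2 * p) ^ 2)) c₀ →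
      ∃ c', Confined (fX c) (A \ fU c) α (2000000 * (Real.log n / (1 - 2 * p) ^ 2)) c' ∧
        agreement (wt a) (A \ fU c) c₀ + 2 * cross (wt a) (fX c) (A \ fU c) c₀ ≤
          agreement (wt a) (A \ fU c) c' + 2 * (∑ x ∈ fX c, ∑ v ∈ A \ fU c,
            if c' x = c' v then wt a (σ (fX c, fU c) x) v else 0) +
            52000 * (Real.log n / (1 - 2 * p)) * (fX c).card)
    (r := Real.exp (-(5 * Real.log n))) (Real.exp_pos _).le ?_ ?_
  · rw [hcard] at hmain
    have h8 : 2 * (4 / (n : ℝ) ^ 4) = 8 / (n : ℝ) ^ 4 := by ring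
    rw [h8] at hmain
    refine le_trans (prob_mono hq ?_) hmain
    intro a ha
    simp only [Exchangeable, not_forall] at ha
    obtain ⟨X, U, hX0, hXB, hUA, hc, h⟩ := ha
    let c : Fin n → Bool × Bool := fun v => (decide (v ∈ X), decide (v ∈ U))
    have hfX : fX c = X := by ext v; simp [fX, c]
    have hfU : fU c = U := by ext v; simp [fU, c]
    refine ⟨c, ?_, ?_⟩
    · intro h
      obtain ⟨x, hx⟩ := hX0
      have := congrFun h x
      simp [c, hx] at this
    · rw [hfX, hfU]
      refine ⟨⟨hXB, hUA, hc⟩, fun h' => h ⟨σ (X, U), hσ (X, U) hc, h'⟩⟩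
  · intro c _
    by_cases h : fX c ⊆ B ∧ fU c ⊆ A ∧ (fX c).card = (fU c).card
    · obtain ⟨hXB, hUA, hcd⟩ := h
      have hXU : ∀ x ∈ fX c, ∀ v ∈ fU c, x ≠ v := fun x hx v hv h =>
        hAB x (hXB hx) v (hUA hv) (congrArg t h)
      refine (prob_mono hq fun a ha => ha.2).trans ((prob_not_exchange hp0 hp hn t (fX c) (fU c)
        (A \ fU c) _ (hσ (fX c, fU c) hcd) hXU
        (fun x hx v hv => hAB x (hXB hx) v (Finset.mem_sdiff.1 hv).1)
        (fun u hu v hv h => (Finset.mem_sdiff.1 hv).2 (h ▸ hu)) α).trans ?_)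
      rw [← Real.exp_nat_mul, Real.exp_le_exp]
      have hfil : (Finset.univ.filter fun v => c v ≠ (false, false)) = fX c ∪ fU c := by
        ext v
        simp only [fX, fU, Finset.mem_filter, Finset.mem_univ, true_and, Finset.mem_union]
        rcases h : c v with ⟨_ | _, _ | _⟩ <;> simp
      have hdj : Disjoint (fX c) (fU c) :=
        Finset.disjoint_left.2 fun x hx hu => hXU x hx x hu rfl
      rw [hfil, Finset.card_union_of_disjoint hdj, ← hcd]
      push_cast
      apply le_of_eq
      ring
    · refine (prob_mono hq (Q := fun _ => False) fun a ha => h ha.1).trans ?_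
      simp only [prob, if_false]
      rw [expect_const hq]
      positivity
  · rw [hcard, div_le_one (by positivity)]
    linarith

end Events

end FaultyOracle

namespace FaultyOracle

/-! ### Agreement of labelings and its optimizers -/

section Agreement

variable {n : ℕ} {w : Fin n → Fin n → ℝ}

theorem agreement_def {α : Type*} [DecidableEq α] (w : Fin n → Fin n → ℝ) (Y : Finset (Fin n))
    (c : Fin n → α) : agreement w Y c = ∑ u ∈ Y, ∑ v ∈ Y, if c u = c v then w u v else 0 := by
  unfold agreement; congr!

theorem cross_def {α : Type*} [DecidableEq α] (w : Fin n → Fin n → ℝ) (X C : Finset (Fin n))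
    (c : Fin n → α) : cross w X C c = ∑ u ∈ X, ∑ v ∈ C, if c u = c v then w u v else 0 := by
  unfold cross; congr!

theorem agreement_congr {α β : Type*} {Y : Finset (Fin n)} {c : Fin n → α} {c' : Fin n → β}
    (h : ∀ u ∈ Y, ∀ v ∈ Y, (c u = c v ↔ c' u = c' v)) : agreement w Y c = agreement w Y c' := by
  classical
  simp only [agreement_def]
  refine Finset.sum_congr rfl fun u hu => Finset.sum_congr rfl fun v hv => ?_
  simp only [h u hu v hv]

theorem cross_eq_zero {α : Type*} {X C : Finset (Fin n)} {c : Fin n → α}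
    (h : ∀ u ∈ X, ∀ v ∈ C, c u ≠ c v) : cross w X C c = 0 := by
  classical
  simp only [cross_def]
  exact Finset.sum_eq_zero fun u hu => Finset.sum_eq_zero fun v hv => if_neg (h u hu v hv)

theorem cross_union_right {α : Type*} {X C D : Finset (Fin n)} (c : Fin n → α)
    (h : Disjoint C D) : cross w X (C ∪ D) c = cross w X C c + cross w X D c := by
  classical
  simp only [cross_def, Finset.sum_union h, Finset.sum_add_distrib]

theorem cross_union_left {α : Type*} {X C D : Finset (Fin n)} (c : Fin n → α)
    (h : Disjoint C D) : cross w (C ∪ D) X c = cross w C X c + cross w D X c := by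
  classical
  simp only [cross_def, Finset.sum_union h]

theorem agreement_union {α : Type*} (hw : ∀ u v, w u v = w v u) {X C : Finset (Fin n)}
    (c : Fin n → α) (h : Disjoint X C) :
    agreement w (X ∪ C) c = agreement w X c + agreement w C c + 2 * cross w X C c := by
  classical
  have h1 : cross w C X c = cross w X C c := by
    simp only [cross_def]
    rw [Finset.sum_comm]
    refine Finset.sum_congr rfl fun u _ => Finset.sum_congr rfl fun v _ => ?_
    rw [hw v u]
    simp only [eq_comm]
  have h2 : ∀ Y, agreement w Y c = cross w Y Y c := fun Y => rfl
  rw [h2 (X ∪ C), cross_union_right c h, cross_union_left c h, cross_union_left c h, h1, h2, h2]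
  ring

/-- No labeling has a larger agreement on `Y`. -/
def IsOptimal (w : Fin n → Fin n → ℝ) (Y : Finset (Fin n)) (c : Fin n → Fin n) : Prop :=
  ∀ c' : Fin n → Fin n, agreement w Y c' ≤ agreement w Y c

theorem exists_isOptimal (w : Fin n → Fin n → ℝ) (Y : Finset (Fin n)) : ∃ c, IsOptimal w Y c := by
  obtain ⟨c, -, hc⟩ := Finset.exists_max_image (Finset.univ : Finset (Fin n → Fin n))
    (agreement w Y) ⟨id, Finset.mem_univ _⟩
  exact ⟨c, fun c' => hc c' (Finset.mem_univ _)⟩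

theorem exists_same_classes {β : Type*} (c : Fin n → β) :
    ∃ g : Fin n → Fin n, (∀ u v, g u = g v ↔ c u = c v) ∧ ∀ v, c (g v) = c v := by
  have h : ∀ v, ∃ u, c u = c v := fun v => ⟨v, rfl⟩
  have key : ∀ v, c (Classical.choose (h v)) = c v := fun v => Classical.choose_spec (h v)
  refine ⟨fun v => Classical.choose (h v), fun u v => ⟨fun e => ?_, fun e => ?_⟩, key⟩
  · have e' := congrArg c e
    simpa only [key] using e'
  · simp only [e]

/-- Agreement depends only on the classes, and every class can be named by one of its points. Hence
optimality among labels in `Fin n` covers competitors with labels of any type. -/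
theorem IsOptimal.agreement_le {Y : Finset (Fin n)} {c : Fin n → Fin n} (hc : IsOptimal w Y c)
    {β : Type*} (c' : Fin n → β) : agreement w Y c' ≤ agreement w Y c := by
  obtain ⟨g, hg, -⟩ := exists_same_classes c'
  rw [← agreement_congr (w := w) (Y := Y) (c := g) fun u _ v _ => hg u v]
  exact hc g

theorem agreement_glue {α β : Type*} (hw : ∀ u v, w u v = w v u) {X C : Finset (Fin n)}
    [DecidablePred (· ∈ X)] (c : Fin n → α) (c' : Fin n → β) (h : Disjoint X C) :
    agreement w (X ∪ C) (fun v => if v ∈ X then Sum.inl (c v) else Sum.inr (c' v)) =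
      agreement w X c + agreement w C c' := by
  rw [agreement_union hw _ h, cross_eq_zero, agreement_congr (c' := c), mul_zero, add_zero,
    agreement_congr (Y := C) (c' := c')]
  · intro u hu v hv
    have hu' : u ∉ X := Finset.disjoint_right.1 h hu
    have hv' : v ∉ X := Finset.disjoint_right.1 h hv
    simp [hu', hv']
  · intro u hu v hv
    simp [hu, hv]
  · intro u hu v hv
    have hv' : v ∉ X := Finset.disjoint_right.1 h hv
    simp [hu, hv']

/-- An optimal labeling is optimal on every union of its classes. -/
theorem IsOptimal.of_closed (hw : ∀ u v, w u v = w v u) {Y S : Finset (Fin n)}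
    {c : Fin n → Fin n} (hc : IsOptimal w Y c) (hS : S ⊆ Y)
    (hcl : ∀ u ∈ S, ∀ v ∈ Y, c u = c v → v ∈ S) : IsOptimal w S c := by
  classical
  intro c'
  have h1 : S ∪ Y \ S = Y := Finset.union_sdiff_of_subset hS
  have h2 := hc.agreement_le (fun v => if v ∈ S then Sum.inl (c' v) else Sum.inr (c v))
  rw [← h1, agreement_glue hw _ _ Finset.disjoint_sdiff,
    agreement_union hw c Finset.disjoint_sdiff, cross_eq_zero] at h2
  · linarith
  · intro u hu v hv huv
    obtain ⟨hv1, hv2⟩ := Finset.mem_sdiff.1 hv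
    exact hv2 (hcl u hu v hv1 huv)

/-- Singleton classes contribute nothing because the weights vanish on the diagonal. This allows all
irrelevant points to be isolated, which makes them agree with the reference labeling. -/
theorem agreement_eq_of_isolated {α : Type*} (hw : ∀ u v, w u v = w v u) (hw0 : ∀ u, w u u = 0)
    {Y S : Finset (Fin n)} (hS : S ⊆ Y) {c : Fin n → α}
    (h : ∀ u ∈ Y, u ∉ S → ∀ v ∈ Y, c v = c u → v = u) : agreement w Y c = agreement w S c := by
  classical
  have h1 : S ∪ Y \ S = Y := Finset.union_sdiff_of_subset hS
  rw [← h1, agreement_union hw c Finset.disjoint_sdiff, cross_eq_zero]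
  · have h2 : agreement w (Y \ S) c = 0 := by
      rw [agreement_def]
      refine Finset.sum_eq_zero fun u hu => Finset.sum_eq_zero fun v hv => ?_
      split_ifs with e
      · obtain ⟨hv1, hv2⟩ := Finset.mem_sdiff.1 hv
        rw [h v hv1 hv2 u (Finset.mem_sdiff.1 hu).1 e, hw0]
      · rfl
    rw [h2]; ring
  · intro u hu v hv e
    obtain ⟨hv1, hv2⟩ := Finset.mem_sdiff.1 hv
    rw [h v hv1 hv2 u (hS hu) e] at hu
    exact hv2 hu

/-- Where the two labelings differ, c₂ is right, so each such pair changes the agreement by its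
truth-signed weight. Elsewhere c₂ need not be the truth; this is what permits partial corrections.
-/
theorem agreement_sub_agreement {α β : Type*} {t : Fin n → Fin n} {Y : Finset (Fin n)}
    {c₁ : Fin n → α} {c₂ : Fin n → β}
    (h₁ : ∀ u ∈ Y, ∀ v ∈ Y, c₁ u = c₁ v → c₂ u ≠ c₂ v → t u ≠ t v)
    (h₂ : ∀ u ∈ Y, ∀ v ∈ Y, c₁ u ≠ c₁ v → c₂ u = c₂ v → t u = t v) :
    agreement w Y c₂ - agreement w Y c₁ = disagreeSum Y c₁ c₂ (truthWt t w) := by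
  classical
  simp only [agreement_def, disagreeSum, ← Finset.sum_sub_distrib]
  refine Finset.sum_congr rfl fun u hu => Finset.sum_congr rfl fun v hv => ?_
  have e1 := h₁ u hu v hv
  have e2 := h₂ u hu v hv
  unfold truthWt
  by_cases a1 : c₁ u = c₁ v <;> by_cases a2 : c₂ u = c₂ v
  · simp [a1, a2]
  · simp [a1, a2, e1 a1 a2]
  · simp [a1, a2, e2 a1 a2]
  · simp [a1, a2]

theorem disagreeSum_one {α β : Type*} [DecidableEq α] [DecidableEq β] (Y : Finset (Fin n))
    (c₁ : Fin n → α) (c₂ : Fin n → β) : disagreeSum Y c₁ c₂ (fun _ _ => 1) =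
      ∑ u ∈ Y, ((Y.filter fun v => ¬ (c₁ u = c₁ v ↔ c₂ u = c₂ v)).card : ℝ) := by
  unfold disagreeSum
  refine Finset.sum_congr rfl fun u _ => ?_
  rw [Finset.card_filter, Nat.cast_sum]
  refine Finset.sum_congr rfl fun v _ => ?_
  split_ifs <;> simp

/-- In applications only a superset Z of the moved points is known, which is harmless since the
threshold grows with their number. If no point moves, the labelings coincide and both sides vanish.
-/
theorem ReliableNear.le_disagreeSum {t : Fin n → Fin n} {Y : Finset (Fin n)} {δ r : ℝ}
    {base : Fin n → Lab n} (hR : ReliableNear t w Y δ r base) (hr : 0 ≤ r)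
    (c₁ c₂ : Fin n → Lab n) (Z : Finset (Fin n)) (hZ : ∀ v, v ∉ Z → c₁ v = base v ∧ c₂ v = base v)
    (hN : r * Z.card ≤ disagreeSum Y c₁ c₂ (fun _ _ => 1)) :
    δ / 2 * disagreeSum Y c₁ c₂ (fun _ _ => 1) ≤ disagreeSum Y c₁ c₂ (truthWt t w) := by
  classical
  have hsub : (Finset.univ.filter fun v => ¬ (c₁ v = base v ∧ c₂ v = base v)) ⊆ Z := by
    intro v hv
    by_contra h
    exact (Finset.mem_filter.1 hv).2 (hZ v h)
  rcases Nat.eq_zero_or_pos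
    (Finset.univ.filter fun v => ¬ (c₁ v = base v ∧ c₂ v = base v)).card with h0 | h0
  · have h : ∀ v, c₁ v = c₂ v := by
      intro v
      rw [Finset.card_eq_zero, Finset.filter_eq_empty_iff] at h0
      have := h0 (Finset.mem_univ v)
      push Not at this
      rw [this.1, this.2]
    have h' : c₁ = c₂ := funext h
    simp [disagreeSum, h']
  · refine hR c₁ c₂ h0 (le_trans (mul_le_mul_of_nonneg_left ?_ hr) hN)
    exact_mod_cast Finset.card_le_card hsub

end Agreement

/-! ### Matching classes with true clusters -/

section Relabel

variable {n : ℕ}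

/-- The cluster of `v` and its class under `c` share more than half of the points of each. -/
def Matched (S : Finset (Fin n)) (t c : Fin n → Fin n) (v : Fin n) : Prop :=
  (S.filter fun u => c u = c v).card < 2 * (S.filter fun u => c u = c v ∧ t u = t v).card ∧
  (S.filter fun u => t u = t v).card < 2 * (S.filter fun u => c u = c v ∧ t u = t v).card

/-- Two subsets that each contain more than half of one class must meet, and a common point
identifies the two clusters. -/
theorem Matched.congr_left {S : Finset (Fin n)} {t c : Fin n → Fin n} {u v : Fin n}
    (hu : Matched S t c u) (hv : Matched S t c v) (h : c u = c v) : t u = t v := by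
  by_contra hne
  have hdis : Disjoint (S.filter fun x => c x = c u ∧ t x = t u)
      (S.filter fun x => c x = c v ∧ t x = t v) := by
    rw [Finset.disjoint_left]
    intro x hx hx'
    exact hne ((Finset.mem_filter.1 hx).2.2.symm.trans (Finset.mem_filter.1 hx').2.2)
  have hsub : (S.filter fun x => c x = c u ∧ t x = t u) ∪
      (S.filter fun x => c x = c v ∧ t x = t v) ⊆ S.filter fun x => c x = c v := by
    intro x hx
    rcases Finset.mem_union.1 hx with hx | hx
    · have := Finset.mem_filter.1 hx
      exact Finset.mem_filter.2 ⟨this.1, this.2.1.trans h⟩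
    · have := Finset.mem_filter.1 hx
      exact Finset.mem_filter.2 ⟨this.1, this.2.1⟩
  have hcard := Finset.card_le_card hsub
  rw [Finset.card_union_of_disjoint hdis] at hcard
  have h1 := hu.1
  have h2 := hv.1
  rw [h] at h1
  rw [h] at hcard
  omega

theorem Matched.congr_right {S : Finset (Fin n)} {t c : Fin n → Fin n} {u v : Fin n}
    (hu : Matched S t c u) (hv : Matched S t c v) (h : t u = t v) : c u = c v := by
  have swap : ∀ {x}, Matched S t c x → Matched S c t x := by
    intro x hx
    unfold Matched at hx ⊢
    simp only [and_comm (a := t _ = t _)]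
    exact ⟨hx.2, hx.1⟩
  exact (swap hu).congr_left (swap hv) h

/-- A labeling can be renamed so that it gives the matched points the labels of their clusters. -/
theorem exists_relabel (S : Finset (Fin n)) (t c : Fin n → Fin n) :
    ∃ c₁ : Fin n → Lab n, (∀ u v, c₁ u = c₁ v ↔ c u = c v) ∧
      (∀ v ∈ S, Matched S t c v → c₁ v = (0, t v)) ∧ ∀ v, (c₁ v).1 ≠ 2 := by
  classical
  -- A class with a matched point gets the name of that point's cluster, which is unique by
  -- `Matched.congr_left`; other classes keep their names in another palette. Relative to the truth
  -- only unmatched points then count as moved, and palette 2 stays free for singletons.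
  let P : Fin n → Prop := fun v => ∃ x, Matched S t c x ∧ c x = c v
  let c₁ : Fin n → Lab n := fun v =>
    if h : P v then (0, t (Classical.choose h)) else (1, c v)
  have hpos : ∀ v x, Matched S t c x → c x = c v → c₁ v = (0, t x) := by
    intro v x hx hxv
    have h : P v := ⟨x, hx, hxv⟩
    have hs := Classical.choose_spec h
    simp only [c₁, dif_pos h]
    rw [hs.1.congr_left hx (hs.2.trans hxv.symm)]
  have hneg : ∀ v, ¬ P v → c₁ v = (1, c v) := fun v h => by simp only [c₁, dif_neg h]
  refine ⟨c₁, fun u v => ?_, fun v _ hv => hpos v v hv rfl, fun v => ?_⟩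
  swap
  · by_cases h : P v <;> simp [c₁, h]
  by_cases hu : P u <;> by_cases hv : P v
  · obtain ⟨x, hx, hxu⟩ := hu
    obtain ⟨y, hy, hyv⟩ := hv
    rw [hpos u x hx hxu, hpos v y hy hyv, ← hxu, ← hyv]
    simp only [Prod.mk.injEq, true_and]
    exact ⟨hx.congr_right hy, hx.congr_left hy⟩
  · obtain ⟨x, hx, hxu⟩ := hu
    rw [hpos u x hx hxu, hneg v hv]
    simp only [Prod.mk.injEq, zero_ne_one, false_and, false_iff]
    exact fun h => hv ⟨x, hx, hxu.trans h⟩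
  · obtain ⟨y, hy, hyv⟩ := hv
    rw [hpos v y hy hyv, hneg u hu]
    simp only [Prod.mk.injEq, one_ne_zero, false_and, false_iff]
    exact fun h => hu ⟨y, hy, hyv.trans h.symm⟩
  · rw [hneg u hu, hneg v hv]
    simp

/-- Let I be the size of the intersection of class and cluster, and a, b the sizes of the two
differences. If there is no match, I ≤ a or I ≤ b, so both I + a and I + b are at most 2(a + b). An
unmatched point thus disagrees with the truth on many pairs as soon as its class or its cluster is
large. -/
theorem card_filter_le_of_not_matched {S : Finset (Fin n)} {t c : Fin n → Fin n} {v : Fin n}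
    (h : ¬ Matched S t c v) :
    (S.filter fun u => c u = c v).card ≤
      2 * (S.filter fun u => ¬ (c v = c u ↔ t v = t u)).card ∧
    (S.filter fun u => t u = t v).card ≤
      2 * (S.filter fun u => ¬ (c v = c u ↔ t v = t u)).card := by
  classical
  set I := (S.filter fun u => c u = c v ∧ t u = t v).card with hI
  have h1 : (S.filter fun u => c u = c v).card =
      I + (S.filter fun u => c u = c v ∧ t u ≠ t v).card := by
    rw [hI, ← Finset.card_union_of_disjoint]
    · congr 1
      ext x
      simp only [Finset.mem_filter, Finset.mem_union]
      tauto
    · rw [Finset.disjoint_left]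
      intro x hx hx'
      simp only [Finset.mem_filter] at hx hx'
      tauto
  have h2 : (S.filter fun u => t u = t v).card =
      I + (S.filter fun u => c u ≠ c v ∧ t u = t v).card := by
    rw [hI, ← Finset.card_union_of_disjoint]
    · congr 1
      ext x
      simp only [Finset.mem_filter, Finset.mem_union]
      tauto
    · rw [Finset.disjoint_left]
      intro x hx hx'
      simp only [Finset.mem_filter] at hx hx'
      tauto
  have h3 : (S.filter fun u => ¬ (c v = c u ↔ t v = t u)).card =
      (S.filter fun u => c u = c v ∧ t u ≠ t v).card +
      (S.filter fun u => c u ≠ c v ∧ t u = t v).card := by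
    rw [← Finset.card_union_of_disjoint]
    · congr 1
      ext x
      simp only [Finset.mem_filter, Finset.mem_union, eq_comm (a := c v), eq_comm (a := t v)]
      tauto
    · rw [Finset.disjoint_left]
      intro x hx hx'
      simp only [Finset.mem_filter] at hx hx'
      tauto
  unfold Matched at h
  rw [h1, h2] at h ⊢
  rw [h3]
  omega

end Relabel

/-! ### Comparison of optimal labelings: majorities, low degrees, attachment -/

section Recovery

variable {n : ℕ} {w : Fin n → Fin n → ℝ}

/-- Lightness applies to each class separately, and the class sizes add up to |S|. -/
theorem abs_agreement_le {α s : ℝ} (hS : SmallSetsLight w α s) {S : Finset (Fin n)}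
    {c : Fin n → Fin n} (h : ∀ v ∈ S, ((S.filter fun u => c u = c v).card : ℝ) ≤ α) :
    |agreement w S c| ≤ s * S.card := by
  have h1 : agreement w S c = ∑ i : Fin n, ∑ u ∈ S.filter (fun u => c u = i),
      ∑ v ∈ S.filter (fun v => c v = i), w u v := by
    rw [agreement_def, ← Finset.sum_fiberwise S c]
    refine Finset.sum_congr rfl fun i _ => Finset.sum_congr rfl fun u hu => ?_
    rw [Finset.sum_filter]
    refine Finset.sum_congr rfl fun v _ => ?_
    rw [(Finset.mem_filter.1 hu).2]
    simp only [eq_comm]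
  have h2 : (S.card : ℝ) = ∑ i : Fin n, ((S.filter fun u => c u = i).card : ℝ) := by
    rw [← Nat.cast_sum]
    congr 1
    exact Finset.card_eq_sum_card_fiberwise fun v _ => Finset.mem_univ _
  rw [h1, h2, Finset.mul_sum]
  refine (Finset.abs_sum_le_sum_abs _ _).trans (Finset.sum_le_sum fun i _ => ?_)
  rcases (S.filter fun u => c u = i).eq_empty_or_nonempty with he | ⟨v, hv⟩
  · simp [he]
  · refine hS _ ?_
    have hv' := Finset.mem_filter.1 hv
    have := h v hv'.1
    rwa [hv'.2] at this

/-- No class of an optimal labeling is a large set without a majority cluster. -/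
theorem exists_majority (hw : ∀ u v, w u v = w v u) (hw0 : ∀ u, w u u = 0)
    {t : Fin n → Fin n} {Y : Finset (Fin n)} {δ L : ℝ} (hδ : 0 < δ) (hL : 0 < L)
    (hR : ReliableNear t w Y δ (400 * L) (fun v => (2, v)))
    {c : Fin n → Fin n} (hc : IsOptimal w Y c) {v : Fin n}
    (hv : 800 * L ≤ (Y.filter fun u => c u = c v).card) :
    ∃ u ∈ Y, c u = c v ∧ (Y.filter fun x => c x = c v).card <
      2 * ((Y.filter fun x => c x = c v).filter fun x => t x = t u).card := by
  classical
  by_contra hcon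
  push Not at hcon
  set P := Y.filter fun u => c u = c v with hP
  have hPY : P ⊆ Y := Finset.filter_subset _ _
  -- The class P as a whole is compared with its splitting into true clusters, all other points
  -- being singletons. Without a majority each point of P disagrees with at least half of P, giving
  -- at least |P|²/2 ≥ 400L|P| pairs, so the splitting would be strictly better.
  let c₁ : Fin n → Lab n := fun u => if u ∈ P then (1, v) else (2, u)
  let c₂ : Fin n → Lab n := fun u => if u ∈ P then (0, t u) else (2, u)
  have hP0 : (0 : ℝ) < P.card := lt_of_lt_of_le (by positivity) hv
  have hN : ((P.card : ℝ) / 2) * P.card ≤ disagreeSum Y c₁ c₂ (fun _ _ => 1) := by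
    rw [disagreeSum_one]
    calc ((P.card : ℝ) / 2) * P.card = ∑ _u ∈ P, (P.card : ℝ) / 2 := by
          rw [Finset.sum_const, nsmul_eq_mul]; ring
      _ ≤ ∑ u ∈ P, ((Y.filter fun v => ¬ (c₁ u = c₁ v ↔ c₂ u = c₂ v)).card : ℝ) := by
          refine Finset.sum_le_sum fun u hu => ?_
          have hu' := Finset.mem_filter.1 hu
          have h1 := hcon u hu'.1 hu'.2
          have h2 : P.card = (P.filter fun x => t x = t u).card +
              (P.filter fun x => ¬ t x = t u).card :=
            (Finset.card_filter_add_card_filter_not _).symm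
          have h3 : (P.filter fun x => ¬ t x = t u).card ≤
              (Y.filter fun v => ¬ (c₁ u = c₁ v ↔ c₂ u = c₂ v)).card := by
            refine Finset.card_le_card fun x hx => ?_
            obtain ⟨hx1, hx2⟩ := Finset.mem_filter.1 hx
            refine Finset.mem_filter.2 ⟨hPY hx1, ?_⟩
            simp only [c₁, c₂, hu, hx1, if_true, true_iff, Prod.mk.injEq, true_and]
            exact fun h => hx2 h.symm
          have h4 : P.card ≤ 2 * (Y.filter fun v => ¬ (c₁ u = c₁ v ↔ c₂ u = c₂ v)).card := by
            omega
          have h5 : (P.card : ℝ) ≤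
              2 * ((Y.filter fun v => ¬ (c₁ u = c₁ v ↔ c₂ u = c₂ v)).card : ℝ) := by
            exact_mod_cast h4
          linarith
      _ ≤ _ := Finset.sum_le_sum_of_subset_of_nonneg hPY fun _ _ _ => Nat.cast_nonneg _
  have hrel := hR.le_disagreeSum (by positivity) c₁ c₂ P
    (fun v hv => by simp [c₁, c₂, hv]) (by nlinarith)
  have hdiff : agreement w Y c₂ - agreement w Y c₁ = disagreeSum Y c₁ c₂ (truthWt t w) := by
    refine agreement_sub_agreement (fun x _ y _ => ?_) fun x _ y _ => ?_ <;>
      by_cases hx : x ∈ P <;> by_cases hy : y ∈ P <;> simp [c₁, c₂, hx, hy] <;> tauto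
  have hiso₁ : agreement w Y c₁ = agreement w P c := by
    rw [agreement_eq_of_isolated hw hw0 hPY]
    · refine agreement_congr fun x hx y hy => ?_
      have hx' := (Finset.mem_filter.1 hx).2
      have hy' := (Finset.mem_filter.1 hy).2
      simp [c₁, hx, hy, hx', hy']
    · intro x _ hx y _ hxy
      by_cases hy : y ∈ P
      · simp [c₁, hx, hy] at hxy
      · simpa [c₁, hx, hy] using hxy
  have hiso₂ : agreement w Y c₂ = agreement w P t := by
    rw [agreement_eq_of_isolated hw hw0 hPY]
    · refine agreement_congr fun x hx y hy => ?_
      simp [c₂, hx, hy]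
    · intro x _ hx y _ hxy
      by_cases hy : y ∈ P
      · simp [c₂, hx, hy] at hxy
      · simpa [c₂, hx, hy] using hxy
  have hopt : agreement w P t ≤ agreement w P c := by
    refine (hc.of_closed hw hPY fun x hx y hy hxy => ?_) t
    exact Finset.mem_filter.2 ⟨hy, hxy ▸ (Finset.mem_filter.1 hx).2⟩
  have : 0 < δ / 2 * disagreeSum Y c₁ c₂ (fun _ _ => 1) :=
    mul_pos (by positivity) (lt_of_lt_of_le (by positivity) hN)
  linarith

/-- Removing points of low degree one after another. -/
theorem exists_low_degree_subset (hw : ∀ u v, w u v = w v u) (hw0 : ∀ u, w u u = 0)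
    {Y A X Λ : Finset (Fin n)} {α s : ℝ} (hs : 0 ≤ s) (hS : SmallSetsLight w α s)
    (hA : A ⊆ Y) (hX : X ⊆ Y) (hXA : Disjoint X A) {c : Fin n → Fin n}
    (hΛ : Λ = A.filter fun v => ((Y.filter fun u => c u = c v).card : ℝ) < α)
    (hcard : 2 * X.card ≤ Λ.card) (k : ℕ) (hk : k ≤ X.card) :
    ∃ U ⊆ Λ, U.card = k ∧ agreement w A c + 2 * cross w X A c ≤
      agreement w (A \ U) c + 2 * cross w X (A \ U) c + 6 * s * k := by
  classical
  induction k with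
  | zero => exact ⟨∅, by simp, by simp, by simp⟩
  | succ k ih =>
    obtain ⟨U, hUΛ, hUk, hU⟩ := ih (by omega)
    have hΛA : Λ ⊆ A := by rw [hΛ]; exact Finset.filter_subset _ _
    set C := A \ U with hC
    set Λ' := Λ \ U with hΛ'
    have hΛC : Λ' ⊆ C := Finset.sdiff_subset_sdiff hΛA le_rfl
    -- Fewer than |X| points have been removed so far, so more than |X| of the at least 2|X| points
    -- of Λ remain; this keeps the average degree bounded below.
    have hΛ'card : X.card + 1 ≤ Λ'.card := by
      rw [hΛ', Finset.card_sdiff_of_subset hUΛ]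
      omega
    let deg : Fin n → ℝ := fun u => (∑ v ∈ C, if c u = c v then w u v else 0) +
      ∑ x ∈ X, if c x = c u then w x u else 0
    have hclosed : ∀ u ∈ Λ', ∀ v ∈ C, c u = c v → v ∈ Λ' := by
      intro u hu v hv huv
      obtain ⟨hv1, hv2⟩ := Finset.mem_sdiff.1 hv
      obtain ⟨hu1, -⟩ := Finset.mem_sdiff.1 hu
      refine Finset.mem_sdiff.2 ⟨?_, hv2⟩
      rw [hΛ] at hu1 ⊢
      have := (Finset.mem_filter.1 hu1).2
      rw [huv] at this
      exact Finset.mem_filter.2 ⟨hv1, this⟩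
    set X' := X.filter fun v => ((Y.filter fun u => c u = c v).card : ℝ) < α with hX'
    have hdj : Disjoint X' Λ' := by
      rw [Finset.disjoint_left]
      intro x hx hx'
      exact Finset.disjoint_left.1 hXA (Finset.mem_filter.1 hx).1
        (hΛA (Finset.mem_sdiff.1 hx').1)
    have hcr : cross w X Λ' c = cross w X' Λ' c := by
      have h1 : X' ∪ X \ X' = X := Finset.union_sdiff_of_subset (Finset.filter_subset _ _)
      conv_lhs => rw [← h1]
      rw [cross_union_left c Finset.disjoint_sdiff, cross_eq_zero (X := X \ X'), add_zero]
      intro x hx u hu hxu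
      obtain ⟨hx1, hx2⟩ := Finset.mem_sdiff.1 hx
      have hu1 := (Finset.mem_sdiff.1 hu).1
      rw [hΛ] at hu1
      have := (Finset.mem_filter.1 hu1).2
      rw [← hxu] at this
      exact hx2 (Finset.mem_filter.2 ⟨hx1, this⟩)
    have hsum : ∑ u ∈ Λ', deg u = agreement w Λ' c + cross w X' Λ' c := by
      simp only [deg, Finset.sum_add_distrib]
      congr 1
      · rw [agreement_def]
        refine Finset.sum_congr rfl fun u hu => ?_
        symm
        refine Finset.sum_subset hΛC fun v hv hv' => if_neg fun h => hv' (hclosed u hu v hv h)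
      · rw [← hcr, cross_def, Finset.sum_comm]
    have hpiece : ∀ S : Finset (Fin n), S ⊆ Y →
        (∀ v ∈ S, ((Y.filter fun u => c u = c v).card : ℝ) < α) →
        |agreement w S c| ≤ s * S.card := by
      intro S hSY h
      refine abs_agreement_le hS fun v hv => le_trans ?_ (h v hv).le
      exact_mod_cast Finset.card_le_card (Finset.filter_subset_filter _ hSY)
    have hsmallΛ : ∀ v ∈ Λ', ((Y.filter fun u => c u = c v).card : ℝ) < α := by
      intro v hv
      have hv1 := (Finset.mem_sdiff.1 hv).1
      rw [hΛ] at hv1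
      exact (Finset.mem_filter.1 hv1).2
    have hsmallX : ∀ v ∈ X', ((Y.filter fun u => c u = c v).card : ℝ) < α :=
      fun v hv => (Finset.mem_filter.1 hv).2
    have hΛY : Λ' ⊆ Y := (hΛC.trans Finset.sdiff_subset).trans hA
    have hX'Y : X' ⊆ Y := (Finset.filter_subset _ _).trans hX
    have b1 := abs_le.1 (hpiece Λ' hΛY hsmallΛ)
    have b2 := abs_le.1 (hpiece X' hX'Y hsmallX)
    have b3 := abs_le.1 (hpiece (X' ∪ Λ') (Finset.union_subset hX'Y hΛY) fun v hv =>
      (Finset.mem_union.1 hv).elim (hsmallX v) (hsmallΛ v))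
    rw [agreement_union hw c hdj, Finset.card_union_of_disjoint hdj] at b3
    push_cast at b3
    have hX'card : (X'.card : ℝ) ≤ Λ'.card := by
      have : X'.card ≤ X.card := Finset.card_le_card (Finset.filter_subset _ _)
      exact_mod_cast (by omega : X'.card ≤ Λ'.card)
    have hX's := mul_le_mul_of_nonneg_left hX'card hs
    -- Lightness of X', Λ' and their union bounds the cross term by s(|X'| + |Λ'|) ≤ 2s|Λ'|, and the
    -- agreement inside Λ' by s|Λ'|. So some point has degree at most 3s, and removing it loses at
    -- most 6s.
    have hdeg : ∑ u ∈ Λ', deg u ≤ ∑ _u ∈ Λ', 3 * s := by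
      rw [hsum, Finset.sum_const, nsmul_eq_mul]
      nlinarith [b1.1, b1.2, b2.1, b2.2, b3.1, b3.2]
    obtain ⟨u, hu, hdu⟩ := Finset.exists_le_of_sum_le
      (Finset.card_pos.1 (by omega : 0 < Λ'.card)) hdeg
    obtain ⟨hu1, hu2⟩ := Finset.mem_sdiff.1 hu
    refine ⟨insert u U, ?_, ?_, ?_⟩
    · exact Finset.insert_subset hu1 hUΛ
    · rw [Finset.card_insert_of_notMem hu2, hUk]
    · have hCu : A \ insert u U = C.erase u := by
        ext x; simp only [hC, Finset.mem_sdiff, Finset.mem_insert, Finset.mem_erase]; tauto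
      have hCC : C = {u} ∪ C.erase u := by
        rw [← Finset.insert_eq, Finset.insert_erase (hΛC hu)]
      have hdj' : Disjoint {u} (C.erase u) := by simp
      have e1 : agreement w C c = agreement w {u} c + agreement w (C.erase u) c +
          2 * cross w {u} (C.erase u) c := by
        conv_lhs => rw [hCC]
        exact agreement_union hw c hdj'
      have e2 : cross w X C c = cross w X {u} c + cross w X (C.erase u) c := by
        conv_lhs => rw [hCC]
        exact cross_union_right c hdj'
      have e3 : agreement w {u} c = 0 := by simp [agreement_def, hw0]
      have e4 : cross w {u} (C.erase u) c + cross w X {u} c = deg u := by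
        simp only [deg, cross_def, Finset.sum_singleton]
        congr 1
        rw [← Finset.sum_erase_add _ _ (hΛC hu)]
        simp [hw0]
      rw [hCu]
      push_cast
      linarith

/-- Attaching points of `B` to the classes of `A` hardly improves on the best labeling of `A`. -/
theorem attachment_le (hw : ∀ u v, w u v = w v u) (hw0 : ∀ u, w u u = 0)
    {Y A B X Λ : Finset (Fin n)} {α β s s' : ℝ} (hs : 0 ≤ s) (hS : SmallSetsLight w α s)
    (hE : Exchangeable w A B α β s') (hA : A ⊆ Y) (hB : B ⊆ Y) (hXB : X ⊆ B)
    (hAB : Disjoint B A) {c : Fin n → Fin n}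
    (hΛ : Λ = A.filter fun v => ((Y.filter fun u => c u = c v).card : ℝ) < α)
    (hcard : 2 * X.card ≤ Λ.card) (hconf : Confined X A α β c) {c₀ : Fin n → Fin n}
    (hc₀ : IsOptimal w A c₀) :
    agreement w A c + 2 * cross w X A c ≤ agreement w A c₀ + (7 * s + s') * X.card := by
  classical
  rcases X.eq_empty_or_nonempty with rfl | hX0
  · have := hc₀ c
    simp [cross_def, this]
  have hXA : Disjoint X A := Finset.disjoint_of_subset_left hXB hAB
  obtain ⟨U, hUΛ, hUX, hU⟩ := exists_low_degree_subset hw hw0 hs hS hA (hXB.trans hB) hXA hΛ hcard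
    X.card le_rfl
  have hUA : U ⊆ A := hUΛ.trans (by rw [hΛ]; exact Finset.filter_subset _ _)
  obtain ⟨σ, hσ, h⟩ := hE X U hX0 hXB hUA hUX.symm
  obtain ⟨c', hc', hle⟩ := h c fun x hx => ⟨(hconf x hx).1, lt_of_le_of_lt
    (by exact_mod_cast Finset.card_le_card (Finset.filter_subset_filter _ Finset.sdiff_subset))
    (hconf x hx).2⟩
  obtain ⟨x₀, hx₀⟩ := hX0
  have : Nonempty (Fin n) := ⟨x₀⟩
  let τ := Function.invFunOn σ X
  have hτX : ∀ u ∈ U, τ u ∈ X := fun u hu => Function.invFunOn_mem (hσ.surjOn hu)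
  have hστ : ∀ u ∈ U, σ (τ u) = u := fun u hu => Function.invFunOn_eq (hσ.surjOn hu)
  have hτσ : ∀ x ∈ X, τ (σ x) = x := fun x hx =>
    hσ.injOn.leftInvOn_invFunOn hx
  -- Each point of U inherits the label of the point of X it replaces, which yields a labeling of A
  -- alone, to be compared with the optimum c₀. The loss per point is 6s for the removal, s for
  -- pairs inside U and s' for the exchange.
  let c'' : Fin n → Fin n := fun v => if v ∈ U then c' (τ v) else c' v
  have e1 : agreement w A c'' = agreement w U c'' + agreement w (A \ U) c' +
      2 * cross w U (A \ U) c'' := by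
    conv_lhs => rw [← Finset.union_sdiff_of_subset hUA]
    rw [agreement_union hw c'' Finset.disjoint_sdiff]
    congr 2
    refine agreement_congr fun u hu v hv => ?_
    simp [c'', (Finset.mem_sdiff.1 hu).2, (Finset.mem_sdiff.1 hv).2]
  have e2 : cross w U (A \ U) c'' = ∑ x ∈ X, ∑ v ∈ A \ U,
      if c' x = c' v then w (σ x) v else 0 := by
    rw [cross_def]
    symm
    refine Finset.sum_bij (fun x _ => σ x) (fun x hx => hσ.mapsTo hx)
      (fun x hx y hy hxy => hσ.injOn hx hy hxy)
      (fun u hu => ⟨τ u, hτX u hu, hστ u hu⟩) fun x hx => ?_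
    refine Finset.sum_congr rfl fun v hv => ?_
    have hσx : σ x ∈ U := hσ.mapsTo hx
    simp [c'', hσx, hτσ x hx, (Finset.mem_sdiff.1 hv).2]
  have e3 : |agreement w U c''| ≤ s * U.card := by
    refine abs_agreement_le hS fun u hu => le_trans ?_ (hc' (τ u) (hτX u hu)).1.le
    have : (U.filter fun v => c'' v = c'' u).card ≤ (X.filter fun y => c' y = c' (τ u)).card := by
      refine Finset.card_le_card_of_injOn τ (fun v hv => ?_) fun v hv v' hv' hvv => ?_
      · have hv1 := Finset.mem_filter.1 (Finset.mem_coe.1 hv)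
        refine Finset.mem_coe.2 (Finset.mem_filter.2 ⟨hτX v hv1.1, ?_⟩)
        simpa [c'', hv1.1, hu] using hv1.2
      · rw [← hστ v (Finset.mem_filter.1 (Finset.mem_coe.1 hv)).1, hvv,
          hστ v' (Finset.mem_filter.1 (Finset.mem_coe.1 hv')).1]
    exact_mod_cast this
  have e4 := (abs_le.1 e3).1
  have e5 := hc₀ c''
  rw [hUX] at e4
  rw [e2] at e1
  linarith

end Recovery

end FaultyOracle

namespace FaultyOracle

/-! ### Exact recovery of the large clusters -/

section Recovery

variable {n : ℕ} {w : Fin n → Fin n → ℝ}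

/-- The points of `Y` whose clusters have at least `m` points in `Y`. -/
noncomputable def largePart (t : Fin n → Fin n) (Y : Finset (Fin n)) (m : ℝ) : Finset (Fin n) :=
  open Classical in Y.filter fun v => m ≤ ((Y.filter fun u => t u = t v).card : ℝ)

theorem mem_largePart {t : Fin n → Fin n} {Y : Finset (Fin n)} {m : ℝ} {v : Fin n} :
    v ∈ largePart t Y m ↔ v ∈ Y ∧ m ≤ ((Y.filter fun u => t u = t v).card : ℝ) := by
  simp [largePart]

open Classical in
/-- The reference labeling that is the truth on `B` and separates all the other points. -/
def truthOn (t : Fin n → Fin n) (B : Finset (Fin n)) (v : Fin n) : Lab n :=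
  if v ∈ B then (0, t v) else (2, v)

/-- Few points of classes in which the large clusters are not dominant: the optimal labeling would
be worse than the truth. -/
theorem false_of_few_loose {t : Fin n → Fin n} {Y : Finset (Fin n)}
    {δ L : ℝ} (hδ : 0 < δ) (hL : 0 < L) {c : Fin n → Fin n} (hc : IsOptimal w Y c)
    (hR : ReliableNear t w Y δ (400 * L) (fun v => (0, t v))) {A B X Λ : Finset (Fin n)}
    (hB : B = largePart t Y (1000000 * L)) (hA : A = Y \ B)
    (hX : X = B.filter fun v => ((B.filter fun u => c u = c v).card : ℝ) < 2400 * L)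
    (hΛ : Λ = A.filter fun v => ((Y.filter fun u => c u = c v).card : ℝ) < 2400 * L)
    (hlt : Λ.card < 2 * X.card) : False := by
  classical
  have hBY : B ⊆ Y := by rw [hB]; exact fun v hv => (mem_largePart.1 hv).1
  have hAY : A ⊆ Y := by rw [hA]; exact Finset.sdiff_subset
  have hΛA : Λ ⊆ A := by rw [hΛ]; exact Finset.filter_subset _ _
  have hXB : X ⊆ B := by rw [hX]; exact Finset.filter_subset _ _
  have hBcl : ∀ v ∈ B, ∀ u ∈ Y, t u = t v → u ∈ B := by
    intro v hv u hu huv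
    rw [hB, mem_largePart] at hv ⊢
    rw [huv]
    exact ⟨hu, hv.2⟩
  have hBΛ : ∀ v ∈ B, v ∉ Λ := fun v hv hv' => by
    have := hΛA hv'
    rw [hA] at this
    exact (Finset.mem_sdiff.1 this).2 hv
  have hAt : ∀ v ∈ A, ∀ u ∈ B, t u ≠ t v := by
    intro v hv u hu h
    rw [hA] at hv
    obtain ⟨h1, h2⟩ := Finset.mem_sdiff.1 hv
    exact h2 (hBcl u hu v h1 h.symm)
  set S := Y \ Λ with hS
  have hSY : S ⊆ Y := Finset.sdiff_subset
  obtain ⟨c₁, hc₁, hc₁m, -⟩ := exists_relabel S t c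
  set Z := S.filter fun v => ¬ Matched S t c v with hZ
  -- l₁ is the optimal labeling renamed; l₂ is the truth except on Λ, where it keeps the given
  -- classes. Both coincide with the truth outside Z and Λ.
  let l₁ : Fin n → Lab n := fun v => if v ∈ Y then c₁ v else (0, t v)
  let l₂ : Fin n → Lab n := fun v => if v ∈ Λ then (1, c v) else (0, t v)
  -- misplaced points of large clusters are not matched
  have hlargeS : ∀ v ∈ B, 1000000 * L ≤ ((S.filter fun u => t u = t v).card : ℝ) := by
    intro v hv
    have h1 : (Y.filter fun u => t u = t v) ⊆ S.filter fun u => t u = t v := by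
      intro u hu
      obtain ⟨hu1, hu2⟩ := Finset.mem_filter.1 hu
      exact Finset.mem_filter.2
        ⟨Finset.mem_sdiff.2 ⟨hu1, hBΛ u (hBcl v hv u hu1 hu2)⟩, hu2⟩
    have h2 := hv
    rw [hB, mem_largePart] at h2
    refine h2.2.trans ?_
    exact_mod_cast Finset.card_le_card h1
  have hXZ : X ⊆ Z := by
    intro v hv
    have hvB := hXB hv
    have hv1 : ((B.filter fun u => c u = c v).card : ℝ) < 2400 * L := by
      rw [hX] at hv; exact (Finset.mem_filter.1 hv).2
    refine Finset.mem_filter.2 ⟨Finset.mem_sdiff.2 ⟨hBY hvB, hBΛ v hvB⟩, fun hm => ?_⟩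
    have h1 := hlargeS v hvB
    have h2 : (S.filter fun u => c u = c v ∧ t u = t v).card ≤
        (B.filter fun u => c u = c v).card := by
      refine Finset.card_le_card fun u hu => ?_
      obtain ⟨hu1, hu2, hu3⟩ := Finset.mem_filter.1 hu
      exact Finset.mem_filter.2 ⟨hBcl v hvB u (hSY hu1) hu3, hu2⟩
    have h3 : ((S.filter fun u => t u = t v).card : ℝ) <
        2 * ((B.filter fun u => c u = c v).card : ℝ) := by
      exact_mod_cast lt_of_lt_of_le hm.2 (Nat.mul_le_mul_left 2 h2)
    linarith
  -- every unmatched point contributes many pairs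
  have hcontrib : ∀ v ∈ Z, 1200 * L ≤
      ((Y.filter fun u => ¬ (l₁ v = l₁ u ↔ l₂ v = l₂ u)).card : ℝ) := by
    intro v hv
    obtain ⟨hvS, hvm⟩ := Finset.mem_filter.1 hv
    obtain ⟨hvY, hvΛ⟩ := Finset.mem_sdiff.1 hvS
    have h1 := card_filter_le_of_not_matched hvm
    have h2 : (S.filter fun u => ¬ (c v = c u ↔ t v = t u)).card ≤
        (Y.filter fun u => ¬ (l₁ v = l₁ u ↔ l₂ v = l₂ u)).card := by
      refine Finset.card_le_card fun u hu => ?_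
      obtain ⟨huS, hu⟩ := Finset.mem_filter.1 hu
      obtain ⟨huY, huΛ⟩ := Finset.mem_sdiff.1 huS
      refine Finset.mem_filter.2 ⟨huY, ?_⟩
      simpa [l₁, l₂, hvY, huY, hvΛ, huΛ, hc₁] using hu
    have h3 : ∀ m : ℕ, m ≤ 2 * (S.filter fun u => ¬ (c v = c u ↔ t v = t u)).card →
        2400 * L ≤ m → 1200 * L ≤
        ((Y.filter fun u => ¬ (l₁ v = l₁ u ↔ l₂ v = l₂ u)).card : ℝ) := by
      intro m hm hm'
      have : (m : ℝ) ≤ 2 * ((Y.filter fun u => ¬ (l₁ v = l₁ u ↔ l₂ v = l₂ u)).card : ℝ) := by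
        exact_mod_cast hm.trans (Nat.mul_le_mul_left 2 h2)
      linarith
    by_cases hvB : v ∈ B
    · exact h3 _ h1.2 (le_trans (by linarith) (hlargeS v hvB))
    · have hvA : v ∈ A := by rw [hA]; exact Finset.mem_sdiff.2 ⟨hvY, hvB⟩
      have hbig : 2400 * L ≤ ((Y.filter fun u => c u = c v).card : ℝ) := by
        by_contra h
        push Not at h
        exact hvΛ (by rw [hΛ]; exact Finset.mem_filter.2 ⟨hvA, h⟩)
      have hsub : (Y.filter fun u => c u = c v) ⊆ S.filter fun u => c u = c v := by
        intro u hu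
        obtain ⟨hu1, hu2⟩ := Finset.mem_filter.1 hu
        refine Finset.mem_filter.2 ⟨Finset.mem_sdiff.2 ⟨hu1, fun hu3 => ?_⟩, hu2⟩
        rw [hΛ] at hu3
        have := (Finset.mem_filter.1 hu3).2
        rw [hu2] at this
        linarith
      exact h3 _ h1.1 (hbig.trans (by exact_mod_cast Finset.card_le_card hsub))
  have hN : 1200 * L * Z.card ≤ disagreeSum Y l₁ l₂ (fun _ _ => 1) := by
    rw [disagreeSum_one]
    calc 1200 * L * Z.card = ∑ _v ∈ Z, 1200 * L := by
          rw [Finset.sum_const, nsmul_eq_mul]; ring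
      _ ≤ ∑ v ∈ Z, ((Y.filter fun u => ¬ (l₁ v = l₁ u ↔ l₂ v = l₂ u)).card : ℝ) :=
          Finset.sum_le_sum hcontrib
      _ ≤ _ := Finset.sum_le_sum_of_subset_of_nonneg
          ((Finset.filter_subset _ _).trans hSY) fun _ _ _ => Nat.cast_nonneg _
  have hXZcard := Finset.card_le_card hXZ
  -- Here |Λ| < 2|X| ≤ 2|Z| is used: the 1200L pairs per point of Z are then exactly the required
  -- 400L per moved point.
  have hZΛ : (Z ∪ Λ).card ≤ 3 * Z.card := (Finset.card_union_le _ _).trans (by omega)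
  have hZΛ' : ((Z ∪ Λ).card : ℝ) ≤ 3 * Z.card := by exact_mod_cast hZΛ
  have hrel := hR.le_disagreeSum (by positivity) l₁ l₂ (Z ∪ Λ) (by
      intro v hv
      rw [Finset.mem_union, not_or] at hv
      refine ⟨?_, by simp [l₂, hv.2]⟩
      by_cases hvY : v ∈ Y
      · have hvS : v ∈ S := Finset.mem_sdiff.2 ⟨hvY, hv.2⟩
        have hm : Matched S t c v := by
          by_contra h
          exact hv.1 (Finset.mem_filter.2 ⟨hvS, h⟩)
        simp [l₁, hvY, hc₁m v hvS hm]
      · simp [l₁, hvY]) (by nlinarith)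
  have hdiff : agreement w Y l₂ - agreement w Y l₁ = disagreeSum Y l₁ l₂ (truthWt t w) := by
    -- A class that meets Λ has fewer than 2400L points, so its points in A all lie in Λ. What l₂
    -- cuts off from Λ is therefore in large clusters, and the cut agrees with the truth.
    have hΛc : ∀ u ∈ Y, ∀ v ∈ Y, u ∈ Λ → v ∉ Λ → c u = c v → v ∈ B := by
      intro u hu v hv huΛ hvΛ huv
      by_contra hvB
      refine hvΛ ?_
      rw [hΛ] at huΛ ⊢
      have := (Finset.mem_filter.1 huΛ).2
      rw [huv] at this
      exact Finset.mem_filter.2 ⟨by rw [hA]; exact Finset.mem_sdiff.2 ⟨hv, hvB⟩, this⟩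
    refine agreement_sub_agreement (fun u hu v hv h1 h2 => ?_) fun u hu v hv h1 h2 => ?_
    · simp only [l₁, hu, hv, if_true, hc₁] at h1
      by_cases huΛ : u ∈ Λ <;> by_cases hvΛ : v ∈ Λ
      · simp [l₂, huΛ, hvΛ, h1] at h2
      · exact (hAt u (hΛA huΛ) v (hΛc u hu v hv huΛ hvΛ h1)).symm
      · exact hAt v (hΛA hvΛ) u (hΛc v hv u hu hvΛ huΛ h1.symm)
      · simpa [l₂, huΛ, hvΛ] using h2
    · simp only [l₁, hu, hv, if_true, hc₁, ne_eq] at h1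
      by_cases huΛ : u ∈ Λ <;> by_cases hvΛ : v ∈ Λ
      · simp only [l₂, huΛ, hvΛ, if_true, Prod.mk.injEq, true_and] at h2
        exact absurd h2 h1
      · simp [l₂, huΛ, hvΛ] at h2
      · simp [l₂, huΛ, hvΛ] at h2
      · simpa [l₂, huΛ, hvΛ] using h2
  have hl₁ : agreement w Y l₁ = agreement w Y c := agreement_congr fun u hu v hv => by
    simp [l₁, hu, hv, hc₁]
  have hopt := hc.agreement_le l₂
  have hZpos : (0 : ℝ) < Z.card := by
    have : 0 < Z.card := by omega
    exact_mod_cast this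
  have : 0 < δ / 2 * disagreeSum Y l₁ l₂ (fun _ _ => 1) :=
    mul_pos (by positivity) (lt_of_lt_of_le (by positivity) hN)
  linarith

/-- If there are enough points of small classes, all the points of large clusters are matched and
no other points are attached to them. -/
theorem matched_of_many_loose (hw : ∀ u v, w u v = w v u) (hw0 : ∀ u, w u u = 0)
    {t : Fin n → Fin n} {Y : Finset (Fin n)}
    {δ L D : ℝ} (hδ : 0 < δ) (hL : 0 < L) (hD : D = δ * L) {c : Fin n → Fin n}
    (hc : IsOptimal w Y c) {A B X Λ : Finset (Fin n)}
    (hB : B = largePart t Y (1000000 * L)) (hA : A = Y \ B)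
    (hR : ReliableNear t w Y δ (400 * L) (truthOn t B))
    (hR' : ReliableNear t w Y δ (400 * L) (fun v => (2, v)))
    (hS : SmallSetsLight w (2400 * L) (7200 * D))
    (hE : Exchangeable w A B (2400 * L) (2000000 * L) (52000 * D))
    (hX : X = B.filter fun v => ((B.filter fun u => c u = c v).card : ℝ) < 2400 * L)
    (hΛ : Λ = A.filter fun v => ((Y.filter fun u => c u = c v).card : ℝ) < 2400 * L)
    (hge : 2 * X.card ≤ Λ.card) :
    (∀ v ∈ B, Matched B t c v) ∧ ∀ v ∈ B, ∀ u ∈ A, c u ≠ c v := by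
  classical
  have hBY : B ⊆ Y := by rw [hB]; exact fun v hv => (mem_largePart.1 hv).1
  have hAY : A ⊆ Y := by rw [hA]; exact Finset.sdiff_subset
  have hXB : X ⊆ B := by rw [hX]; exact Finset.filter_subset _ _
  have hBA : Disjoint B A := by rw [hA]; exact Finset.disjoint_sdiff
  have hBAY : B ∪ A = Y := by rw [hA]; exact Finset.union_sdiff_of_subset hBY
  have hD0 : 0 < D := by rw [hD]; positivity
  have hBcl : ∀ v ∈ B, ∀ u ∈ Y, t u = t v → u ∈ B := by
    intro v hv u hu huv
    rw [hB, mem_largePart] at hv ⊢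
    rw [huv]
    exact ⟨hu, hv.2⟩
  have hAt : ∀ v ∈ A, ∀ u ∈ B, t u ≠ t v := fun v hv u hu h =>
    Finset.disjoint_left.1 hBA (hBcl u hu v (hAY hv) h.symm) hv
  have hlarge : ∀ v ∈ B, 1000000 * L ≤ ((B.filter fun u => t u = t v).card : ℝ) := by
    intro v hv
    have h2 := hv
    rw [hB, mem_largePart] at h2
    refine h2.2.trans ?_
    have h1 : (Y.filter fun u => t u = t v) ⊆ B.filter fun u => t u = t v := by
      intro u hu
      obtain ⟨hu1, hu2⟩ := Finset.mem_filter.1 hu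
      exact Finset.mem_filter.2 ⟨hBcl v hv u hu1 hu2, hu2⟩
    exact_mod_cast Finset.card_le_card h1
  have hsmallA : ∀ v ∈ A, ((Y.filter fun u => t u = t v).card : ℝ) < 1000000 * L := by
    intro v hv
    by_contra h
    push Not at h
    have : v ∈ B := by rw [hB]; exact mem_largePart.2 ⟨hAY hv, h⟩
    exact Finset.disjoint_left.1 hBA this hv
  -- the classes of misplaced points are confined
  have hconf : Confined X A (2400 * L) (2000000 * L) c := by
    intro x hx
    have hx1 : ((B.filter fun u => c u = c x).card : ℝ) < 2400 * L := by
      rw [hX] at hx; exact (Finset.mem_filter.1 hx).2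
    refine ⟨lt_of_le_of_lt ?_ hx1, ?_⟩
    · exact_mod_cast Finset.card_le_card (Finset.filter_subset_filter _ hXB)
    · by_contra hcon
      push Not at hcon
      have hP : 2000000 * L ≤ ((Y.filter fun u => c u = c x).card : ℝ) :=
        hcon.trans (by exact_mod_cast Finset.card_le_card (Finset.filter_subset_filter _ hAY))
      -- A class with 2000000L points has a majority cluster. A large cluster would put more than
      -- 2400L points of B into the class of x; a small one has fewer than 1000000L points, too few
      -- for a majority.
      obtain ⟨u, hu, hux, hmaj⟩ := exists_majority hw hw0 hδ hL hR' hc (v := x) (by linarith)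
      have hmaj' : ((Y.filter fun y => c y = c x).card : ℝ) <
          2 * ((((Y.filter fun y => c y = c x).filter fun y => t y = t u).card : ℕ) : ℝ) := by
        exact_mod_cast hmaj
      rw [← hBAY, Finset.mem_union] at hu
      rcases hu with hu | hu
      · have h1 : ((Y.filter fun y => c y = c x).filter fun y => t y = t u) ⊆
            B.filter fun y => c y = c x := by
          intro y hy
          obtain ⟨hy1, hy2⟩ := Finset.mem_filter.1 hy
          obtain ⟨hy3, hy4⟩ := Finset.mem_filter.1 hy1
          exact Finset.mem_filter.2 ⟨hBcl u hu y hy3 hy2, hy4⟩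
        have h2 : ((((Y.filter fun y => c y = c x).filter fun y => t y = t u).card : ℕ) : ℝ) ≤
            ((B.filter fun y => c y = c x).card : ℝ) := by
          exact_mod_cast Finset.card_le_card h1
        linarith
      · have h1 : ((Y.filter fun y => c y = c x).filter fun y => t y = t u) ⊆
            Y.filter fun y => t y = t u :=
          Finset.filter_subset_filter _ (Finset.filter_subset _ _)
        have h2 : ((((Y.filter fun y => c y = c x).filter fun y => t y = t u).card : ℕ) : ℝ) ≤
            ((Y.filter fun y => t y = t u).card : ℝ) := by
          exact_mod_cast Finset.card_le_card h1
        linarith [hsmallA u hu]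
  obtain ⟨c₀, hc₀⟩ := exists_isOptimal w A
  have hatt := attachment_le hw hw0 (by positivity) hS hE hAY hBY hXB hBA hΛ hge hconf hc₀
  -- the comparison on the large clusters
  set E := A.filter fun v => 2400 * L ≤ ((B.filter fun u => c u = c v).card : ℝ) with hE'
  have hEA : E ⊆ A := Finset.filter_subset _ _
  have hBE : Disjoint B E := Finset.disjoint_of_subset_right hEA hBA
  obtain ⟨c₁, hc₁, hc₁m, hc₁2⟩ := exists_relabel B t c
  set Z := B.filter fun v => ¬ Matched B t c v with hZ
  -- The correction takes place on B and the points E of A attached to it substantially; the rest of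
  -- A is isolated so that it does not enter the union bound. l₂ makes B true and cuts it off from E
  -- without touching the classes inside E.
  let l₁ : Fin n → Lab n := fun v => if v ∈ B ∪ E then c₁ v else (2, v)
  let l₂ : Fin n → Lab n := fun v => if v ∈ B then (0, t v) else if v ∈ E then (1, c v) else (2, v)
  have hEB : ∀ v ∈ E, v ∉ B := fun v hv hv' => Finset.disjoint_left.1 hBE hv' hv
  have hXZ : X ⊆ Z := by
    intro v hv
    have hvB := hXB hv
    have hv1 : ((B.filter fun u => c u = c v).card : ℝ) < 2400 * L := by
      rw [hX] at hv; exact (Finset.mem_filter.1 hv).2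
    refine Finset.mem_filter.2 ⟨hvB, fun hm => ?_⟩
    have h1 := hlarge v hvB
    have h2 : (B.filter fun u => c u = c v ∧ t u = t v).card ≤
        (B.filter fun u => c u = c v).card := by
      refine Finset.card_le_card fun u hu => ?_
      obtain ⟨hu1, hu2, hu3⟩ := Finset.mem_filter.1 hu
      exact Finset.mem_filter.2 ⟨hu1, hu2⟩
    have h3 : ((B.filter fun u => t u = t v).card : ℝ) <
        2 * ((B.filter fun u => c u = c v).card : ℝ) := by
      exact_mod_cast lt_of_lt_of_le hm.2 (Nat.mul_le_mul_left 2 h2)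
    linarith
  have hcZ : ∀ v ∈ Z, 500000 * L ≤
      ((Y.filter fun u => ¬ (l₁ v = l₁ u ↔ l₂ v = l₂ u)).card : ℝ) := by
    intro v hv
    obtain ⟨hvB, hvm⟩ := Finset.mem_filter.1 hv
    have h1 := (card_filter_le_of_not_matched hvm).2
    have h2 : (B.filter fun u => ¬ (c v = c u ↔ t v = t u)).card ≤
        (Y.filter fun u => ¬ (l₁ v = l₁ u ↔ l₂ v = l₂ u)).card := by
      refine Finset.card_le_card fun u hu => ?_
      obtain ⟨huB, hu⟩ := Finset.mem_filter.1 hu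
      refine Finset.mem_filter.2 ⟨hBY huB, ?_⟩
      simpa [l₁, l₂, hvB, huB, hc₁] using hu
    have h3 : ((B.filter fun u => t u = t v).card : ℝ) ≤
        2 * ((Y.filter fun u => ¬ (l₁ v = l₁ u ↔ l₂ v = l₂ u)).card : ℝ) := by
      exact_mod_cast h1.trans (Nat.mul_le_mul_left 2 h2)
    linarith [hlarge v hvB]
  have hcE : ∀ v ∈ E, 2400 * L ≤
      ((Y.filter fun u => ¬ (l₁ v = l₁ u ↔ l₂ v = l₂ u)).card : ℝ) := by
    intro v hv
    refine (Finset.mem_filter.1 hv).2.trans ?_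
    have : (B.filter fun u => c u = c v) ⊆
        Y.filter fun u => ¬ (l₁ v = l₁ u ↔ l₂ v = l₂ u) := by
      intro u hu
      obtain ⟨huB, huc⟩ := Finset.mem_filter.1 hu
      refine Finset.mem_filter.2 ⟨hBY huB, ?_⟩
      simp [l₁, l₂, hv, huB, hEB v hv, hc₁, huc]
    exact_mod_cast Finset.card_le_card this
  have hZE : Disjoint Z E := Finset.disjoint_of_subset_left (Finset.filter_subset _ _) hBE
  have hN : 500000 * L * Z.card + 2400 * L * E.card ≤ disagreeSum Y l₁ l₂ (fun _ _ => 1) := by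
    rw [disagreeSum_one]
    calc 500000 * L * Z.card + 2400 * L * E.card =
          ∑ _v ∈ Z, 500000 * L + ∑ _v ∈ E, 2400 * L := by
          rw [Finset.sum_const, Finset.sum_const, nsmul_eq_mul, nsmul_eq_mul]; ring
      _ ≤ ∑ v ∈ Z, ((Y.filter fun u => ¬ (l₁ v = l₁ u ↔ l₂ v = l₂ u)).card : ℝ) +
          ∑ v ∈ E, ((Y.filter fun u => ¬ (l₁ v = l₁ u ↔ l₂ v = l₂ u)).card : ℝ) :=
          add_le_add (Finset.sum_le_sum hcZ) (Finset.sum_le_sum hcE)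
      _ = ∑ v ∈ Z ∪ E, ((Y.filter fun u => ¬ (l₁ v = l₁ u ↔ l₂ v = l₂ u)).card : ℝ) :=
          (Finset.sum_union hZE).symm
      _ ≤ _ := Finset.sum_le_sum_of_subset_of_nonneg (Finset.union_subset
          ((Finset.filter_subset _ _).trans hBY) (hEA.trans hAY)) fun _ _ _ => Nat.cast_nonneg _
  have hZ0 : (0 : ℝ) ≤ Z.card := Nat.cast_nonneg _
  have hE0 : (0 : ℝ) ≤ E.card := Nat.cast_nonneg _
  have hrel := hR.le_disagreeSum (by positivity) l₁ l₂ (Z ∪ E) (by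
      intro v hv
      rw [Finset.mem_union, not_or] at hv
      by_cases hvB : v ∈ B
      · have hm : Matched B t c v := by
          by_contra h
          exact hv.1 (Finset.mem_filter.2 ⟨hvB, h⟩)
        simp [l₁, l₂, truthOn, hvB, hc₁m v hvB hm]
      · simp [l₁, l₂, truthOn, hvB, hv.2]) (by
      rw [Finset.card_union_of_disjoint hZE]
      push_cast
      nlinarith)
  have hdiff : agreement w Y l₂ - agreement w Y l₁ = disagreeSum Y l₁ l₂ (truthWt t w) := by
    refine agreement_sub_agreement (fun u hu v hv h1 h2 => ?_) fun u hu v hv h1 h2 => ?_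
    · by_cases huB : u ∈ B <;> by_cases hvB : v ∈ B
      · simpa [l₂, huB, hvB] using h2
      · exact hAt v (by rw [hA]; exact Finset.mem_sdiff.2 ⟨hv, hvB⟩) u huB
      · exact (hAt u (by rw [hA]; exact Finset.mem_sdiff.2 ⟨hu, huB⟩) v hvB).symm
      · exfalso
        by_cases huE : u ∈ E <;> by_cases hvE : v ∈ E
        · simp only [l₁, Finset.mem_union, huE, hvE, or_true, if_true, hc₁] at h1
          simp [l₂, huB, hvB, huE, hvE, h1] at h2
        · have h3 : c₁ u = (2, v) := by simpa [l₁, huE, hvB, hvE] using h1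
          exact hc₁2 u (by rw [h3])
        · have h3 : (2, u) = c₁ v := by simpa [l₁, hvE, huB, huE] using h1
          exact hc₁2 v (by rw [← h3])
        · have : u = v := by simpa [l₁, huB, hvB, huE, hvE] using h1
          exact h2 (by rw [this])
    · by_cases huB : u ∈ B <;> by_cases hvB : v ∈ B
      · simpa [l₂, huB, hvB] using h2
      · by_cases hvE : v ∈ E <;> simp [l₂, huB, hvB, hvE] at h2
      · by_cases huE : u ∈ E <;> simp [l₂, huB, hvB, huE] at h2
      · exfalso
        by_cases huE : u ∈ E <;> by_cases hvE : v ∈ E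
        · have : c u = c v := by simpa [l₂, huB, hvB, huE, hvE] using h2
          apply h1
          simp only [l₁, Finset.mem_union, huE, hvE, or_true, if_true]
          rwa [hc₁]
        · simp [l₂, huB, hvB, huE, hvE] at h2
        · simp [l₂, huB, hvB, huE, hvE] at h2
        · have : u = v := by simpa [l₂, huB, hvB, huE, hvE] using h2
          exact h1 (by rw [this])
  -- the agreements of the labelings
  have hBEY : B ∪ E ⊆ Y := Finset.union_subset hBY (hEA.trans hAY)
  have hl₁ : agreement w Y l₁ = agreement w (B ∪ E) c := by
    rw [agreement_eq_of_isolated hw hw0 hBEY]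
    · refine agreement_congr fun u hu v hv => ?_
      simp only [l₁, hu, hv, if_true, hc₁]
    · intro u _ hu v _ huv
      by_cases hv : v ∈ B ∪ E
      · simp only [l₁, hu, hv, if_true, if_false] at huv
        exact absurd (by rw [huv]) (hc₁2 v)
      · simpa only [l₁, hu, hv, if_false, Prod.mk.injEq, true_and] using huv
  have hl₂ : agreement w Y l₂ = agreement w B t + agreement w E c := by
    rw [agreement_eq_of_isolated hw hw0 hBEY, agreement_union hw l₂ hBE, cross_eq_zero,
      agreement_congr (c' := t), agreement_congr (Y := E) (c' := c)]
    · ring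
    · intro u hu v hv
      simp [l₂, hu, hv, hEB u hu, hEB v hv]
    · intro u hu v hv
      simp [l₂, hu, hv]
    · intro u hu v hv
      simp [l₂, hu, hv, hEB v hv]
    · intro u _ hu v _ huv
      rw [Finset.mem_union, not_or] at hu
      by_cases hvB : v ∈ B
      · simp [l₂, hu.1, hu.2, hvB] at huv
      · by_cases hvE : v ∈ E
        · simp [l₂, hu.1, hu.2, hvB, hvE] at huv
        · simpa [l₂, hu.1, hu.2, hvB, hvE] using huv
  have hjoin : ∀ x ∈ B, ∀ v ∈ A, v ∉ E → c x = c v → x ∈ X := by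
    intro x hx v hv hvE hxv
    rw [hX]
    refine Finset.mem_filter.2 ⟨hx, ?_⟩
    by_contra h
    push Not at h
    rw [hxv] at h
    exact hvE (Finset.mem_filter.2 ⟨hv, h⟩)
  have hXE : ∀ x ∈ X, ∀ v ∈ E, c x ≠ c v := by
    intro x hx v hv hxv
    have h1 := (Finset.mem_filter.1 hv).2
    rw [hX] at hx
    have h2 := (Finset.mem_filter.1 hx).2
    rw [hxv] at h2
    linarith
  have hcr : cross w B (A \ E) c = cross w X A c := by
    have e1 : cross w B (A \ E) c = cross w X (A \ E) c := by
      conv_lhs => rw [← Finset.union_sdiff_of_subset hXB]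
      rw [cross_union_left c Finset.disjoint_sdiff, cross_eq_zero (X := B \ X), add_zero]
      intro x hx v hv hxv
      obtain ⟨hx1, hx2⟩ := Finset.mem_sdiff.1 hx
      obtain ⟨hv1, hv2⟩ := Finset.mem_sdiff.1 hv
      exact hx2 (hjoin x hx1 v hv1 hv2 hxv)
    have e2 : cross w X A c = cross w X E c + cross w X (A \ E) c := by
      conv_lhs => rw [← Finset.union_sdiff_of_subset hEA]
      exact cross_union_right c Finset.disjoint_sdiff
    rw [e1, e2, cross_eq_zero hXE, zero_add]
  -- Outside E, only points of X are joined to A, and points of X are not joined to E. The whole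
  -- interaction of B with A therefore splits into a part inside B ∪ E and the attachment of X.
  have hY : agreement w Y c = agreement w (B ∪ E) c - agreement w E c + agreement w A c +
      2 * cross w X A c := by
    have e1 : cross w B A c = cross w B E c + cross w B (A \ E) c := by
      conv_lhs => rw [← Finset.union_sdiff_of_subset hEA]
      exact cross_union_right c Finset.disjoint_sdiff
    rw [← hBAY, agreement_union hw c hBA, agreement_union hw c hBE, e1, hcr]
    ring
  have hglue := hc.agreement_le fun v => if v ∈ B then Sum.inl (t v) else Sum.inr (c₀ v)
  rw [← hBAY, agreement_glue hw t c₀ hBA, hBAY] at hglue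
  have hXZ' : (X.card : ℝ) ≤ Z.card := by exact_mod_cast Finset.card_le_card hXZ
  have hgain : disagreeSum Y l₁ l₂ (truthWt t w) ≤ 102400 * D * Z.card := by
    have h1 : (7 * (7200 * D) + 52000 * D) * X.card ≤ 102400 * D * Z.card :=
      mul_le_mul (by linarith) hXZ' (Nat.cast_nonneg _) (by positivity)
    linarith
  -- The correction gains at least 250000 D|Z|, while optimality of c and the attachment bound allow
  -- at most (7 · 7200 + 52000) D|X| ≤ 102400 D|Z|. So nothing can be misplaced or attached.
  have hlow : δ / 2 * (500000 * L * Z.card + 2400 * L * E.card) ≤ 102400 * D * Z.card :=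
    (mul_le_mul_of_nonneg_left hN (by positivity)).trans (hrel.trans hgain)
  have hlow' : D * (147600 * Z.card + 1200 * E.card) ≤ 0 := by
    have : δ / 2 * (500000 * L * Z.card + 2400 * L * E.card) =
        D * (250000 * Z.card + 1200 * E.card) := by rw [hD]; ring
    linarith
  have hsum := nonpos_of_mul_nonpos_right hlow' hD0
  have hZe : Z = ∅ := by
    have : (Z.card : ℝ) = 0 := by linarith
    exact Finset.card_eq_zero.1 (by exact_mod_cast this)
  have hEe : E = ∅ := by
    have : (E.card : ℝ) = 0 := by linarith
    exact Finset.card_eq_zero.1 (by exact_mod_cast this)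
  refine ⟨fun v hv => ?_, fun v hv u hu huv => ?_⟩
  · by_contra h
    have : v ∈ Z := Finset.mem_filter.2 ⟨hv, h⟩
    simp [hZe] at this
  · have := hXZ (hjoin v hv u hu (by simp [hEe]) huv.symm)
    simp [hZe] at this

/-- Large clusters are recovered exactly, and the other classes are not too large. -/
theorem IsOptimal.recovery (hw : ∀ u v, w u v = w v u) (hw0 : ∀ u, w u u = 0)
    {t : Fin n → Fin n} {Y : Finset (Fin n)}
    {δ L D : ℝ} (hδ : 0 < δ) (hL : 0 < L) (hD : D = δ * L) {c : Fin n → Fin n}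
    (hc : IsOptimal w Y c)
    (hR₀ : ReliableNear t w Y δ (400 * L) (fun v => (0, t v)))
    (hR : ReliableNear t w Y δ (400 * L) (truthOn t (largePart t Y (1000000 * L))))
    (hR' : ReliableNear t w Y δ (400 * L) (fun v => (2, v)))
    (hS : SmallSetsLight w (2400 * L) (7200 * D))
    (hE : Exchangeable w (Y \ largePart t Y (1000000 * L)) (largePart t Y (1000000 * L))
      (2400 * L) (2000000 * L) (52000 * D)) :
    (∀ v ∈ largePart t Y (1000000 * L), ∀ u ∈ Y, (c u = c v ↔ t u = t v)) ∧
    ∀ v ∈ Y, v ∉ largePart t Y (1000000 * L) →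
      ((Y.filter fun u => c u = c v).card : ℝ) < 2000000 * L := by
  classical
  set B := largePart t Y (1000000 * L) with hB
  have hBcl : ∀ v ∈ B, ∀ u ∈ Y, t u = t v → u ∈ B := by
    intro v hv u hu huv
    rw [hB, mem_largePart] at hv ⊢
    rw [huv]
    exact ⟨hu, hv.2⟩
  have hm : (∀ v ∈ B, Matched B t c v) ∧ ∀ v ∈ B, ∀ u ∈ Y \ B, c u ≠ c v := by
    -- The dichotomy is whether A offers enough points in small classes for the exchange.
    rcases lt_or_ge ((Y \ B).filter fun v =>
        ((Y.filter fun u => c u = c v).card : ℝ) < 2400 * L).card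
      (2 * (B.filter fun v => ((B.filter fun u => c u = c v).card : ℝ) < 2400 * L).card)
      with h | h
    · exact (false_of_few_loose hδ hL hc hR₀ hB rfl rfl rfl h).elim
    · exact matched_of_many_loose hw hw0 hδ hL hD hc hB rfl hR hR' hS hE rfl rfl h
  have h1 : ∀ v ∈ B, ∀ u ∈ Y, (c u = c v ↔ t u = t v) := by
    intro v hv u hu
    by_cases huB : u ∈ B
    · exact ⟨(hm.1 u huB).congr_left (hm.1 v hv), (hm.1 u huB).congr_right (hm.1 v hv)⟩
    · exact ⟨fun h => absurd h (hm.2 v hv u (Finset.mem_sdiff.2 ⟨hu, huB⟩)),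
        fun h => absurd (hBcl v hv u hu h) huB⟩
  refine ⟨h1, fun v hv hvB => ?_⟩
  by_contra hcon
  push Not at hcon
  obtain ⟨u, hu, huv, hmaj⟩ := exists_majority hw hw0 hδ hL hR' hc (v := v) (by linarith)
  -- The majority cluster of an oversized class is small, since large clusters are already known to
  -- be classes of their own; but a small cluster cannot be a majority of 2000000L points.
  have huB : u ∉ B := fun h => hvB (hBcl u h v hv ((h1 u h v hv).1 huv.symm))
  have h2 : ((Y.filter fun x => t x = t u).card : ℝ) < 1000000 * L := by
    by_contra h
    push Not at h
    exact huB (mem_largePart.2 ⟨hu, h⟩)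
  have h3 : ((Y.filter fun x => c x = c v).card : ℝ) <
      2 * ((Y.filter fun x => t x = t u).card : ℝ) := by
    have h4 : ((Y.filter fun x => c x = c v).filter fun x => t x = t u).card ≤
        (Y.filter fun x => t x = t u).card :=
      Finset.card_le_card (Finset.filter_subset_filter _ (Finset.filter_subset _ _))
    exact_mod_cast lt_of_lt_of_le hmaj (Nat.mul_le_mul_left 2 h4)
  linarith

end Recovery

end FaultyOracle

namespace FaultyOracle

/-! ### Probability of recovery on a fixed set -/

section Probability

variable {n : ℕ}

/-- Every optimal labeling of `Y` recovers the clusters with at least `K` points in `Y`, and its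
other classes have less than `2 * K` points. -/
def Recovers (w : Fin n → Fin n → ℝ) (t : Fin n → Fin n) (K : ℝ) (Y : Finset (Fin n)) : Prop :=
  ∀ c, IsOptimal w Y c → (∀ v ∈ largePart t Y K, ∀ u ∈ Y, (c u = c v ↔ t u = t v)) ∧
    ∀ v ∈ Y, v ∉ largePart t Y K → ((Y.filter fun u => c u = c v).card : ℝ) < 2 * K

/-- Recovery is deterministic given five events, each of which fails with probability at most 8/n⁴:
reliability near three references, lightness of small sets and exchangeability. -/
theorem prob_not_recovers {p : ℝ} (hp0 : 0 ≤ p) (hp : p < 1 / 2) (hn : 2 ≤ n)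
    (t : Fin n → Fin n) (Y : Finset (Fin n)) :
    prob (answerLaw p t) (fun a => ¬ Recovers (wt a) t
      (1000000 * (Real.log n / (1 - 2 * p) ^ 2)) Y) ≤ 40 / (n : ℝ) ^ 4 := by
  have hδ : 0 < 1 - 2 * p := by linarith
  have hq := isBitLaw_answerLaw hp0 hp t
  have hlog : 0 < Real.log n := Real.log_pos (by exact_mod_cast (by omega : 1 < n))
  have hL : 0 < Real.log n / (1 - 2 * p) ^ 2 := by positivity
  set L := Real.log n / (1 - 2 * p) ^ 2 with hLdef
  set B := largePart t Y (1000000 * L) with hB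
  have hAB : ∀ x ∈ B, ∀ v ∈ Y \ B, t x ≠ t v := by
    intro x hx v hv h
    obtain ⟨h1, h2⟩ := Finset.mem_sdiff.1 hv
    refine h2 ?_
    rw [hB, mem_largePart] at hx ⊢
    rw [← h]
    exact ⟨h1, hx.2⟩
  have e1 := prob_not_reliableNear hp0 hp hn t Y fun v => (0, t v)
  have e2 := prob_not_reliableNear hp0 hp hn t Y (truthOn t B)
  have e3 := prob_not_reliableNear hp0 hp hn t Y fun v => (2, v)
  have e4 := prob_not_smallSetsLight hp0 hp hn t
  have e5 := prob_not_exchangeable hp0 hp hn t (Y \ B) B hAB (2400 * L)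
  have hmono := prob_mono hq (P := fun a => ¬ Recovers (wt a) t (1000000 * L) Y)
    (Q := fun a => ¬ ReliableNear t (wt a) Y (1 - 2 * p) (400 * L) (fun v => (0, t v)) ∨
      ¬ ReliableNear t (wt a) Y (1 - 2 * p) (400 * L) (truthOn t B) ∨
      ¬ ReliableNear t (wt a) Y (1 - 2 * p) (400 * L) (fun v => (2, v)) ∨
      ¬ SmallSetsLight (wt a) (2400 * L) (7200 * (Real.log n / (1 - 2 * p))) ∨
      ¬ Exchangeable (wt a) (Y \ B) B (2400 * L) (2000000 * L)
        (52000 * (Real.log n / (1 - 2 * p)))) (by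
      intro a h
      by_contra hcon
      push Not at hcon
      obtain ⟨h1, h2, h3, h4, h5⟩ := hcon
      refine h fun c hc => ?_
      have := hc.recovery (wt_comm a) (wt_self a) hδ hL
        (D := Real.log n / (1 - 2 * p)) (by rw [hLdef]; field_simp) h1 h2 h3 h4 h5
      exact ⟨this.1, fun v hv hvB => (this.2 v hv hvB).trans_le (by linarith)⟩)
  have f1 := (hmono.trans (prob_or_le hq _ _)).trans (add_le_add le_rfl
    ((prob_or_le hq _ _).trans (add_le_add le_rfl ((prob_or_le hq _ _).trans
      (add_le_add le_rfl (prob_or_le hq _ _))))))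
  refine f1.trans ((add_le_add e1 (add_le_add e2 (add_le_add e3 (add_le_add e4 e5)))).trans ?_)
  apply le_of_eq
  ring

end Probability

/-! ### Partitions as labelings, and likelihood as agreement -/

section Clusterings

variable {n : ℕ}

/-- The clusters of `T` are the classes of the labeling `t`. -/
def IsLabeling (T : Clustering n) (t : Fin n → Fin n) : Prop :=
  ∀ S, S ∈ T.parts ↔ ∃ v, S = Finset.univ.filter fun u => t u = t v

theorem isLabeling_of_part {T : Clustering n} {t : Fin n → Fin n}
    (h : ∀ v, (Finset.univ.filter fun u => t u = t v) = T.part v) : IsLabeling T t := by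
  refine fun S => ⟨fun hS => ?_, ?_⟩
  · obtain ⟨v, hv⟩ := T.nonempty_of_mem_parts hS
    exact ⟨v, by rw [h, T.part_eq_of_mem hS hv]⟩
  · rintro ⟨v, rfl⟩
    rw [h]
    exact T.part_mem.2 (Finset.mem_univ v)

theorem exists_isLabeling (T : Clustering n) : ∃ t, IsLabeling T t := by
  classical
  obtain ⟨t, ht, -⟩ := exists_same_classes T.part
  refine ⟨t, isLabeling_of_part fun v => ?_⟩
  ext u
  simp only [Finset.mem_filter, Finset.mem_univ, true_and, ht]
  constructor
  · intro h; rw [← h]; exact T.mem_part (Finset.mem_univ u)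
  · exact T.part_eq_of_mem (T.part_mem.2 (Finset.mem_univ v))

open Classical in
/-- The clustering whose clusters are the classes of a labeling. -/
noncomputable def clusteringOf (c : Fin n → Fin n) : Clustering n :=
  Finpartition.ofSetoid (Setoid.ker c)

theorem isLabeling_clusteringOf (c : Fin n → Fin n) : IsLabeling (clusteringOf c) c := by
  classical
  refine isLabeling_of_part fun v => ?_
  ext u
  rw [clusteringOf, Finpartition.mem_part_ofSetoid_iff_rel, Finset.mem_filter]
  simp [eq_comm]

theorem IsLabeling.sameCluster_iff {T : Clustering n} {t : Fin n → Fin n} (h : IsLabeling T t)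
    (e : Pair n) : SameCluster T e ↔ Joined t e := by
  obtain ⟨e, he⟩ := e
  induction e using Sym2.inductionOn with
  | hf u v =>
    rw [joined_mk]
    unfold SameCluster
    constructor
    · rintro ⟨S, hS, hm⟩
      obtain ⟨x, rfl⟩ := (h S).1 hS
      have h1 := (Finset.mem_filter.1 (hm u (by simp))).2
      have h2 := (Finset.mem_filter.1 (hm v (by simp))).2
      rw [h1, h2]
    · intro huv
      refine ⟨_, (h _).2 ⟨u, rfl⟩, fun x hx => ?_⟩
      simp only [Sym2.mem_iff] at hx
      rcases hx with rfl | rfl <;> simp [huv]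

theorem IsLabeling.card_parts {T : Clustering n} {t : Fin n → Fin n} (h : IsLabeling T t) :
    T.parts.card = (Finset.univ.image t).card := by
  classical
  have : T.parts = (Finset.univ.image t).image fun i => Finset.univ.filter fun u => t u = i := by
    ext S
    rw [h S]
    simp [eq_comm]
  rw [this, Finset.card_image_of_injOn]
  intro i hi j hj hij
  obtain ⟨v, -, rfl⟩ := Finset.mem_image.1 (Finset.mem_coe.1 hi)
  have : v ∈ Finset.univ.filter fun u => t u = t v := by simp
  simp only at hij
  rw [hij] at this
  exact (Finset.mem_filter.1 this).2

theorem IsLabeling.answerProb_eq {T : Clustering n} {t : Fin n → Fin n} (h : IsLabeling T t)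
    (p : ℝ) : answerProb p T = answerLaw p t := by
  funext e b
  unfold answerProb answerLaw
  rw [h.sameCluster_iff]

theorem IsLabeling.real_oracleLaw {p : ℝ} (hp0 : 0 ≤ p) (hp : p < 1 / 2) {T : Clustering n}
    {t : Fin n → Fin n} (h : IsLabeling T t) (P : Answers n → Prop) :
    (oracleLaw p T).real {a | P a} = prob (answerLaw p t) P := by
  classical
  have hq := isBitLaw_answerLaw hp0 hp t
  have hfin : ∀ e : Pair n, IsFiniteMeasure
      (∑ b : Bool, ENNReal.ofReal (answerProb p T e b) • Measure.dirac b) := fun e => by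
    constructor
    simp
  have hsing : ∀ a : Answers n, (oracleLaw p T).real {a} = ∏ e, answerLaw p t e (a e) := by
    intro a
    unfold oracleLaw
    rw [measureReal_def, Measure.pi_singleton, ENNReal.toReal_prod]
    refine Finset.prod_congr rfl fun e _ => ?_
    rw [h.answerProb_eq]
    cases a e <;> simp [hq.nonneg]
  have hfin' : IsFiniteMeasure (oracleLaw p T) := by unfold oracleLaw; infer_instance
  have hset : {a | P a} = ((Finset.univ.filter P : Finset (Answers n)) : Set (Answers n)) := by
    ext a; simp
  rw [hset, ← sum_measureReal_singleton, Finset.sum_filter]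
  unfold prob expect
  refine Finset.sum_congr rfl fun a _ => ?_
  rw [hsing]
  by_cases hPa : P a <;> simp [hPa]

/-- The number of answers that are correct if the clusters are the classes of `c`. -/
noncomputable def numCorrect (a : Answers n) (c : Fin n → Fin n) : ℕ :=
  open Classical in (Finset.univ.filter fun e => (a e = true ↔ Joined c e)).card

/-- For a pair with sign s, twice the indicator of a correct answer is 2s + (1 - s) if the pair is
joined and 1 - s if not. Up to a constant independent of the labeling, agreement thus counts correct
answers. -/
theorem two_mul_numCorrect (a : Answers n) (c : Fin n → Fin n) :
    2 * (numCorrect a c : ℝ) = agreement (wt a) Finset.univ c + ∑ e, (1 - sg (a e)) := by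
  classical
  have h1 : agreement (wt a) Finset.univ c =
      2 * ∑ e : Pair n, (if Joined c e then 1 else 0) * sg (a e) := by
    have hsym : ∀ u v, (if c u = c v then (1 : ℝ) else 0) = if c v = c u then 1 else 0 := by
      intro u v; simp only [eq_comm]
    have h := sum_mul_ord hsym fun e => sg (a e)
    rw [agreement_def]
    refine Eq.trans ?_ (h.trans ?_)
    · refine Finset.sum_congr rfl fun u _ => Finset.sum_congr rfl fun v _ => ?_
      unfold wt
      split_ifs <;> simp
    · congr 1
      refine Finset.sum_congr rfl fun e _ => ?_
      obtain ⟨e, he⟩ := e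
      induction e using Sym2.inductionOn with
      | hf u v => simp [joined_mk]
  rw [h1, numCorrect, Finset.card_filter, Nat.cast_sum, Finset.mul_sum, Finset.mul_sum,
    ← Finset.sum_add_distrib]
  refine Finset.sum_congr rfl fun e _ => ?_
  by_cases hJ : Joined c e <;> cases a e <;> simp [hJ, sg] <;> norm_num

theorem IsLabeling.likelihood_eq {T : Clustering n} {t : Fin n → Fin n} (h : IsLabeling T t)
    (p : ℝ) (a : Answers n) : likelihood p a T =
      (1 - p) ^ numCorrect a t * p ^ (Fintype.card (Pair n) - numCorrect a t) := by
  classical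
  unfold likelihood
  rw [h.answerProb_eq]
  unfold answerLaw
  rw [Finset.prod_ite, Finset.prod_const, Finset.prod_const]
  congr 2
  have := Finset.card_filter_add_card_filter_not (s := Finset.univ)
    (fun e => (a e = true ↔ Joined t e))
  rw [Finset.card_univ] at this
  unfold numCorrect
  rw [← this]
  have e : ∀ x y : ℕ, y = x + y - x := by omega
  convert e _ _

/-- The likelihood is (1 - p)^x p^(N - x) with x correct answers among N, and it does not decrease
in x because p ≤ 1 - p; this includes p = 0. -/
theorem IsOptimal.isMLEstimate {p : ℝ} (hp0 : 0 ≤ p) (hp : p < 1 / 2) {a : Answers n}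
    {c : Fin n → Fin n} (hc : IsOptimal (wt a) Finset.univ c) :
    IsMLEstimate p a (clusteringOf c) := by
  intro T'
  obtain ⟨t, ht⟩ := exists_isLabeling T'
  rw [ht.likelihood_eq, (isLabeling_clusteringOf c).likelihood_eq]
  have h1 := two_mul_numCorrect a t
  have h2 := two_mul_numCorrect a c
  have h3 := hc t
  have hle : numCorrect a t ≤ numCorrect a c := by
    have : (numCorrect a t : ℝ) ≤ numCorrect a c := by linarith
    exact_mod_cast this
  have hN : numCorrect a c ≤ Fintype.card (Pair n) := Finset.card_le_univ _
  obtain ⟨d, hd⟩ := Nat.exists_eq_add_of_le hle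
  have e1 : Fintype.card (Pair n) - numCorrect a t =
      d + (Fintype.card (Pair n) - numCorrect a c) := by omega
  rw [e1, hd, pow_add, pow_add, ← hd, mul_assoc]
  have h5 : p ^ d ≤ (1 - p) ^ d := pow_le_pow_left₀ hp0 (by linarith) d
  have h6 : 0 ≤ (1 - p) ^ numCorrect a t := pow_nonneg (by linarith) _
  have h7 : 0 ≤ p ^ (Fintype.card (Pair n) - numCorrect a c) := pow_nonneg hp0 _
  exact mul_le_mul_of_nonneg_left (mul_le_mul_of_nonneg_right h5 h7) h6

end Clusterings

/-! ### Comparison with the lower-bound expression -/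

section Divergence

/-- The divergence equals (1 - 2p) log((1 - p)/p), and log x ≤ x - 1 bounds it by (1 - 2p)²/p ≤ (1 -
2p)²/p₀. -/
theorem le_div_jsBernoulli {p₀ : ℝ} (hp₀ : 0 < p₀) (n k : ℕ) {p : ℝ} (h : p₀ ≤ p)
    (hp : p < 1 / 2) :
    (n : ℝ) * k * Real.log n / (1 - 2 * p) ^ 2 ≤
      1 / p₀ * Real.log n * (n * k / jsBernoulli p (1 - p)) := by
  have hp0 : 0 < p := by linarith
  have hδ : 0 < 1 - 2 * p := by linarith
  have hq : 0 < 1 - p := by linarith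
  have hlog : Real.log (p / (1 - p)) = -Real.log ((1 - p) / p) := by
    rw [← Real.log_inv, inv_div]
  have hjs : jsBernoulli p (1 - p) = (1 - 2 * p) * Real.log ((1 - p) / p) := by
    unfold jsBernoulli klBernoulli
    rw [sub_sub_cancel, hlog]
    ring
  have hlt : 1 < (1 - p) / p := by rw [lt_div_iff₀ hp0]; linarith
  have hpos : 0 < Real.log ((1 - p) / p) := Real.log_pos hlt
  have hle : Real.log ((1 - p) / p) ≤ (1 - 2 * p) / p₀ := by
    refine (Real.log_le_sub_one_of_pos (by positivity)).trans ?_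
    rw [show (1 - p) / p - 1 = (1 - 2 * p) / p by field_simp; ring]
    exact div_le_div_of_nonneg_left hδ.le hp₀ h
  have hln : 0 ≤ Real.log n := Real.log_natCast_nonneg n
  rw [hjs]
  have hinv : 1 / (1 - 2 * p) ^ 2 ≤ 1 / p₀ * (1 / ((1 - 2 * p) * Real.log ((1 - p) / p))) := by
    rw [← one_div_mul_one_div_rev, ← mul_assoc] at *
    rw [le_div_iff₀ hp₀] at hle
    rw [one_div_mul_one_div, one_div_mul_one_div, one_div_le_one_div (by positivity)
      (by positivity)]
    nlinarith
  have := mul_le_mul_of_nonneg_left hinv (by positivity : 0 ≤ (n : ℝ) * k * Real.log n)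
  calc (n : ℝ) * k * Real.log n / (1 - 2 * p) ^ 2 = n * k * Real.log n * (1 / (1 - 2 * p) ^ 2) := by
        ring
    _ ≤ _ := this
    _ = _ := by ring

end Divergence

end FaultyOracle

namespace FaultyOracle

/-! ### The adaptive algorithm and its invariants -/

section Algorithm

variable {n : ℕ}

namespace QueryAlgorithm

/-- Make the listed queries, record the answers in `k`, and go on with the record. -/
def ask : List (Pair n) → Answers n → (Answers n → QueryAlgorithm n) → QueryAlgorithm n
  | [], k, f => f k
  | e :: l, k, f => query e fun b => ask l (open Classical in Function.update k e b) f

theorem ask_spec (a : Answers n) (f : Answers n → QueryAlgorithm n) (l : List (Pair n))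
    (k : Answers n) : ∃ k' : Answers n, (∀ e ∈ l, k' e = a e) ∧ (∀ e, e ∉ l → k' e = k e) ∧
      output a (ask l k f) = output a (f k') ∧
      numQueries a (ask l k f) = numQueries a (f k') + l.length := by
  classical
  induction l generalizing k with
  | nil => exact ⟨k, by simp, by simp, rfl, rfl⟩
  | cons e l ih =>
    obtain ⟨k', h1, h2, h3, h4⟩ := ih (Function.update k e (a e))
    refine ⟨k', fun x hx => ?_, fun x hx => ?_, ?_, ?_⟩
    · by_cases hxl : x ∈ l
      · exact h1 x hxl
      · rcases List.mem_cons.1 hx with rfl | hx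
        · rw [h2 x hxl, Function.update_self]
        · exact absurd hx hxl
    · rw [List.mem_cons, not_or] at hx
      rw [h2 x hx.2, Function.update_of_ne hx.1]
    · simp only [ask, output]
      convert h3
    · simp only [ask, numQueries, List.length_cons]
      rw [← add_assoc, ← h4]

end QueryAlgorithm

open QueryAlgorithm

/-- A labeling with the largest agreement on `Y`. -/
noncomputable def optLabeling (w : Fin n → Fin n → ℝ) (Y : Finset (Fin n)) : Fin n → Fin n :=
  Classical.choose (exists_isOptimal w Y)

theorem isOptimal_optLabeling (w : Fin n → Fin n → ℝ) (Y : Finset (Fin n)) :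
    IsOptimal w Y (optLabeling w Y) := Classical.choose_spec (exists_isOptimal w Y)

theorem IsOptimal.congr_weight {w w' : Fin n → Fin n → ℝ} {Y : Finset (Fin n)}
    {c : Fin n → Fin n} (hc : IsOptimal w Y c) (h : ∀ u ∈ Y, ∀ v ∈ Y, w u v = w' u v) :
    IsOptimal w' Y c := by
  have e : ∀ d : Fin n → Fin n, agreement w' Y d = agreement w Y d := by
    intro d
    simp only [agreement_def]
    refine Finset.sum_congr rfl fun u hu => Finset.sum_congr rfl fun v hv => ?_
    rw [h u hu v hv]
  intro d
  rw [e, e]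
  exact hc d

open Classical in
/-- The pairs that consist of `v` and a point of `A`. -/
noncomputable def pairsWith (v : Fin n) (A : Finset (Fin n)) : Finset (Pair n) :=
  Finset.univ.filter fun e => ∃ u ∈ A, e.1 = s(v, u)

theorem card_pairsWith_le (v : Fin n) (A : Finset (Fin n)) : (pairsWith v A).card ≤ A.card := by
  classical
  rw [← Finset.card_image_of_injective (pairsWith v A) Subtype.val_injective]
  refine (Finset.card_le_card (t := A.image fun u => s(v, u)) fun x hx => ?_).trans
    Finset.card_image_le
  obtain ⟨e, he, rfl⟩ := Finset.mem_image.1 hx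
  obtain ⟨u, hu, h⟩ := (Finset.mem_filter.1 he).2
  exact Finset.mem_image.2 ⟨u, hu, h.symm⟩

/-- The record of answers is a total function with arbitrary values at pairs not yet asked. The
invariant is that it is correct on all pairs of active points, and asking v against all of them
extends this to v. -/
theorem wt_eq_of_pairsWith {a k k' : Answers n} {v : Fin n} {A : Finset (Fin n)}
    (hk : ∀ x ∈ A, ∀ y ∈ A, wt k x y = wt a x y) (h1 : ∀ e ∈ pairsWith v A, k' e = a e)
    (h2 : ∀ e, e ∉ pairsWith v A → k' e = k e) :
    ∀ x ∈ insert v A, ∀ y ∈ insert v A, wt k' x y = wt a x y := by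
  have key : ∀ x ∈ insert v A, ∀ y ∈ A, wt k' x y = wt a x y := by
    intro x hx y hy
    by_cases hxy : x = y
    · simp [wt, ord, hxy]
    by_cases hm : (⟨s(x, y), by simpa using hxy⟩ : Pair n) ∈ pairsWith v A
    · simp [wt, ord, hxy, h1 _ hm]
    · rcases Finset.mem_insert.1 hx with rfl | hx
      · exact absurd (Finset.mem_filter.2 ⟨Finset.mem_univ _, y, hy, rfl⟩) hm
      · have := hk x hx y hy
        simp only [wt, ord, hxy, dif_neg, not_false_eq_true] at this ⊢
        rw [h2 _ hm]
        exact this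
  intro x hx y hy
  rcases Finset.mem_insert.1 hy with rfl | hy'
  · rcases Finset.mem_insert.1 hx with rfl | hx'
    · simp [wt_self]
    · rw [wt_comm k', wt_comm a]
      exact key y hy x hx'
  · exact key x hx y hy'

open Classical in
/-- A point of `A` in the class of `v`, or `v` itself. -/
noncomputable def partner (c : Fin n → Fin n) (A : Finset (Fin n)) (v : Fin n) : Fin n :=
  if h : ∃ u ∈ A, c u = c v then Classical.choose h else v

theorem partner_spec {c : Fin n → Fin n} {A : Finset (Fin n)} {v : Fin n}
    (h : ∃ u ∈ A, c u = c v) : partner c A v ∈ A ∧ c (partner c A v) = c v := by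
  rw [partner, dif_pos h]
  exact Classical.choose_spec h

open Classical in
/-- The clustering algorithm: the points are compared with the active points `A` one after another;
a point becomes active unless it joins `m` active points in an optimal labeling, and then one of
these represents it. -/
noncomputable def run (m : ℝ) : List (Fin n) → Finset (Fin n) → (Fin n → Fin n) → Answers n →
    QueryAlgorithm n
  | [], A, rep, k => finish (clusteringOf fun v => optLabeling (wt k) A (rep v))
  | v :: vs, A, rep, k => ask (pairsWith v A).toList k fun k' =>
      if m ≤ ((A.filter fun u =>
          optLabeling (wt k') (insert v A) u = optLabeling (wt k') (insert v A) v).card : ℝ) then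
        run m vs A (Function.update rep v (partner (optLabeling (wt k') (insert v A)) A v)) k'
      else run m vs (insert v A) rep k'

open Classical in
/-- The next set of active points if the optimal labelings find the true clusters. -/
noncomputable def nextActive (m : ℝ) (t : Fin n → Fin n) (A : Finset (Fin n)) (v : Fin n) :
    Finset (Fin n) :=
  if m ≤ ((A.filter fun u => t u = t v).card : ℝ) then A else insert v A

/-- The sets whose optimal labelings the algorithm uses if these find the true clusters. -/
noncomputable def usedSets (m : ℝ) (t : Fin n → Fin n) :
    List (Fin n) → Finset (Fin n) → Finset (Finset (Fin n))
  | [], A => {A}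
  | v :: vs, A => insert (insert v A) (usedSets m t vs (nextActive m t A v))

theorem card_usedSets_le (m : ℝ) (t : Fin n → Fin n) (vs : List (Fin n)) (A : Finset (Fin n)) :
    (usedSets m t vs A).card ≤ vs.length + 1 := by
  induction vs generalizing A with
  | nil => simp [usedSets]
  | cons v vs ih =>
    refine (Finset.card_insert_le _ _).trans ?_
    simp only [List.length_cons]
    have := ih (nextActive m t A v)
    omega

/-- The active points and the representatives after all points but those of `vs`. -/
structure IsState (t : Fin n → Fin n) (K : ℝ) (vs : List (Fin n)) (A : Finset (Fin n))
    (rep : Fin n → Fin n) : Prop where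
  rep_mem : ∀ v, v ∉ vs → rep v ∈ A
  label_rep : ∀ v, t (rep v) = t v
  rep_active : ∀ v ∈ A, rep v = v
  rep_todo : ∀ v ∈ vs, rep v = v
  todo_notMem : ∀ v ∈ vs, v ∉ A
  large : ∀ v, v ∉ vs → v ∉ A → 2 * K ≤ ((A.filter fun u => t u = t v).card : ℝ)
  card_le : ∀ v, ((A.filter fun u => t u = t v).card : ℝ) ≤ 2 * K + 1

theorem IsState.skip {t : Fin n → Fin n} {K : ℝ} {v : Fin n} {vs : List (Fin n)}
    {A : Finset (Fin n)} {rep : Fin n → Fin n} (h : IsState t K (v :: vs) A rep)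
    (hv : v ∉ vs) {x : Fin n} (hx : x ∈ A) (hxv : t x = t v)
    (hK : 2 * K ≤ ((A.filter fun u => t u = t v).card : ℝ)) :
    IsState t K vs A (Function.update rep v x) := by
  have hvA : v ∉ A := h.todo_notMem v (by simp)
  refine ⟨fun u hu => ?_, fun u => ?_, fun u hu => ?_, fun u hu => ?_, fun u hu => ?_,
    fun u hu huA => ?_, h.card_le⟩
  · by_cases huv : u = v
    · rw [huv, Function.update_self]; exact hx
    · rw [Function.update_of_ne huv]; exact h.rep_mem u (by simp [huv, hu])
  · by_cases huv : u = v
    · rw [huv, Function.update_self]; exact hxv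
    · rw [Function.update_of_ne huv]; exact h.label_rep u
  · rw [Function.update_of_ne (fun e : u = v => hvA (e ▸ hu))]; exact h.rep_active u hu
  · rw [Function.update_of_ne (fun e : u = v => hv (e ▸ hu))]; exact h.rep_todo u (by simp [hu])
  · exact h.todo_notMem u (by simp [hu])
  · by_cases huv : u = v
    · rw [huv]; exact hK
    · exact h.large u (by simp [huv, hu]) huA

theorem IsState.insert {t : Fin n → Fin n} {K : ℝ} {v : Fin n} {vs : List (Fin n)}
    {A : Finset (Fin n)} {rep : Fin n → Fin n} (h : IsState t K (v :: vs) A rep)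
    (hv : v ∉ vs) (hK : ((A.filter fun u => t u = t v).card : ℝ) < 2 * K) :
    IsState t K vs (insert v A) rep := by
  refine ⟨fun u hu => ?_, h.label_rep, fun u hu => ?_, fun u hu => ?_, fun u hu => ?_,
    fun u hu huA => ?_, fun u => ?_⟩
  · by_cases huv : u = v
    · rw [huv, h.rep_todo v (by simp)]; simp
    · exact Finset.mem_insert_of_mem (h.rep_mem u (by simp [huv, hu]))
  · rcases Finset.mem_insert.1 hu with rfl | hu
    · exact h.rep_todo u (by simp)
    · exact h.rep_active u hu
  · exact h.rep_todo u (by simp [hu])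
  · rw [Finset.mem_insert, not_or]
    exact ⟨fun e => hv (e ▸ hu), h.todo_notMem u (by simp [hu])⟩
  · rw [Finset.mem_insert, not_or] at huA
    refine (h.large u (by simp [huA.1, hu]) huA.2).trans ?_
    exact_mod_cast Finset.card_le_card
      (Finset.filter_subset_filter _ (Finset.subset_insert v A))
  · rw [Finset.filter_insert]
    split_ifs with e
    · have h1 : ((Insert.insert v (A.filter fun x => t x = t u)).card : ℝ) ≤
          (A.filter fun x => t x = t u).card + 1 := by exact_mod_cast Finset.card_insert_le _ _
      rw [e] at hK
      linarith
    · exact h.card_le u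

/-- On the good event the test made with the optimal labeling and the test made with the truth have
the same outcome, so the run follows the path described by `usedSets`. Good behaviour is then needed
only on those sets. -/
theorem run_spec {a : Answers n} {t : Fin n → Fin n} {K M : ℝ} (hK : 0 < K)
    (hM : ∀ A : Finset (Fin n), (∀ v, ((A.filter fun u => t u = t v).card : ℝ) ≤ 2 * K + 1) →
      (A.card : ℝ) ≤ M) (vs : List (Fin n)) (hvs : vs.Nodup) (A : Finset (Fin n))
    (rep : Fin n → Fin n) (k : Answers n) (hstate : IsState t K vs A rep)
    (hk : ∀ x ∈ A, ∀ y ∈ A, wt k x y = wt a x y)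
    (hgood : ∀ Y ∈ usedSets (2 * K) t vs A, Recovers (wt a) t K Y) :
    ∃ A' rep' c, IsState t K [] A' rep' ∧ Recovers (wt a) t K A' ∧ IsOptimal (wt a) A' c ∧
      (run (2 * K) vs A rep k).output a = clusteringOf (fun v => c (rep' v)) ∧
      ((run (2 * K) vs A rep k).numQueries a : ℝ) ≤ vs.length * M := by
  classical
  induction vs generalizing A rep k with
  | nil =>
    refine ⟨A, rep, optLabeling (wt k) A, hstate, hgood A (by simp [usedSets]),
      (isOptimal_optLabeling (wt k) A).congr_weight hk, rfl, ?_⟩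
    simp [run, numQueries]
  | cons v vs ih =>
    obtain ⟨hv, hvs'⟩ := List.nodup_cons.1 hvs
    obtain ⟨k', h1, h2, h3, h4⟩ := ask_spec a (fun k' =>
      if 2 * K ≤ ((A.filter fun u =>
          optLabeling (wt k') (insert v A) u = optLabeling (wt k') (insert v A) v).card : ℝ) then
        run (2 * K) vs A
          (Function.update rep v (partner (optLabeling (wt k') (insert v A)) A v)) k'
      else run (2 * K) vs (insert v A) rep k') (pairsWith v A).toList k
    simp only [Finset.mem_toList, Finset.length_toList] at h1 h2 h4
    have hk' := wt_eq_of_pairsWith hk h1 h2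
    set c := optLabeling (wt k') (insert v A) with hc
    have hopt : IsOptimal (wt a) (insert v A) c :=
      (isOptimal_optLabeling (wt k') (insert v A)).congr_weight hk'
    obtain ⟨hex, hsm⟩ := hgood (insert v A) (by simp [usedSets]) c hopt
    have hsub : A ⊆ insert v A := Finset.subset_insert v A
    have hle : ∀ d : Fin n → Fin n, ((A.filter fun u => d u = d v).card : ℝ) ≤
        (((insert v A).filter fun u => d u = d v).card : ℝ) := fun d => by
      exact_mod_cast Finset.card_le_card (Finset.filter_subset_filter _ hsub)
    have hnext : ∀ Y ∈ usedSets (2 * K) t vs (nextActive (2 * K) t A v),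
        Recovers (wt a) t K Y := fun Y hY => hgood Y (by simp [usedSets, hY])
    have hcard : ((pairsWith v A).card : ℝ) ≤ M :=
      le_trans (by exact_mod_cast card_pairsWith_le v A) (hM A hstate.card_le)
    -- The threshold 2K serves both directions: a class with 2K points cannot belong to a point of a
    -- small cluster, and a cluster with 2K active points is large. In either case v lies in the
    -- recovered part, where class and cluster coincide.
    have hmem : 2 * K ≤ ((A.filter fun u => c u = c v).card : ℝ) ∨
        2 * K ≤ ((A.filter fun u => t u = t v).card : ℝ) → v ∈ largePart t (insert v A) K := by
      intro h
      by_contra hcon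
      rcases h with h | h
      · exact absurd (h.trans (hle c)) (not_le.2 (hsm v (by simp) hcon))
      · exact hcon (mem_largePart.2 ⟨by simp, by linarith [hle t]⟩)
    have hiff : v ∈ largePart t (insert v A) K →
        (A.filter fun u => c u = c v) = A.filter fun u => t u = t v := fun h =>
      Finset.filter_congr fun u hu => hex v h u (hsub hu)
    have hrun : (run (2 * K) (v :: vs) A rep k).output a = _ := h3
    have hnum : (run (2 * K) (v :: vs) A rep k).numQueries a = _ := h4
    by_cases hbig : 2 * K ≤ ((A.filter fun u => c u = c v).card : ℝ)
    · have hvB := hmem (Or.inl hbig)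
      rw [if_pos hbig] at hrun hnum
      have hbig' := hbig
      rw [hiff hvB] at hbig'
      have hne : ∃ u ∈ A, c u = c v := by
        have : 0 < (A.filter fun u => c u = c v).card := by
          have : (0 : ℝ) < (A.filter fun u => c u = c v).card := by linarith
          exact_mod_cast this
        obtain ⟨u, hu⟩ := Finset.card_pos.1 this
        exact ⟨u, (Finset.mem_filter.1 hu).1, (Finset.mem_filter.1 hu).2⟩
      obtain ⟨hp1, hp2⟩ := partner_spec hne
      rw [nextActive, if_pos hbig'] at hnext
      obtain ⟨A', rep', c', e1, e2, e3, e4, e5⟩ := ih hvs' A _ k'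
        (hstate.skip hv hp1 ((hex v hvB _ (hsub hp1)).1 hp2) hbig')
        (fun x hx y hy => hk' x (hsub hx) y (hsub hy)) hnext
      refine ⟨A', rep', c', e1, e2, e3, by rw [hrun, e4], ?_⟩
      rw [hnum]
      push_cast [List.length_cons]
      linarith
    · have hbig' : ¬ 2 * K ≤ ((A.filter fun u => t u = t v).card : ℝ) := fun h =>
        hbig (by rw [hiff (hmem (Or.inr h))]; exact h)
      rw [if_neg hbig] at hrun hnum
      rw [nextActive, if_neg hbig'] at hnext
      obtain ⟨A', rep', c', e1, e2, e3, e4, e5⟩ := ih hvs' (insert v A) rep k'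
        (hstate.insert hv (not_le.1 hbig')) hk' hnext
      refine ⟨A', rep', c', e1, e2, e3, by rw [hrun, e4], ?_⟩
      rw [hnum]
      push_cast [List.length_cons]
      linarith

/-- Extending an optimal labeling of the active points by the representatives is optimal. -/
theorem IsState.isOptimal {w : Fin n → Fin n → ℝ} (hw : ∀ u v, w u v = w v u)
    {t : Fin n → Fin n} {K : ℝ} (hK : 0 < K) {A : Finset (Fin n)} {rep c : Fin n → Fin n}
    (h : IsState t K [] A rep) (hA : Recovers w t K A) (hU : Recovers w t K Finset.univ)
    (hc : IsOptimal w A c) : IsOptimal w Finset.univ fun v => c (rep v) := by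
  classical
  obtain ⟨g, hg⟩ := exists_isOptimal w Finset.univ
  -- B consists of the clusters with at least K active points. A dropped point has 2K active
  -- companions, so everything outside B is active.
  set B := Finset.univ.filter fun v => K ≤ ((A.filter fun u => t u = t v).card : ℝ) with hB
  have hmB : ∀ v, v ∈ B ↔ K ≤ ((A.filter fun u => t u = t v).card : ℝ) := fun v => by simp [hB]
  have hBt : ∀ v ∈ B, ∀ u, t u = t v → u ∈ B := by
    intro v hv u huv
    rw [hmB] at hv ⊢
    rwa [huv]
  have hBA : Bᶜ ⊆ A := by
    intro v hv
    by_contra hvA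
    rw [Finset.mem_compl, hmB] at hv
    exact hv (by linarith [h.large v (by simp) hvA])
  have hgB : ∀ v ∈ B, ∀ u, (g u = g v ↔ t u = t v) := by
    intro v hv u
    refine (hU g hg).1 v (mem_largePart.2 ⟨Finset.mem_univ v, ((hmB v).1 hv).trans ?_⟩) u
      (Finset.mem_univ u)
    exact_mod_cast Finset.card_le_card (Finset.filter_subset_filter _ (Finset.subset_univ A))
  have hcB : ∀ v ∈ B, ∀ u ∈ A, ∀ x ∈ A, t x = t v → (c u = c x ↔ t u = t v) := by
    intro v hv u hu x hx hxv
    rw [← hxv]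
    exact (hA c hc).1 x (mem_largePart.2 ⟨hx, by rw [hxv]; exact (hmB v).1 hv⟩) u hu
  have hlB : ∀ v ∈ B, ∀ u, (c (rep u) = c (rep v) ↔ t u = t v) := by
    intro v hv u
    rw [hcB v hv (rep u) (h.rep_mem u (by simp)) (rep v) (h.rep_mem v (by simp)) (h.label_rep v),
      h.label_rep]
  have hsplit : ∀ l : Fin n → Fin n, (∀ v ∈ B, ∀ u, (l u = l v ↔ t u = t v)) →
      agreement w Finset.univ l = agreement w B t + agreement w Bᶜ l := by
    intro l hl
    rw [← Finset.union_compl B, agreement_union hw l disjoint_compl_right, cross_eq_zero,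
      agreement_congr (c' := t) fun u _ v hv => hl v hv u]
    · ring
    · intro u hu v hv huv
      exact Finset.mem_compl.1 hv (hBt u hu v ((hl u hu v).1 huv.symm))
  -- On B both the global optimum g and the extended labeling are the truth and separate B from the
  -- rest, so they can differ only on the complement of B. There c is optimal, because this
  -- complement is a union of classes within A.
  have hcl : IsOptimal w Bᶜ c := by
    refine hc.of_closed hw hBA fun u hu v hv huv => ?_
    rw [Finset.mem_compl] at hu ⊢
    intro hvB
    exact hu (hBt v hvB u ((hcB v hvB u (hBA (Finset.mem_compl.2 hu)) v hv rfl).1 huv))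
  have hl : agreement w Bᶜ (fun v => c (rep v)) = agreement w Bᶜ c :=
    agreement_congr fun u hu v hv => by
      simp only [h.rep_active u (hBA hu), h.rep_active v (hBA hv)]
  intro d
  refine (hg d).trans ?_
  rw [hsplit g hgB, hsplit _ hlB, hl]
  linarith [hcl g]

end Algorithm

end FaultyOracle

namespace FaultyOracle

/-! ### Query count, probability of success and the theorem -/

section Conclusion

variable {n : ℕ}

theorem card_le_of_card_filter_le {t : Fin n → Fin n} {A : Finset (Fin n)} {r : ℝ}
    (h : ∀ v, ((A.filter fun u => t u = t v).card : ℝ) ≤ r) :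
    (A.card : ℝ) ≤ (Finset.univ.image t).card * r := by
  rw [Finset.card_eq_sum_card_fiberwise (f := t) (t := Finset.univ.image t)
    fun v _ => Finset.mem_coe.2 (Finset.mem_image_of_mem t (Finset.mem_univ v))]
  push_cast
  rw [← nsmul_eq_mul]
  refine Finset.sum_le_card_nsmul _ _ _ fun i hi => ?_
  obtain ⟨v, -, rfl⟩ := Finset.mem_image.1 hi
  exact h v

theorem isState_initial (t : Fin n → Fin n) {K : ℝ} (hK : 0 < K) :
    IsState t K (List.finRange n) ∅ id where
  rep_mem v hv := absurd (List.mem_finRange v) hv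
  label_rep v := rfl
  rep_active v hv := rfl
  rep_todo v hv := rfl
  todo_notMem v hv := Finset.notMem_empty v
  large v hv := absurd (List.mem_finRange v) hv
  card_le v := by
    simp only [Finset.filter_empty, Finset.card_empty, Nat.cast_zero]
    positivity

/-- The query algorithm for `n` points and the error probability `p`. -/
noncomputable def clusterAlgorithm (n : ℕ) (p : ℝ) : QueryAlgorithm n :=
  run (2 * (1000000 * (Real.log n / (1 - 2 * p) ^ 2))) (List.finRange n) ∅ id fun _ => false

/-- The output is a global optimum by `IsState.isOptimal`, so it is an ML estimate, and recovery on
the set of all points applied to this very labeling yields the large clusters. -/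
theorem clusterAlgorithm_spec {p : ℝ} (hp0 : 0 ≤ p) (hp : p < 1 / 2) (hn : 2 ≤ n)
    {T : Clustering n} {t : Fin n → Fin n} (ht : IsLabeling T t) {a : Answers n}
    (hgood : ∀ Y ∈ insert Finset.univ (usedSets
      (2 * (1000000 * (Real.log n / (1 - 2 * p) ^ 2))) t (List.finRange n) ∅),
      Recovers (wt a) t (1000000 * (Real.log n / (1 - 2 * p) ^ 2)) Y) :
    (((clusterAlgorithm n p).numQueries a : ℕ) : ℝ) ≤
      3000000 * ((n : ℝ) * (T.parts.card : ℝ) * Real.log (n : ℝ) / (1 - 2 * p) ^ 2) ∧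
    IsMLEstimate p a ((clusterAlgorithm n p).output a) ∧
    ∀ S ∈ T.parts, 1000000 * Real.log (n : ℝ) / (1 - 2 * p) ^ 2 ≤ (S.card : ℝ) →
      S ∈ ((clusterAlgorithm n p).output a).parts := by
  have hδ : 0 < 1 - 2 * p := by linarith
  have hδ1 : (1 - 2 * p) ^ 2 ≤ 1 := by nlinarith
  have hn2 : (2 : ℝ) ≤ n := by exact_mod_cast hn
  have hlog : 1 / 2 ≤ Real.log n := by
    have h1 := Real.log_two_gt_d9
    have h2 := Real.log_le_log (by norm_num) hn2
    linarith
  have hL : 1 / 2 ≤ Real.log n / (1 - 2 * p) ^ 2 := by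
    rw [le_div_iff₀ (by positivity)]
    linarith
  set L := Real.log n / (1 - 2 * p) ^ 2 with hLdef
  set K := 1000000 * L with hKdef
  have hK : 0 < K := by positivity
  have hU : Recovers (wt a) t K Finset.univ := hgood _ (Finset.mem_insert_self _ _)
  obtain ⟨A, rep, c, h1, h2, h3, h4, h5⟩ := run_spec hK
    (M := (Finset.univ.image t).card * (2 * K + 1)) (fun A hA => card_le_of_card_filter_le hA)
    (List.finRange n) (List.nodup_finRange n) ∅ id (fun _ => false) (isState_initial t hK)
    (by simp) fun Y hY => hgood Y (Finset.mem_insert_of_mem hY)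
  have hout : (clusterAlgorithm n p).output a = clusteringOf fun v => c (rep v) := h4
  have hopt := h1.isOptimal (wt_comm a) hK h2 hU h3
  refine ⟨?_, ?_, fun S hS hSK => ?_⟩
  · refine le_trans h5 ?_
    rw [List.length_finRange, ht.card_parts]
    -- The bound L ≥ 1/2, from n ≥ 2 and δ ≤ 1, absorbs the extra 1.
    have h6 : 2 * K + 1 ≤ 3000000 * L := by rw [hKdef]; linarith
    calc (n : ℝ) * ((Finset.univ.image t).card * (2 * K + 1)) ≤
        n * ((Finset.univ.image t).card * (3000000 * L)) := by gcongr
      _ = _ := by rw [hLdef]; ring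
  · rw [hout]
    exact hopt.isMLEstimate hp0 hp
  · obtain ⟨v, rfl⟩ := (ht S).1 hS
    rw [hout, isLabeling_clusteringOf]
    refine ⟨v, Finset.filter_congr fun u _ => ((hU _ hopt).1 v (mem_largePart.2
      ⟨Finset.mem_univ v, le_trans (le_of_eq ?_) hSK⟩) u (Finset.mem_univ u)).symm⟩
    rw [hKdef, hLdef]
    ring

/-- The used sets are computed from t alone, so the union bound runs over at most n + 2 fixed sets
although the algorithm is adaptive. -/
theorem prob_not_recovers_all {p : ℝ} (hp0 : 0 ≤ p) (hp : p < 1 / 2) (hn : 2 ≤ n)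
    (t : Fin n → Fin n) :
    prob (answerLaw p t) (fun a => ¬ ∀ Y ∈ insert Finset.univ (usedSets
      (2 * (1000000 * (Real.log n / (1 - 2 * p) ^ 2))) t (List.finRange n) ∅),
      Recovers (wt a) t (1000000 * (Real.log n / (1 - 2 * p) ^ 2)) Y) ≤ 80 / ((n : ℝ) + 1) := by
  have hq := isBitLaw_answerLaw hp0 hp t
  have hn2 : (2 : ℝ) ≤ n := by exact_mod_cast hn
  set F := insert Finset.univ (usedSets
    (2 * (1000000 * (Real.log n / (1 - 2 * p) ^ 2))) t (List.finRange n) ∅) with hF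
  have hcard : (F.card : ℝ) ≤ n + 2 := by
    have h1 := Finset.card_insert_le Finset.univ (usedSets
      (2 * (1000000 * (Real.log n / (1 - 2 * p) ^ 2))) t (List.finRange n) ∅)
    have h2 := card_usedSets_le (2 * (1000000 * (Real.log n / (1 - 2 * p) ^ 2))) t
      (List.finRange n) ∅
    rw [List.length_finRange] at h2
    exact_mod_cast h1.trans (by omega)
  calc _ ≤ prob (answerLaw p t) (fun a => ∃ Y ∈ F, ¬ Recovers (wt a) t
        (1000000 * (Real.log n / (1 - 2 * p) ^ 2)) Y) :=
        prob_mono hq fun a h => by push Not at h; exact h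
    _ ≤ ∑ Y ∈ F, prob (answerLaw p t) (fun a => ¬ Recovers (wt a) t
        (1000000 * (Real.log n / (1 - 2 * p) ^ 2)) Y) := prob_exists_le hq F _
    _ ≤ ∑ _Y ∈ F, 40 / (n : ℝ) ^ 4 :=
        Finset.sum_le_sum fun Y _ => prob_not_recovers hp0 hp hn t Y
    _ = F.card * (40 / (n : ℝ) ^ 4) := by rw [Finset.sum_const, nsmul_eq_mul]
    _ ≤ (n + 2) * (40 / (n : ℝ) ^ 4) := by gcongr
    _ ≤ (2 * n) * (40 / (n : ℝ) ^ 4) := by gcongr; linarith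
    _ = 80 / (n : ℝ) ^ 3 := by field_simp; ring
    _ ≤ 80 / ((n : ℝ) + 1) := by
        gcongr
        nlinarith [mul_le_mul hn2 hn2 (by norm_num) (by linarith)]

end Conclusion

end FaultyOracle

theorem theorem2 :
    (∃ (𝒜 : (n : ℕ) → (p : ℝ) → FaultyOracle.QueryAlgorithm n) (C₁ C₂ : ℝ) (ε : ℕ → ℝ),
      0 < C₁ ∧ 0 < C₂ ∧ Tendsto ε atTop (𝓝 0) ∧
      ∀ (n : ℕ) (p : ℝ), 0 ≤ p → p < 1 / 2 → ∀ T : FaultyOracle.Clustering n,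
        1 - ε n ≤ (FaultyOracle.oracleLaw p T).real
          {a : FaultyOracle.Answers n |
            (((𝒜 n p).numQueries a : ℕ) : ℝ) ≤
              C₁ * ((n : ℝ) * (T.parts.card : ℝ) * Real.log (n : ℝ) / (1 - 2 * p) ^ 2) ∧
            FaultyOracle.IsMLEstimate p a ((𝒜 n p).output a) ∧
            ∀ S ∈ T.parts, C₂ * Real.log (n : ℝ) / (1 - 2 * p) ^ 2 ≤ (S.card : ℝ) →
              S ∈ ((𝒜 n p).output a).parts}) ∧
    (∀ p₀ : ℝ, 0 < p₀ → ∃ C₃ : ℝ, 0 < C₃ ∧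
      ∀ (n k : ℕ) (p : ℝ), p₀ ≤ p → p < 1 / 2 →
        (n : ℝ) * (k : ℝ) * Real.log (n : ℝ) / (1 - 2 * p) ^ 2 ≤
          C₃ * Real.log (n : ℝ) *
            ((n : ℝ) * (k : ℝ) / FaultyOracle.jsBernoulli p (1 - p))) := by
  refine ⟨⟨FaultyOracle.clusterAlgorithm, 3000000, 1000000, fun n => 80 / ((n : ℝ) + 1),
    by norm_num, by norm_num, ?_, fun n p hp0 hp T => ?_⟩,
    fun p₀ hp₀ => ⟨1 / p₀, by positivity, fun n k p h hp =>
      FaultyOracle.le_div_jsBernoulli hp₀ n k h hp⟩⟩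
  · exact tendsto_const_nhds.div_atTop
      (tendsto_atTop_add_const_right _ _ tendsto_natCast_atTop_atTop)
  · rcases lt_or_ge n 2 with hn | hn
    · have h1 : (n : ℝ) + 1 ≤ 2 := by exact_mod_cast (by omega : n + 1 ≤ 2)
      have h2 : 1 ≤ 80 / ((n : ℝ) + 1) := by
        rw [le_div_iff₀ (by positivity)]
        linarith
      have h3 : 1 - 80 / ((n : ℝ) + 1) ≤ 0 := by linarith
      exact h3.trans measureReal_nonneg
    · obtain ⟨t, ht⟩ := FaultyOracle.exists_isLabeling T
      rw [ht.real_oracleLaw hp0 hp]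
      have h1 := FaultyOracle.prob_not_recovers_all hp0 hp hn t
      rw [FaultyOracle.prob_not (FaultyOracle.isBitLaw_answerLaw hp0 hp t)] at h1
      refine le_trans ?_ (FaultyOracle.prob_mono (FaultyOracle.isBitLaw_answerLaw hp0 hp t)
        fun a => FaultyOracle.clusterAlgorithm_spec hp0 hp hn ht)
      linarith
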